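/- Consider, for real constants $\alpha,\beta,\gamma,\kappa$, the equation $$\Delta\equiv u_{tt}-(\kappa u+\gamma u^2)_{xx}-u\,u_{xxxx}-\mu u_{xxtt}-\alpha u_xu_{xxx}-\beta u_{xx}^2=0\qquad\text{with }\mu=0 .$$ Let $X,T,U\subseteq\mathbb R$ be non-empty open intervals and let $\xi,\phi$ be smooth functions of $(x,t,u)\in X\times T\times U$. The field $\mathbf v=\xi\partial_x+\partial_t+\phi\partial_u$ (that is, $\tau=1$) is a *nonclassical symmetry* if $\mathrm{pr}^{(4)}\mathbf v(\Delta)=0$ at all jets with $(x,t,u)\in X\times T\times U$ and $u\neq0$ at which $\Delta=0$ and at which $\xi u_x+u_t-\phi=0$ holds together with its total derivatives of order at most three. (After elimination of $u_{tt}$ the coefficient of $u_{xxxx}$ in $\Delta$ is $-u$.) A field $\mathbf w=\xi\partial_x+\tau\partial_t+\phi\partial_u$ is a *classical symmetry* if $\mathrm{pr}^{(4)}\mathbf w(\Delta)=0$ at all jets over $X\times T\times U$ with $\Delta=0$. A nonclassical symmetry $\mathbf v$ is *genuinely nonclassical* if no multiple $\lambda(x,t,u)\mathbf v$, with $\lambda$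 smooth and nowhere zero on $X\times T\times U$, is a classical symmetry. All functions below are real and smooth, and $c_0,c_1,\dots$ are real constants. **Infinitesimals.** Each of the following is a nonclassical symmetry: 1. $\kappa=0$, $\xi=0$, $\phi=g(t)u$, where $g''+gg'-g^3=0$ on $T$; 2. $\alpha=\beta=\gamma=0$, $\xi=s$ with $s=\pm\sqrt\kappa$ (so $\kappa\ge0$), $\phi=c_3y^3+c_2y^2+c_1y+c_0$, $y=x+st$; 3. $\alpha=\beta=\gamma=\kappa=0$, $\xi=0$, $\phi=-\dfrac{g'}{g}u+g\,Q(x)$, $Q(x)=c_4x^4+c_3x^3+c_2x^2+c_1x+c_0$, where $g$ has no zero on $T$ and $g^2g'''-4gg'g''+2g'^3+24c_4g^4=0$ on $T$. A field $\xi\partial_x+\partial_t+\phi\partial_u$ with smooth $\xi,\phi$ on $X\times T\times U$ is genuinely nonclassical if and only if it is of form 1 with $2g'\not\equiv g^2$ on $T$, or of form 2 with $(c_0,\dots,c_3)\ne0$, or of form 3 with $(c_0,\dots,c_4)\neq0$. **Reduction 1.** Let $g$ be smooth on $T$, $g\not\equiv0$. Then $g''+gg'-g^3=0$ on $T$ if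 and only if there are constants $c_1,c_2$ and a smooth nowhere zero $\psi$ on $T$ with $g=\psi'/\psi$ and $$\psi'^2=4c_1\psi^3+c_2 .$$ For all such $\psi,c_1,c_2$: $(c_1,c_2)\ne(0,0)$; if $c_1=0$ then $\psi=at+b$ with $a\neq0$ and $a^2=c_2$; if $c_2=0$ then $\psi=[c_1(t+c_3)^2]^{-1}$ for some $c_3$; if $c_1c_2\ne0$ then $P=c_1\psi$ satisfies the Weierstrass equation $P'^2=4P^3-g_3$ with $g_3=-c_1^2c_2$. If moreover $\kappa=0$, then a smooth $u$ on $X\times T$ solves both $\Delta=0$ and $u_t=gu$ if and only if $u=w(x)\psi(t)$ with $w$ smooth on $X$ and $$ww''''+\alpha w'w'''+\beta w''^2+2\gamma(ww''+w'^2)-6c_1w=0 .$$ **Reduction 2.** Let $\alpha=\beta=\gamma=0$, $\kappa=s^2$, $s\ne0$, $y=x+st$, $z=x-st$. For a smooth $u$ on $X\times T$ the following are equivalent: (a) $u$ solves $\Delta=0$ and $su_x+u_t=c_3y^3+c_2y^2+c_1y+c_0$; (b) $u=w(z)+\frac{c_3}{8s}y^4+\frac{c_2}{6s}y^3+\frac{c_1}{4s}y^2+c_0t$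 with $w$ smooth and $s\,w''''+3c_3=0$; (c) for some constants $c_4,\dots,c_7$, $$u=-\tfrac{c_3}{8s}z^4+c_4z^3+c_5z^2+c_6z+c_7+\tfrac{c_3}{8s}y^4+\tfrac{c_2}{6s}y^3+\tfrac{c_1}{4s}y^2+c_0t .$$ **Reduction 3.** Let $\alpha=\beta=\gamma=\kappa=0$, let $g$ be smooth without zeros on $T$, $G'=g^2$ on $T$, and $Q=c_4x^4+c_3x^3+c_2x^2+c_1x+c_0$. Then $g^2g'''-4gg'g''+2g'^3+24c_4g^4=0$ on $T$ if and only if for some constant $c_5$ $$gg''-2g'^2+24c_4\,gG+24c_5\,g=0\quad\text{on }T.$$ For every $c_5$ for which this holds and every smooth $u\not\equiv0$ on $X\times T$ the following are equivalent: (a) $u$ solves $\Delta=0$ and $u_t=-\frac{g'}gu+gQ$; (b) $u=\frac1g[w(x)+Q(x)G(t)]$ with $w$ smooth on $X$ and $w''''-24c_5=0$; (c) for some constants $c_6,\dots,c_9$, $$u=\frac1g\left[c_5x^4+c_6x^3+c_7x^2+c_8x+c_9+Q(x)G(t)\right].$$ -/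

import Mathlib

open Set
open scoped ContDiff

noncomputable section

/-- Infinite jets of functions `u(x,t)`: `(x, t, p)`, where `p i k` is the coordinate
`∂_x^i ∂_t^k u`. -/
abbrev Jet : Type := ℝ × ℝ × (ℕ → ℕ → ℝ)

namespace Jet

/-- The independent variable `x`. -/
def x (j : Jet) : ℝ := j.1

/-- The independent variable `t`. -/
def t (j : Jet) : ℝ := j.2.1

/-- The jet coordinate `∂_x^i ∂_t^k u`. -/
def u (j : Jet) (i k : ℕ) : ℝ := j.2.2 i k

end Jet

/-- The total derivative `D_x = ∂_x + ∑ u_{i+1,k} ∂/∂u_{i,k}`, i.e. the derivative along the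
direction in which `x` has speed `1`, `t` has speed `0` and `u_{i,k}` has speed `u_{i+1,k}`. -/
def totalDx (F : Jet → ℝ) (j : Jet) : ℝ :=
  deriv (fun s : ℝ => F (j + s • ((1, 0, fun i k => j.u (i + 1) k) : Jet))) 0

/-- The total derivative `D_t = ∂_t + ∑ u_{i,k+1} ∂/∂u_{i,k}`. -/
def totalDt (F : Jet → ℝ) (j : Jet) : ℝ :=
  deriv (fun s : ℝ => F (j + s • ((0, 1, fun i k => j.u i (k + 1)) : Jet))) 0

/-- A vector field `ξ(x,t,u) ∂_x + τ(x,t,u) ∂_t + φ(x,t,u) ∂_u`. -/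
structure PointField where
  ξ : ℝ → ℝ → ℝ → ℝ
  τ : ℝ → ℝ → ℝ → ℝ
  φ : ℝ → ℝ → ℝ → ℝ

namespace PointField

/-- The function `ψ = ξ u_x + τ u_t - φ` on jets; `ψ = 0` is the invariant surface condition. -/
def surface (v : PointField) (j : Jet) : ℝ :=
  v.ξ j.x j.t (j.u 0 0) * j.u 1 0 + v.τ j.x j.t (j.u 0 0) * j.u 0 1 - v.φ j.x j.t (j.u 0 0)

/-- The coefficient of `∂/∂u_{i,k}` in the prolongation of `v`:
`D_x^i D_t^k (φ - ξ u_x - τ u_t) + ξ u_{i+1,k} + τ u_{i,k+1}`. -/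
def prCoeff (v : PointField) (i k : ℕ) (j : Jet) : ℝ :=
  totalDx^[i] (totalDt^[k] (fun j' => -v.surface j')) j
    + v.ξ j.x j.t (j.u 0 0) * j.u (i + 1) k + v.τ j.x j.t (j.u 0 0) * j.u i (k + 1)

/-- The prolonged vector field `pr v = ξ ∂_x + τ ∂_t + ∑ φ^{i,k} ∂/∂u_{i,k}` applied to a
function on jets.  On functions of order four it is the fourth prolongation. -/
def pr (v : PointField) (F : Jet → ℝ) (j : Jet) : ℝ :=
  deriv (fun s : ℝ => F (j + s • ((v.ξ j.x j.t (j.u 0 0), v.τ j.x j.t (j.u 0 0),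
    fun i k => v.prCoeff i k j) : Jet))) 0

/-- The product of a function and a vector field. -/
def smulFun (l : ℝ → ℝ → ℝ → ℝ) (v : PointField) : PointField where
  ξ := fun x t u => l x t u * v.ξ x t u
  τ := fun x t u => l x t u * v.τ x t u
  φ := fun x t u => l x t u * v.φ x t u

/-- The field `ξ ∂_x + ∂_t + φ ∂_u` (the normalization `τ = 1`). -/
def unitTau (ξ φ : ℝ → ℝ → ℝ → ℝ) : PointField where
  ξ := ξ
  τ := fun _ _ _ => 1
  φ := φ

end PointField

/-- `Δ = u_tt - (κ u + γ u²)_xx - u u_xxxx - μ u_xxtt - α u_x u_xxx - β u_xx²`. -/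
def Delta (α β γ κ μ : ℝ) (j : Jet) : ℝ :=
  j.u 0 2 - (κ * j.u 2 0 + 2 * γ * (j.u 0 0 * j.u 2 0 + j.u 1 0 ^ 2))
    - j.u 0 0 * j.u 4 0 - μ * j.u 2 2 - α * (j.u 1 0 * j.u 3 0) - β * j.u 2 0 ^ 2

/-- Smoothness of a function of `(x,t,u)` on the box `X × T × U`. -/
def SmoothOnBox (X T U : Set ℝ) (f : ℝ → ℝ → ℝ → ℝ) : Prop :=
  ContDiffOn ℝ ∞ (fun p : ℝ × ℝ × ℝ => f p.1 p.2.1 p.2.2) (X ×ˢ T ×ˢ U)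

/-- `v` is a classical (Lie point) symmetry of `Δ = 0` over the box `X × T × U`:
`pr v (Δ) = 0` wherever `Δ = 0`. -/
def IsClassicalSymmetry (α β γ κ μ : ℝ) (X T U : Set ℝ) (v : PointField) : Prop :=
  ∀ j : Jet, j.x ∈ X → j.t ∈ T → j.u 0 0 ∈ U →
    Delta α β γ κ μ j = 0 → v.pr (Delta α β γ κ μ) j = 0

/-- `ξ ∂_x + ∂_t + φ ∂_u` is a nonclassical (Bluman-Cole) symmetry of `Δ = 0` over the box
`X × T × U`: `pr v (Δ) = 0` wherever `Δ = 0` and `ψ = 0`, together with the differential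
consequences of `ψ = 0` up to order four in `u`.
After elimination of `u_tt` and `u_xxtt` by `ψ = 0`, the coefficient of `u_xxxx` in `Δ` is
`-(u + μ ξ²)`; as usual, jets at which this leading coefficient vanishes, so that the reduced
equation cannot be solved for `u_xxxx`, are left out. -/
def IsNonclassicalSymmetry (α β γ κ μ : ℝ) (X T U : Set ℝ) (ξ φ : ℝ → ℝ → ℝ → ℝ) : Prop :=
  ∀ j : Jet, j.x ∈ X → j.t ∈ T → j.u 0 0 ∈ U →
    j.u 0 0 + μ * ξ j.x j.t (j.u 0 0) ^ 2 ≠ 0 →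
    Delta α β γ κ μ j = 0 →
    (∀ i k : ℕ, i + k ≤ 3 →
      totalDx^[i] (totalDt^[k] (PointField.unitTau ξ φ).surface) j = 0) →
    (PointField.unitTau ξ φ).pr (Delta α β γ κ μ) j = 0

/-- Some multiple of `ξ ∂_x + ∂_t + φ ∂_u` by a smooth nowhere vanishing function (which has the
same invariant surfaces) is a classical symmetry. -/
def IsClassicalUpToFactor (α β γ κ μ : ℝ) (X T U : Set ℝ) (ξ φ : ℝ → ℝ → ℝ → ℝ) : Prop :=
  ∃ l : ℝ → ℝ → ℝ → ℝ, SmoothOnBox X T U l ∧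
    (∀ x ∈ X, ∀ t ∈ T, ∀ u ∈ U, l x t u ≠ 0) ∧
    IsClassicalSymmetry α β γ κ μ X T U ((PointField.unitTau ξ φ).smulFun l)

/-- A nonclassical symmetry that does not come from a classical one. -/
def IsGenuinelyNonclassical (α β γ κ μ : ℝ) (X T U : Set ℝ) (ξ φ : ℝ → ℝ → ℝ → ℝ) : Prop :=
  IsNonclassicalSymmetry α β γ κ μ X T U ξ φ ∧ ¬ IsClassicalUpToFactor α β γ κ μ X T U ξ φ

/-- The infinitesimal `φ = g(t) u`. -/
def phiOne (g : ℝ → ℝ) (_x t u : ℝ) : ℝ := g t * u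

/-- The infinitesimal `φ = c₃ y³ + c₂ y² + c₁ y + c₀`, `y = x + s t`. -/
def phiTwo (s c₀ c₁ c₂ c₃ : ℝ) (x t _u : ℝ) : ℝ :=
  c₃ * (x + s * t) ^ 3 + c₂ * (x + s * t) ^ 2 + c₁ * (x + s * t) + c₀

/-- The polynomial `c₄ x⁴ + c₃ x³ + c₂ x² + c₁ x + c₀`. -/
def quartic (c₀ c₁ c₂ c₃ c₄ x : ℝ) : ℝ :=
  c₄ * x ^ 4 + c₃ * x ^ 3 + c₂ * x ^ 2 + c₁ * x + c₀

/-- The infinitesimal `φ = -u g'/g + g (c₄ x⁴ + c₃ x³ + c₂ x² + c₁ x + c₀)`. -/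
def phiThree (g : ℝ → ℝ) (c₀ c₁ c₂ c₃ c₄ : ℝ) (x t u : ℝ) : ℝ :=
  -(u / g t) * deriv g t + g t * quartic c₀ c₁ c₂ c₃ c₄ x

/-- `g'' + g g' - g³ = 0` on `T`. -/
def SolvesOdeOne (T : Set ℝ) (g : ℝ → ℝ) : Prop :=
  ∀ t ∈ T, iteratedDeriv 2 g t + g t * deriv g t - g t ^ 3 = 0

/-- `g² g''' - 4 g g' g'' + 2 g'³ + 24 c₄ g⁴ = 0` on `T`. -/
def SolvesOdeThree (T : Set ℝ) (c₄ : ℝ) (g : ℝ → ℝ) : Prop :=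
  ∀ t ∈ T, g t ^ 2 * iteratedDeriv 3 g t - 4 * g t * deriv g t * iteratedDeriv 2 g t
    + 2 * deriv g t ^ 3 + 24 * c₄ * g t ^ 4 = 0

/-- First kind: `κ = 0`, `ξ = 0`, `φ = g(t) u` with `g'' + g g' - g³ = 0`. -/
def KindOne (κ : ℝ) (X T U : Set ℝ) (ξ φ : ℝ → ℝ → ℝ → ℝ) (g : ℝ → ℝ) : Prop :=
  κ = 0 ∧ ContDiffOn ℝ ∞ g T ∧ SolvesOdeOne T g ∧
    ∀ x ∈ X, ∀ t ∈ T, ∀ u ∈ U, ξ x t u = 0 ∧ φ x t u = phiOne g x t u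

/-- Second kind: `α = β = γ = 0`, `ξ = s` with `s = ±√κ` (i.e. `s² = κ`), and `φ` a cubic
polynomial in `x + s t`. -/
def KindTwo (α β γ κ : ℝ) (X T U : Set ℝ) (ξ φ : ℝ → ℝ → ℝ → ℝ) (s c₀ c₁ c₂ c₃ : ℝ) : Prop :=
  α = 0 ∧ β = 0 ∧ γ = 0 ∧ s ^ 2 = κ ∧
    ∀ x ∈ X, ∀ t ∈ T, ∀ u ∈ U, ξ x t u = s ∧ φ x t u = phiTwo s c₀ c₁ c₂ c₃ x t u

/-- Third kind: `α = β = γ = κ = 0`, `ξ = 0`, `φ = -u g'/g + g · (quartic in x)`, where `g` solves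
a third order equation. -/
def KindThree (α β γ κ : ℝ) (X T U : Set ℝ) (ξ φ : ℝ → ℝ → ℝ → ℝ) (g : ℝ → ℝ)
    (c₀ c₁ c₂ c₃ c₄ : ℝ) : Prop :=
  α = 0 ∧ β = 0 ∧ γ = 0 ∧ κ = 0 ∧ ContDiffOn ℝ ∞ g T ∧ (∀ t ∈ T, g t ≠ 0) ∧
    SolvesOdeThree T c₄ g ∧
    ∀ x ∈ X, ∀ t ∈ T, ∀ u ∈ U, ξ x t u = 0 ∧ φ x t u = phiThree g c₀ c₁ c₂ c₃ c₄ x t u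

/-- The infinite jet of a function `u(x,t)` at a point. -/
def jetOf (u : ℝ → ℝ → ℝ) (x t : ℝ) : Jet :=
  (x, t, fun i k => iteratedDeriv i (fun x' => iteratedDeriv k (fun t' => u x' t') t) x)

/-- Smoothness of a function of `(x,t)` on `X × T`. -/
def SmoothOnRect (X T : Set ℝ) (u : ℝ → ℝ → ℝ) : Prop :=
  ContDiffOn ℝ ∞ (fun p : ℝ × ℝ => u p.1 p.2) (X ×ˢ T)

/-- `u` is a solution on `X × T` of both `Δ = 0` and the invariant surface condition
`ξ u_x + u_t = φ`. -/
def IsInvariantSolution (α β γ κ μ : ℝ) (X T : Set ℝ) (ξ φ : ℝ → ℝ → ℝ → ℝ)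
    (u : ℝ → ℝ → ℝ) : Prop :=
  ∀ x ∈ X, ∀ t ∈ T, Delta α β γ κ μ (jetOf u x t) = 0 ∧
    (PointField.unitTau ξ φ).surface (jetOf u x t) = 0

/-- `ψ` is smooth and nowhere zero on `T`, `g = (log ψ)'`, and `ψ'² = 4 c₁ ψ³ + c₂`. -/
def IsLogPrimitive (T : Set ℝ) (g ψ : ℝ → ℝ) (c₁ c₂ : ℝ) : Prop :=
  ContDiffOn ℝ ∞ ψ T ∧ ∀ t ∈ T, ψ t ≠ 0 ∧ g t = deriv ψ t / ψ t ∧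
    deriv ψ t ^ 2 = 4 * c₁ * ψ t ^ 3 + c₂

end

/-!
The proof has three parts: the determining equations of the nonclassical symmetries, their complete
solution, and the integration of the equations for the invariant solutions.

*Determining equations.* For every choice of `x, t, u, u_x, u_xx, …` there is exactly one jet that
satisfies `ξ u_x + u_t - φ = 0` and its differential consequences (`exists_jet_surface`), so on such
jets the `t`-derivatives can be expressed by `x`-derivatives and the symmetry condition becomes an
implication between two explicit expressions in `x, t, u, u_x, …, u_xxxx`
(`isNonclassicalSymmetry_iff`). Since `u ≠ 0`, the equation `Δ = 0` can be solved for `u_xxxx`, and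
there remains a polynomial in `u_x, u_xx, u_xxx` whose coefficients must vanish. Its highest
coefficients give `ξ = a(x, t)` and an Euler equation in `u` for `φ`, so that `φ = A + C u` or, for
`α = 4`, `β = 3`, `φ = A / u + C u`; in the second case the remaining coefficients force `A = 0`
(`laurent_eq_zero`). Thus every nonclassical symmetry is affine in `u`, and `a, A, C` satisfy the
equations collected in `AffineSystem` (`IsNonclassicalSymmetry.exists_affineSystem`). Conversely,
these equations imply that the field is a nonclassical symmetry.

*Solution.* Always `C_xx = 0` (`px_px_C_eq_zero`). For `κ = 0` one finds `C = 4 a_x + 2 m` and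
`a_t = m a` with `m = m(t)` (`exists_rate`). If `a ≢ 0`, then `m' = m²`, and for `A = 0` the multiple
of the field by `exp (-∫ m)` is classical (`isClassicalUpToFactor_of_affineSystem`); if `a = 0`, then
`C` depends on `t` only, and the equation for `C` gives the first family when `A = 0` and the third
when `A ≢ 0`, while `a ≢ 0`, `A ≢ 0` is impossible. For `κ ≠ 0` the coefficient of `u u_xx` is a
polynomial identity in `x` (`u2_polynomial`) which, with an elimination in `t`
(`px_a_C_contradiction`), leaves only `C = 2 a_x`, `a_t = -a a_x`. For `A = 0` the field is again
classical up to a factor, and for `A ≢ 0` the function `a` is constant with `a² = κ` and `A` is a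
cubic polynomial in `x + a t`, which is the second family. Many of these steps divide by a function
that may have zeros; they are carried out on a smaller rectangle where it has none. Within the three
families, a factor that makes the field classical depends on `t` only and is affine
(`IsClassicalUpToFactor.exists_affine_factor`), which happens exactly for the degenerate members.

*Reductions.* For `g = ψ'/ψ` the equation for `g` says that `(ψ'' / ψ²)' = 0`, and `ψ'` is an
integrating factor of `ψ'' = 6 c₁ ψ²`. The invariant surface condition is linear along its
characteristics and fixes the dependence of `u` on one variable up to a function `w` of the other;
on such `u`, the expression `Δ` is a multiple of the reduced equation for `w`. Where this multiple
contains the factor `u`, it is cancelled by density of `{u ≠ 0}`: on an open set with `u = 0` the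
reduced equation is checked directly, or excluded by connectedness.
-/

/-! ### Partial derivatives on a box -/

/-- The partial derivative `∂f/∂x` of a function of `(x, t, u)`. -/
noncomputable def dX (f : ℝ → ℝ → ℝ → ℝ) (x t u : ℝ) : ℝ := deriv (fun s => f s t u) x

/-- The partial derivative `∂f/∂t` of a function of `(x, t, u)`. -/
noncomputable def dT (f : ℝ → ℝ → ℝ → ℝ) (x t u : ℝ) : ℝ := deriv (fun s => f x s u) t

/-- The partial derivative `∂f/∂u` of a function of `(x, t, u)`. -/
noncomputable def dU (f : ℝ → ℝ → ℝ → ℝ) (x t u : ℝ) : ℝ := deriv (fun s => f x t s) u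

/-- Equality of two functions of `(x, t, u)` on the box `X × T × U`. -/
def EqOnBox (X T U : Set ℝ) (f g : ℝ → ℝ → ℝ → ℝ) : Prop :=
  ∀ x ∈ X, ∀ t ∈ T, ∀ u ∈ U, f x t u = g x t u

section Box

variable {X T U : Set ℝ} {f g : ℝ → ℝ → ℝ → ℝ} {x t u : ℝ}

theorem EqOnBox.symm (h : EqOnBox X T U f g) : EqOnBox X T U g f :=
  fun x hx t ht u hu => (h x hx t ht u hu).symm

theorem EqOnBox.congr_dX (hX : IsOpen X) (h : EqOnBox X T U f g) : EqOnBox X T U (dX f) (dX g) :=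
  fun x hx t ht u hu => Filter.EventuallyEq.deriv_eq <| by
    filter_upwards [hX.mem_nhds hx] with y hy using h y hy t ht u hu

theorem EqOnBox.congr_dT (hT : IsOpen T) (h : EqOnBox X T U f g) : EqOnBox X T U (dT f) (dT g) :=
  fun x hx t ht u hu => Filter.EventuallyEq.deriv_eq <| by
    filter_upwards [hT.mem_nhds ht] with y hy using h x hx y hy u hu

theorem EqOnBox.congr_dU (hU : IsOpen U) (h : EqOnBox X T U f g) : EqOnBox X T U (dU f) (dU g) :=
  fun x hx t ht u hu => Filter.EventuallyEq.deriv_eq <| by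
    filter_upwards [hU.mem_nhds hu] with y hy using h x hx t ht y hy

theorem SmoothOnBox.congr (hf : SmoothOnBox X T U f) (h : EqOnBox X T U g f) :
    SmoothOnBox X T U g :=
  ContDiffOn.congr hf fun p hp => h p.1 hp.1 p.2.1 hp.2.1 p.2.2 hp.2.2

theorem SmoothOnBox.contDiffAt (hX : IsOpen X) (hT : IsOpen T) (hU : IsOpen U)
    (hf : SmoothOnBox X T U f) (hx : x ∈ X) (ht : t ∈ T) (hu : u ∈ U) :
    ContDiffAt ℝ ∞ (fun p : ℝ × ℝ × ℝ => f p.1 p.2.1 p.2.2) (x, t, u) :=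
  ContDiffOn.contDiffAt hf ((hX.prod (hT.prod hU)).mem_nhds ⟨hx, ht, hu⟩)

theorem SmoothOnBox.hasFDerivAt (hX : IsOpen X) (hT : IsOpen T) (hU : IsOpen U)
    (hf : SmoothOnBox X T U f) (hx : x ∈ X) (ht : t ∈ T) (hu : u ∈ U) :
    HasFDerivAt (fun p : ℝ × ℝ × ℝ => f p.1 p.2.1 p.2.2)
      (fderiv ℝ (fun p : ℝ × ℝ × ℝ => f p.1 p.2.1 p.2.2) (x, t, u)) (x, t, u) :=
  ((hf.contDiffAt hX hT hU hx ht hu).differentiableAt (by simp)).hasFDerivAt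

theorem SmoothOnBox.hasDerivAt_fderiv (hX : IsOpen X) (hT : IsOpen T) (hU : IsOpen U)
    (hf : SmoothOnBox X T U f) (hx : x ∈ X) (ht : t ∈ T) (hu : u ∈ U) {c₁ c₂ c₃ : ℝ → ℝ}
    {a b c s₀ : ℝ} (h₁ : HasDerivAt c₁ a s₀) (h₂ : HasDerivAt c₂ b s₀) (h₃ : HasDerivAt c₃ c s₀)
    (e₁ : c₁ s₀ = x) (e₂ : c₂ s₀ = t) (e₃ : c₃ s₀ = u) :
    HasDerivAt (fun s => f (c₁ s) (c₂ s) (c₃ s))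
      (fderiv ℝ (fun p : ℝ × ℝ × ℝ => f p.1 p.2.1 p.2.2) (x, t, u) (a, b, c)) s₀ := by
  subst e₁ e₂ e₃
  exact (hf.hasFDerivAt hX hT hU hx ht hu).comp_hasDerivAt (f := fun s => (c₁ s, c₂ s, c₃ s)) s₀
    (h₁.prodMk (h₂.prodMk h₃))

theorem SmoothOnBox.dX_eq (hX : IsOpen X) (hT : IsOpen T) (hU : IsOpen U)
    (hf : SmoothOnBox X T U f) (hx : x ∈ X) (ht : t ∈ T) (hu : u ∈ U) :
    dX f x t u = fderiv ℝ (fun p : ℝ × ℝ × ℝ => f p.1 p.2.1 p.2.2) (x, t, u) (1, 0, 0) :=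
  (hf.hasDerivAt_fderiv hX hT hU hx ht hu (hasDerivAt_id x) (hasDerivAt_const x t)
    (hasDerivAt_const x u) rfl rfl rfl).deriv

theorem SmoothOnBox.dT_eq (hX : IsOpen X) (hT : IsOpen T) (hU : IsOpen U)
    (hf : SmoothOnBox X T U f) (hx : x ∈ X) (ht : t ∈ T) (hu : u ∈ U) :
    dT f x t u = fderiv ℝ (fun p : ℝ × ℝ × ℝ => f p.1 p.2.1 p.2.2) (x, t, u) (0, 1, 0) :=
  (hf.hasDerivAt_fderiv hX hT hU hx ht hu (hasDerivAt_const t x) (hasDerivAt_id t)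
    (hasDerivAt_const t u) rfl rfl rfl).deriv

theorem SmoothOnBox.dU_eq (hX : IsOpen X) (hT : IsOpen T) (hU : IsOpen U)
    (hf : SmoothOnBox X T U f) (hx : x ∈ X) (ht : t ∈ T) (hu : u ∈ U) :
    dU f x t u = fderiv ℝ (fun p : ℝ × ℝ × ℝ => f p.1 p.2.1 p.2.2) (x, t, u) (0, 0, 1) :=
  (hf.hasDerivAt_fderiv hX hT hU hx ht hu (hasDerivAt_const u x) (hasDerivAt_const u t)
    (hasDerivAt_id u) rfl rfl rfl).deriv

/-- The chain rule for a function of `(x, t, u)` along a curve. -/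
theorem SmoothOnBox.hasDerivAt_comp (hX : IsOpen X) (hT : IsOpen T) (hU : IsOpen U)
    (hf : SmoothOnBox X T U f) (hx : x ∈ X) (ht : t ∈ T) (hu : u ∈ U) {c₁ c₂ c₃ : ℝ → ℝ}
    {a b c s₀ : ℝ} (h₁ : HasDerivAt c₁ a s₀) (h₂ : HasDerivAt c₂ b s₀) (h₃ : HasDerivAt c₃ c s₀)
    (e₁ : c₁ s₀ = x) (e₂ : c₂ s₀ = t) (e₃ : c₃ s₀ = u) :
    HasDerivAt (fun s => f (c₁ s) (c₂ s) (c₃ s))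
      (dX f x t u * a + dT f x t u * b + dU f x t u * c) s₀ := by
  convert hf.hasDerivAt_fderiv hX hT hU hx ht hu h₁ h₂ h₃ e₁ e₂ e₃ using 1
  rw [hf.dX_eq hX hT hU hx ht hu, hf.dT_eq hX hT hU hx ht hu, hf.dU_eq hX hT hU hx ht hu]
  have : ((a, b, c) : ℝ × ℝ × ℝ)
      = a • ((1, 0, 0) : ℝ × ℝ × ℝ) + b • ((0, 1, 0) : ℝ × ℝ × ℝ) + c • ((0, 0, 1) : ℝ × ℝ × ℝ) := by
    simp
  rw [this, map_add, map_add, map_smul, map_smul, map_smul]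
  simp only [smul_eq_mul]
  ring

theorem SmoothOnBox.hasDerivAt_x (hX : IsOpen X) (hT : IsOpen T) (hU : IsOpen U)
    (hf : SmoothOnBox X T U f) (hx : x ∈ X) (ht : t ∈ T) (hu : u ∈ U) :
    HasDerivAt (fun s => f s t u) (dX f x t u) x := by
  simpa using hf.hasDerivAt_comp hX hT hU hx ht hu (hasDerivAt_id x) (hasDerivAt_const x t)
    (hasDerivAt_const x u) rfl rfl rfl

theorem SmoothOnBox.hasDerivAt_t (hX : IsOpen X) (hT : IsOpen T) (hU : IsOpen U)
    (hf : SmoothOnBox X T U f) (hx : x ∈ X) (ht : t ∈ T) (hu : u ∈ U) :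
    HasDerivAt (fun s => f x s u) (dT f x t u) t := by
  simpa using hf.hasDerivAt_comp hX hT hU hx ht hu (hasDerivAt_const t x) (hasDerivAt_id t)
    (hasDerivAt_const t u) rfl rfl rfl

theorem SmoothOnBox.hasDerivAt_u (hX : IsOpen X) (hT : IsOpen T) (hU : IsOpen U)
    (hf : SmoothOnBox X T U f) (hx : x ∈ X) (ht : t ∈ T) (hu : u ∈ U) :
    HasDerivAt (fun s => f x t s) (dU f x t u) u := by
  simpa using hf.hasDerivAt_comp hX hT hU hx ht hu (hasDerivAt_const u x) (hasDerivAt_const u t)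
    (hasDerivAt_id u) rfl rfl rfl

theorem SmoothOnBox.fderiv_apply (hX : IsOpen X) (hT : IsOpen T) (hU : IsOpen U)
    (hf : SmoothOnBox X T U f) (w : ℝ × ℝ × ℝ) :
    SmoothOnBox X T U
      (fun x t u => fderiv ℝ (fun p : ℝ × ℝ × ℝ => f p.1 p.2.1 p.2.2) (x, t, u) w) :=
  (ContDiffOn.fderiv_of_isOpen hf (hX.prod (hT.prod hU)) (m := ∞) (by simp)).clm_apply
    contDiffOn_const

theorem SmoothOnBox.smooth_dX (hX : IsOpen X) (hT : IsOpen T) (hU : IsOpen U)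
    (hf : SmoothOnBox X T U f) : SmoothOnBox X T U (dX f) :=
  (hf.fderiv_apply hX hT hU (1, 0, 0)).congr fun _ hx _ ht _ hu => hf.dX_eq hX hT hU hx ht hu

theorem SmoothOnBox.smooth_dT (hX : IsOpen X) (hT : IsOpen T) (hU : IsOpen U)
    (hf : SmoothOnBox X T U f) : SmoothOnBox X T U (dT f) :=
  (hf.fderiv_apply hX hT hU (0, 1, 0)).congr fun _ hx _ ht _ hu => hf.dT_eq hX hT hU hx ht hu

theorem SmoothOnBox.smooth_dU (hX : IsOpen X) (hT : IsOpen T) (hU : IsOpen U)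
    (hf : SmoothOnBox X T U f) : SmoothOnBox X T U (dU f) :=
  (hf.fderiv_apply hX hT hU (0, 0, 1)).congr fun _ hx _ ht _ hu => hf.dU_eq hX hT hU hx ht hu

theorem SmoothOnBox.fderiv_fderiv_comm (hX : IsOpen X) (hT : IsOpen T) (hU : IsOpen U)
    (hf : SmoothOnBox X T U f) (hx : x ∈ X) (ht : t ∈ T) (hu : u ∈ U) (v w : ℝ × ℝ × ℝ) :
    fderiv ℝ (fun p => fderiv ℝ (fun p : ℝ × ℝ × ℝ => f p.1 p.2.1 p.2.2) p v) (x, t, u) w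
      = fderiv ℝ (fun p => fderiv ℝ (fun p : ℝ × ℝ × ℝ => f p.1 p.2.1 p.2.2) p w) (x, t, u) v := by
  have hd : DifferentiableAt ℝ (fderiv ℝ (fun p : ℝ × ℝ × ℝ => f p.1 p.2.1 p.2.2)) (x, t, u) :=
    ((hf.contDiffAt hX hT hU hx ht hu).fderiv_right (m := 1) (by norm_cast)).differentiableAt
      (by simp)
  have e : ∀ z : ℝ × ℝ × ℝ,
      fderiv ℝ (fun p => fderiv ℝ (fun p : ℝ × ℝ × ℝ => f p.1 p.2.1 p.2.2) p z) (x, t, u)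
        = (fderiv ℝ (fderiv ℝ (fun p : ℝ × ℝ × ℝ => f p.1 p.2.1 p.2.2)) (x, t, u)).flip z := by
    intro z
    have := (hd.hasFDerivAt.clm_apply (hasFDerivAt_const z (x, t, u))).fderiv
    rw [this]
    simp
  rw [e, e]
  exact ((hf.contDiffAt hX hT hU hx ht hu).isSymmSndFDerivAt (by simp; norm_cast)).eq w v

theorem SmoothOnBox.dU_dX (hX : IsOpen X) (hT : IsOpen T) (hU : IsOpen U)
    (hf : SmoothOnBox X T U f) : EqOnBox X T U (dU (dX f)) (dX (dU f)) := by
  intro x hx t ht u hu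
  have e₁ : EqOnBox X T U (dX f) (fun x t u =>
      fderiv ℝ (fun p : ℝ × ℝ × ℝ => f p.1 p.2.1 p.2.2) (x, t, u) (1, 0, 0)) :=
    fun x hx t ht u hu => hf.dX_eq hX hT hU hx ht hu
  have e₂ : EqOnBox X T U (dU f) (fun x t u =>
      fderiv ℝ (fun p : ℝ × ℝ × ℝ => f p.1 p.2.1 p.2.2) (x, t, u) (0, 0, 1)) :=
    fun x hx t ht u hu => hf.dU_eq hX hT hU hx ht hu
  rw [e₁.congr_dU hU x hx t ht u hu, e₂.congr_dX hX x hx t ht u hu,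
    SmoothOnBox.dU_eq hX hT hU (hf.fderiv_apply hX hT hU (1, 0, 0)) hx ht hu,
    SmoothOnBox.dX_eq hX hT hU (hf.fderiv_apply hX hT hU (0, 0, 1)) hx ht hu]
  exact hf.fderiv_fderiv_comm hX hT hU hx ht hu _ _

theorem SmoothOnBox.dU_dT (hX : IsOpen X) (hT : IsOpen T) (hU : IsOpen U)
    (hf : SmoothOnBox X T U f) : EqOnBox X T U (dU (dT f)) (dT (dU f)) := by
  intro x hx t ht u hu
  have e₁ : EqOnBox X T U (dT f) (fun x t u =>
      fderiv ℝ (fun p : ℝ × ℝ × ℝ => f p.1 p.2.1 p.2.2) (x, t, u) (0, 1, 0)) :=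
    fun x hx t ht u hu => hf.dT_eq hX hT hU hx ht hu
  have e₂ : EqOnBox X T U (dU f) (fun x t u =>
      fderiv ℝ (fun p : ℝ × ℝ × ℝ => f p.1 p.2.1 p.2.2) (x, t, u) (0, 0, 1)) :=
    fun x hx t ht u hu => hf.dU_eq hX hT hU hx ht hu
  rw [e₁.congr_dU hU x hx t ht u hu, e₂.congr_dT hT x hx t ht u hu,
    SmoothOnBox.dU_eq hX hT hU (hf.fderiv_apply hX hT hU (0, 1, 0)) hx ht hu,
    SmoothOnBox.dT_eq hX hT hU (hf.fderiv_apply hX hT hU (0, 0, 1)) hx ht hu]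
  exact hf.fderiv_fderiv_comm hX hT hU hx ht hu _ _

theorem SmoothOnBox.dT_dX (hX : IsOpen X) (hT : IsOpen T) (hU : IsOpen U)
    (hf : SmoothOnBox X T U f) : EqOnBox X T U (dT (dX f)) (dX (dT f)) := by
  intro x hx t ht u hu
  have e₁ : EqOnBox X T U (dX f) (fun x t u =>
      fderiv ℝ (fun p : ℝ × ℝ × ℝ => f p.1 p.2.1 p.2.2) (x, t, u) (1, 0, 0)) :=
    fun x hx t ht u hu => hf.dX_eq hX hT hU hx ht hu
  have e₂ : EqOnBox X T U (dT f) (fun x t u =>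
      fderiv ℝ (fun p : ℝ × ℝ × ℝ => f p.1 p.2.1 p.2.2) (x, t, u) (0, 1, 0)) :=
    fun x hx t ht u hu => hf.dT_eq hX hT hU hx ht hu
  rw [e₁.congr_dT hT x hx t ht u hu, e₂.congr_dX hX x hx t ht u hu,
    SmoothOnBox.dT_eq hX hT hU (hf.fderiv_apply hX hT hU (1, 0, 0)) hx ht hu,
    SmoothOnBox.dX_eq hX hT hU (hf.fderiv_apply hX hT hU (0, 1, 0)) hx ht hu]
  exact hf.fderiv_fderiv_comm hX hT hU hx ht hu _ _

end Box

/-! ### Total derivatives and prolongation coefficients -/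

/-- The jet `j` lies over the box `X × T × U`. -/
def Jet.Over (X T U : Set ℝ) (j : Jet) : Prop := j.x ∈ X ∧ j.t ∈ T ∧ j.u 0 0 ∈ U

/-- A function of `(x, t, u)` regarded as a function on jets. -/
def liftJet (f : ℝ → ℝ → ℝ → ℝ) (j : Jet) : ℝ := f j.x j.t (j.u 0 0)

/-- The direction of the total derivative `D_x`. -/
def dirX (j : Jet) : Jet := (1, 0, fun i k => j.u (i + 1) k)

/-- The direction of the total derivative `D_t`. -/
def dirT (j : Jet) : Jet := (0, 1, fun i k => j.u i (k + 1))

/-- Over the box, `F'` is the derivative of `F` along the field of directions `d`. -/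
def HasDirDeriv (X T U : Set ℝ) (d : Jet → Jet) (F F' : Jet → ℝ) : Prop :=
  ∀ j : Jet, j.Over X T U → HasDerivAt (fun s : ℝ => F (j + s • d j)) (F' j) 0

theorem Jet.x_add_smul (j d : Jet) (s : ℝ) : (j + s • d).x = j.x + s * d.x := rfl
theorem Jet.t_add_smul (j d : Jet) (s : ℝ) : (j + s • d).t = j.t + s * d.t := rfl
theorem Jet.u_add_smul (j d : Jet) (s : ℝ) (i k : ℕ) :
    (j + s • d).u i k = j.u i k + s * d.u i k := rfl

@[simp] theorem dirX_x (j : Jet) : (dirX j).x = 1 := rfl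
@[simp] theorem dirX_t (j : Jet) : (dirX j).t = 0 := rfl
@[simp] theorem dirX_u (j : Jet) (i k : ℕ) : (dirX j).u i k = j.u (i + 1) k := rfl
@[simp] theorem dirT_x (j : Jet) : (dirT j).x = 0 := rfl
@[simp] theorem dirT_t (j : Jet) : (dirT j).t = 1 := rfl
@[simp] theorem dirT_u (j : Jet) (i k : ℕ) : (dirT j).u i k = j.u i (k + 1) := rfl

theorem hasDerivAt_add_mul (a b : ℝ) : HasDerivAt (fun s : ℝ => a + s * b) b 0 := by
  simpa using ((hasDerivAt_id (0 : ℝ)).mul_const b).const_add a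

section Rules

variable {X T U : Set ℝ} {d : Jet → Jet} {F F' G G' : Jet → ℝ} {f : ℝ → ℝ → ℝ → ℝ}

theorem Jet.Over.eventually (hX : IsOpen X) (hT : IsOpen T) (hU : IsOpen U) {j : Jet}
    (hj : j.Over X T U) (d : Jet) : ∀ᶠ s : ℝ in nhds 0, (j + s • d).Over X T U := by
  have key : ∀ {S : Set ℝ} (_ : IsOpen S) {a : ℝ} (_ : a ∈ S) (b : ℝ),
      ∀ᶠ s : ℝ in nhds 0, a + s * b ∈ S := by
    intro S hS a ha b
    have h := (hasDerivAt_add_mul a b).continuousAt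
    exact h.eventually (hS.mem_nhds (by simpa using ha))
  filter_upwards [key hX hj.1 d.x, key hT hj.2.1 d.t, key hU hj.2.2 (d.u 0 0)] with s h₁ h₂ h₃
  exact ⟨h₁, h₂, h₃⟩

theorem HasDirDeriv.congr (hX : IsOpen X) (hT : IsOpen T) (hU : IsOpen U)
    (h : HasDirDeriv X T U d F F') (hG : ∀ j : Jet, j.Over X T U → G j = F j)
    (hG' : ∀ j : Jet, j.Over X T U → G' j = F' j) : HasDirDeriv X T U d G G' := by
  intro j hj
  rw [hG' j hj]
  refine (h j hj).congr_of_eventuallyEq ?_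
  filter_upwards [hj.eventually hX hT hU (d j)] with s hs using hG _ hs

theorem HasDirDeriv.coord (i k : ℕ) :
    HasDirDeriv X T U d (fun j => j.u i k) (fun j => (d j).u i k) :=
  fun j _ => hasDerivAt_add_mul (j.u i k) ((d j).u i k)

theorem HasDirDeriv.add (hF : HasDirDeriv X T U d F F') (hG : HasDirDeriv X T U d G G') :
    HasDirDeriv X T U d (fun j => F j + G j) (fun j => F' j + G' j) :=
  fun j hj => (hF j hj).add (hG j hj)

theorem HasDirDeriv.sub (hF : HasDirDeriv X T U d F F') (hG : HasDirDeriv X T U d G G') :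
    HasDirDeriv X T U d (fun j => F j - G j) (fun j => F' j - G' j) :=
  fun j hj => (hF j hj).sub (hG j hj)

theorem HasDirDeriv.mul (hF : HasDirDeriv X T U d F F') (hG : HasDirDeriv X T U d G G') :
    HasDirDeriv X T U d (fun j => F j * G j) (fun j => F' j * G j + F j * G' j) :=
  fun j hj => by
    have h := (hF j hj).mul (hG j hj)
    simp only [zero_smul, add_zero] at h
    exact h

theorem HasDirDeriv.const_mul (c : ℝ) (hF : HasDirDeriv X T U d F F') :
    HasDirDeriv X T U d (fun j => c * F j) (fun j => c * F' j) :=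
  fun j hj => (hF j hj).const_mul c

theorem HasDirDeriv.lift (hX : IsOpen X) (hT : IsOpen T) (hU : IsOpen U)
    (hf : SmoothOnBox X T U f) :
    HasDirDeriv X T U d (liftJet f) (fun j => liftJet (dX f) j * (d j).x
      + liftJet (dT f) j * (d j).t + liftJet (dU f) j * (d j).u 0 0) :=
  fun j hj => hf.hasDerivAt_comp hX hT hU hj.1 hj.2.1 hj.2.2
    (hasDerivAt_add_mul j.x (d j).x) (hasDerivAt_add_mul j.t (d j).t)
    (hasDerivAt_add_mul (j.u 0 0) ((d j).u 0 0)) (by simp) (by simp) (by simp)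

theorem HasDirDeriv.totalDx_eq (h : HasDirDeriv X T U dirX F F') {j : Jet} (hj : j.Over X T U) :
    totalDx F j = F' j := (h j hj).deriv

theorem HasDirDeriv.totalDt_eq (h : HasDirDeriv X T U dirT F F') {j : Jet} (hj : j.Over X T U) :
    totalDt F j = F' j := (h j hj).deriv

theorem totalDx_congr (hX : IsOpen X) (hT : IsOpen T) (hU : IsOpen U)
    (h : ∀ j : Jet, j.Over X T U → F j = G j) {j : Jet} (hj : j.Over X T U) :
    totalDx F j = totalDx G j := by
  refine Filter.EventuallyEq.deriv_eq ?_
  filter_upwards [hj.eventually hX hT hU (dirX j)] with s hs using h _ hs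

theorem totalDt_congr (hX : IsOpen X) (hT : IsOpen T) (hU : IsOpen U)
    (h : ∀ j : Jet, j.Over X T U → F j = G j) {j : Jet} (hj : j.Over X T U) :
    totalDt F j = totalDt G j := by
  refine Filter.EventuallyEq.deriv_eq ?_
  filter_upwards [hj.eventually hX hT hU (dirT j)] with s hs using h _ hs

end Rules

/-! ### Explicit total derivatives of a function of `(x, t, u)` -/

/-- `D_x f` for `f = f(x, t, u)`. -/
noncomputable def xD1 (f : ℝ → ℝ → ℝ → ℝ) (x t u u₁ : ℝ) : ℝ := dX f x t u + dU f x t u * u₁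

/-- `D_x² f` for `f = f(x, t, u)`. -/
noncomputable def xD2 (f : ℝ → ℝ → ℝ → ℝ) (x t u u₁ u₂ : ℝ) : ℝ :=
  dX (dX f) x t u + 2 * dX (dU f) x t u * u₁ + dU (dU f) x t u * u₁ ^ 2 + dU f x t u * u₂

/-- `D_x³ f` for `f = f(x, t, u)`. -/
noncomputable def xD3 (f : ℝ → ℝ → ℝ → ℝ) (x t u u₁ u₂ u₃ : ℝ) : ℝ :=
  dX (dX (dX f)) x t u + 3 * dX (dX (dU f)) x t u * u₁ + 3 * dX (dU (dU f)) x t u * u₁ ^ 2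
    + dU (dU (dU f)) x t u * u₁ ^ 3 + 3 * dX (dU f) x t u * u₂
    + 3 * dU (dU f) x t u * (u₁ * u₂) + dU f x t u * u₃

/-- `D_x⁴ f` for `f = f(x, t, u)`. -/
noncomputable def xD4 (f : ℝ → ℝ → ℝ → ℝ) (x t u u₁ u₂ u₃ u₄ : ℝ) : ℝ :=
  dX (dX (dX (dX f))) x t u + 4 * dX (dX (dX (dU f))) x t u * u₁
    + 6 * dX (dX (dU (dU f))) x t u * u₁ ^ 2 + 4 * dX (dU (dU (dU f))) x t u * u₁ ^ 3
    + dU (dU (dU (dU f))) x t u * u₁ ^ 4 + 6 * dX (dX (dU f)) x t u * u₂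
    + 12 * dX (dU (dU f)) x t u * (u₁ * u₂) + 6 * dU (dU (dU f)) x t u * (u₁ ^ 2 * u₂)
    + 3 * dU (dU f) x t u * u₂ ^ 2 + 4 * dX (dU f) x t u * u₃
    + 4 * dU (dU f) x t u * (u₁ * u₃) + dU f x t u * u₄

/-- `D_t f` for `f = f(x, t, u)`; here `v = u_t`. -/
noncomputable def tD1 (f : ℝ → ℝ → ℝ → ℝ) (x t u v : ℝ) : ℝ := dT f x t u + dU f x t u * v

/-- `D_t² f` for `f = f(x, t, u)`; here `v = u_t` and `w = u_tt`. -/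
noncomputable def tD2 (f : ℝ → ℝ → ℝ → ℝ) (x t u v w : ℝ) : ℝ :=
  dT (dT f) x t u + 2 * dT (dU f) x t u * v + dU (dU f) x t u * v ^ 2 + dU f x t u * w

section Explicit

variable {X T U : Set ℝ} {f : ℝ → ℝ → ℝ → ℝ}

theorem hasDirDeriv_lift_x (hX : IsOpen X) (hT : IsOpen T) (hU : IsOpen U)
    (hf : SmoothOnBox X T U f) :
    HasDirDeriv X T U dirX (liftJet f) (fun j => liftJet (dX f) j + liftJet (dU f) j * j.u 1 0) :=
  (HasDirDeriv.lift hX hT hU hf).congr hX hT hU (fun _ _ => rfl) (fun j _ => by simp)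

theorem hasDirDeriv_lift_t (hX : IsOpen X) (hT : IsOpen T) (hU : IsOpen U)
    (hf : SmoothOnBox X T U f) :
    HasDirDeriv X T U dirT (liftJet f) (fun j => liftJet (dT f) j + liftJet (dU f) j * j.u 0 1) :=
  (HasDirDeriv.lift hX hT hU hf).congr hX hT hU (fun _ _ => rfl) (fun j _ => by simp)

theorem hasDirDeriv_xD0 (hX : IsOpen X) (hT : IsOpen T) (hU : IsOpen U)
    (hf : SmoothOnBox X T U f) :
    HasDirDeriv X T U dirX (liftJet f) (fun j => xD1 f j.x j.t (j.u 0 0) (j.u 1 0)) :=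
  hasDirDeriv_lift_x hX hT hU hf

theorem hasDirDeriv_xD1 (hX : IsOpen X) (hT : IsOpen T) (hU : IsOpen U)
    (hf : SmoothOnBox X T U f) :
    HasDirDeriv X T U dirX (fun j => xD1 f j.x j.t (j.u 0 0) (j.u 1 0))
      (fun j => xD2 f j.x j.t (j.u 0 0) (j.u 1 0) (j.u 2 0)) := by
  refine ((hasDirDeriv_lift_x hX hT hU (hf.smooth_dX hX hT hU)).add
    ((hasDirDeriv_lift_x hX hT hU (hf.smooth_dU hX hT hU)).mul (.coord 1 0))).congr hX hT hU
    (fun _ _ => rfl) fun j hj => ?_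
  have e := hf.dU_dX hX hT hU _ hj.1 _ hj.2.1 _ hj.2.2
  simp only [liftJet, xD2, dirX_u, e]
  ring

/-- Commutation of `∂/∂u` with `∂/∂x` in the iterated partial derivatives occurring in `D_x⁴ f`. -/
theorem SmoothOnBox.partial_comm (hX : IsOpen X) (hT : IsOpen T) (hU : IsOpen U)
    (hf : SmoothOnBox X T U f) :
    EqOnBox X T U (dX (dU (dX f))) (dX (dX (dU f))) ∧
    EqOnBox X T U (dU (dU (dX f))) (dX (dU (dU f))) ∧
    EqOnBox X T U (dX (dX (dU (dX f)))) (dX (dX (dX (dU f)))) ∧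
    EqOnBox X T U (dX (dU (dU (dX f)))) (dX (dX (dU (dU f)))) ∧
    EqOnBox X T U (dU (dU (dU (dX f)))) (dX (dU (dU (dU f)))) := by
  have e := hf.dU_dX hX hT hU
  have e₁ := (hf.smooth_dU hX hT hU).dU_dX hX hT hU
  have e₂ := ((hf.smooth_dU hX hT hU).smooth_dU hX hT hU).dU_dX hX hT hU
  have e₃ : EqOnBox X T U (dU (dU (dX f))) (dX (dU (dU f))) := fun x hx t ht u hu =>
    (e.congr_dU hU x hx t ht u hu).trans (e₁ x hx t ht u hu)
  exact ⟨e.congr_dX hX, e₃, (e.congr_dX hX).congr_dX hX, e₃.congr_dX hX,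
    fun x hx t ht u hu => (e₃.congr_dU hU x hx t ht u hu).trans (e₂ x hx t ht u hu)⟩

theorem hasDirDeriv_xD2 (hX : IsOpen X) (hT : IsOpen T) (hU : IsOpen U)
    (hf : SmoothOnBox X T U f) :
    HasDirDeriv X T U dirX (fun j => xD2 f j.x j.t (j.u 0 0) (j.u 1 0) (j.u 2 0))
      (fun j => xD3 f j.x j.t (j.u 0 0) (j.u 1 0) (j.u 2 0) (j.u 3 0)) := by
  have hfU := hf.smooth_dU hX hT hU
  refine (((hasDirDeriv_xD1 hX hT hU (hf.smooth_dX hX hT hU)).add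
    ((hasDirDeriv_xD1 hX hT hU hfU).mul (.coord 1 0))).add
      ((hasDirDeriv_xD0 hX hT hU hfU).mul (.coord 2 0))).congr hX hT hU
    (fun j hj => ?_) fun j hj => ?_
  · have e := hf.dU_dX hX hT hU _ hj.1 _ hj.2.1 _ hj.2.2
    simp only [xD1, xD2, liftJet, e]
    ring
  · obtain ⟨e₁, e₂, -⟩ := hf.partial_comm hX hT hU
    simp only [xD1, xD2, xD3, liftJet, dirX_u, hf.dU_dX hX hT hU _ hj.1 _ hj.2.1 _ hj.2.2,
      e₁ _ hj.1 _ hj.2.1 _ hj.2.2, e₂ _ hj.1 _ hj.2.1 _ hj.2.2]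
    ring

theorem hasDirDeriv_xD3 (hX : IsOpen X) (hT : IsOpen T) (hU : IsOpen U)
    (hf : SmoothOnBox X T U f) :
    HasDirDeriv X T U dirX (fun j => xD3 f j.x j.t (j.u 0 0) (j.u 1 0) (j.u 2 0) (j.u 3 0))
      (fun j => xD4 f j.x j.t (j.u 0 0) (j.u 1 0) (j.u 2 0) (j.u 3 0) (j.u 4 0)) := by
  have hfU := hf.smooth_dU hX hT hU
  refine ((((hasDirDeriv_xD2 hX hT hU (hf.smooth_dX hX hT hU)).add
    ((hasDirDeriv_xD2 hX hT hU hfU).mul (.coord 1 0))).add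
      (((hasDirDeriv_xD1 hX hT hU hfU).const_mul 2).mul (.coord 2 0))).add
      ((hasDirDeriv_xD0 hX hT hU hfU).mul (.coord 3 0))).congr hX hT hU
    (fun j hj => ?_) fun j hj => ?_
  · obtain ⟨e₁, e₂, -⟩ := hf.partial_comm hX hT hU
    simp only [xD1, xD2, xD3, liftJet, hf.dU_dX hX hT hU _ hj.1 _ hj.2.1 _ hj.2.2,
      e₁ _ hj.1 _ hj.2.1 _ hj.2.2, e₂ _ hj.1 _ hj.2.1 _ hj.2.2]
    ring
  · obtain ⟨e₁, e₂, e₃, e₄, e₅⟩ := hf.partial_comm hX hT hU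
    simp only [xD1, xD2, xD3, xD4, liftJet, dirX_u, hf.dU_dX hX hT hU _ hj.1 _ hj.2.1 _ hj.2.2,
      e₁ _ hj.1 _ hj.2.1 _ hj.2.2, e₂ _ hj.1 _ hj.2.1 _ hj.2.2, e₃ _ hj.1 _ hj.2.1 _ hj.2.2,
      e₄ _ hj.1 _ hj.2.1 _ hj.2.2, e₅ _ hj.1 _ hj.2.1 _ hj.2.2]
    ring

theorem hasDirDeriv_tD0 (hX : IsOpen X) (hT : IsOpen T) (hU : IsOpen U)
    (hf : SmoothOnBox X T U f) :
    HasDirDeriv X T U dirT (liftJet f) (fun j => tD1 f j.x j.t (j.u 0 0) (j.u 0 1)) :=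
  hasDirDeriv_lift_t hX hT hU hf

theorem hasDirDeriv_tD1 (hX : IsOpen X) (hT : IsOpen T) (hU : IsOpen U)
    (hf : SmoothOnBox X T U f) :
    HasDirDeriv X T U dirT (fun j => tD1 f j.x j.t (j.u 0 0) (j.u 0 1))
      (fun j => tD2 f j.x j.t (j.u 0 0) (j.u 0 1) (j.u 0 2)) := by
  refine ((hasDirDeriv_lift_t hX hT hU (hf.smooth_dT hX hT hU)).add
    ((hasDirDeriv_lift_t hX hT hU (hf.smooth_dU hX hT hU)).mul (.coord 0 1))).congr hX hT hU
    (fun _ _ => rfl) fun j hj => ?_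
  have e := hf.dU_dT hX hT hU _ hj.1 _ hj.2.1 _ hj.2.2
  simp only [liftJet, tD2, dirT_u, e]
  ring

end Explicit

/-! ### The prolongation coefficients entering `pr v (Δ)` -/

namespace PointField

/-- The coefficient of `∂/∂u_x` in the prolongation of `v`. -/
noncomputable def pr10 (v : PointField) (j : Jet) : ℝ :=
  xD1 v.φ j.x j.t (j.u 0 0) (j.u 1 0) - xD1 v.ξ j.x j.t (j.u 0 0) (j.u 1 0) * j.u 1 0
    - xD1 v.τ j.x j.t (j.u 0 0) (j.u 1 0) * j.u 0 1

/-- The coefficient of `∂/∂u_xx` in the prolongation of `v`. -/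
noncomputable def pr20 (v : PointField) (j : Jet) : ℝ :=
  xD2 v.φ j.x j.t (j.u 0 0) (j.u 1 0) (j.u 2 0)
    - (xD2 v.ξ j.x j.t (j.u 0 0) (j.u 1 0) (j.u 2 0) * j.u 1 0
      + 2 * xD1 v.ξ j.x j.t (j.u 0 0) (j.u 1 0) * j.u 2 0)
    - (xD2 v.τ j.x j.t (j.u 0 0) (j.u 1 0) (j.u 2 0) * j.u 0 1
      + 2 * xD1 v.τ j.x j.t (j.u 0 0) (j.u 1 0) * j.u 1 1)

/-- The coefficient of `∂/∂u_xxx` in the prolongation of `v`. -/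
noncomputable def pr30 (v : PointField) (j : Jet) : ℝ :=
  xD3 v.φ j.x j.t (j.u 0 0) (j.u 1 0) (j.u 2 0) (j.u 3 0)
    - (xD3 v.ξ j.x j.t (j.u 0 0) (j.u 1 0) (j.u 2 0) (j.u 3 0) * j.u 1 0
      + 3 * xD2 v.ξ j.x j.t (j.u 0 0) (j.u 1 0) (j.u 2 0) * j.u 2 0
      + 3 * xD1 v.ξ j.x j.t (j.u 0 0) (j.u 1 0) * j.u 3 0)
    - (xD3 v.τ j.x j.t (j.u 0 0) (j.u 1 0) (j.u 2 0) (j.u 3 0) * j.u 0 1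
      + 3 * xD2 v.τ j.x j.t (j.u 0 0) (j.u 1 0) (j.u 2 0) * j.u 1 1
      + 3 * xD1 v.τ j.x j.t (j.u 0 0) (j.u 1 0) * j.u 2 1)

/-- The coefficient of `∂/∂u_xxxx` in the prolongation of `v`. -/
noncomputable def pr40 (v : PointField) (j : Jet) : ℝ :=
  xD4 v.φ j.x j.t (j.u 0 0) (j.u 1 0) (j.u 2 0) (j.u 3 0) (j.u 4 0)
    - (xD4 v.ξ j.x j.t (j.u 0 0) (j.u 1 0) (j.u 2 0) (j.u 3 0) (j.u 4 0) * j.u 1 0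
      + 4 * xD3 v.ξ j.x j.t (j.u 0 0) (j.u 1 0) (j.u 2 0) (j.u 3 0) * j.u 2 0
      + 6 * xD2 v.ξ j.x j.t (j.u 0 0) (j.u 1 0) (j.u 2 0) * j.u 3 0
      + 4 * xD1 v.ξ j.x j.t (j.u 0 0) (j.u 1 0) * j.u 4 0)
    - (xD4 v.τ j.x j.t (j.u 0 0) (j.u 1 0) (j.u 2 0) (j.u 3 0) (j.u 4 0) * j.u 0 1
      + 4 * xD3 v.τ j.x j.t (j.u 0 0) (j.u 1 0) (j.u 2 0) (j.u 3 0) * j.u 1 1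
      + 6 * xD2 v.τ j.x j.t (j.u 0 0) (j.u 1 0) (j.u 2 0) * j.u 2 1
      + 4 * xD1 v.τ j.x j.t (j.u 0 0) (j.u 1 0) * j.u 3 1)

/-- The coefficient of `∂/∂u_tt` in the prolongation of `v`. -/
noncomputable def pr02 (v : PointField) (j : Jet) : ℝ :=
  tD2 v.φ j.x j.t (j.u 0 0) (j.u 0 1) (j.u 0 2)
    - (tD2 v.ξ j.x j.t (j.u 0 0) (j.u 0 1) (j.u 0 2) * j.u 1 0
      + 2 * tD1 v.ξ j.x j.t (j.u 0 0) (j.u 0 1) * j.u 1 1)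
    - (tD2 v.τ j.x j.t (j.u 0 0) (j.u 0 1) (j.u 0 2) * j.u 0 1
      + 2 * tD1 v.τ j.x j.t (j.u 0 0) (j.u 0 1) * j.u 0 2)

variable {X T U : Set ℝ}

theorem prCoeff_eq_of_hasDirDeriv_x (hX : IsOpen X) (hT : IsOpen T) (hU : IsOpen U)
    {v : PointField} (hξ : SmoothOnBox X T U v.ξ) (hτ : SmoothOnBox X T U v.τ)
    (hφ : SmoothOnBox X T U v.φ) {j : Jet} (hj : j.Over X T U) :
    v.prCoeff 1 0 j = v.pr10 j ∧ v.prCoeff 2 0 j = v.pr20 j ∧ v.prCoeff 3 0 j = v.pr30 j ∧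
      v.prCoeff 4 0 j = v.pr40 j := by
  have x0 := @hasDirDeriv_xD0 X T U
  have x1 := @hasDirDeriv_xD1 X T U
  have x2 := @hasDirDeriv_xD2 X T U
  have x3 := @hasDirDeriv_xD3 X T U
  have h1 : HasDirDeriv X T U dirX (fun j => -v.surface j) (fun j => v.pr10 j
      - liftJet v.ξ j * j.u 2 0 - liftJet v.τ j * j.u 1 1) :=
    (((x0 hX hT hU hφ).sub ((x0 hX hT hU hξ).mul (.coord 1 0))).sub
      ((x0 hX hT hU hτ).mul (.coord 0 1))).congr hX hT hU
      (fun j _ => by simp only [surface, liftJet]; ring)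
      (fun j _ => by simp only [pr10, dirX_u]; ring)
  have h2 : HasDirDeriv X T U dirX (fun j => v.pr10 j
      - liftJet v.ξ j * j.u 2 0 - liftJet v.τ j * j.u 1 1) (fun j => v.pr20 j
      - liftJet v.ξ j * j.u 3 0 - liftJet v.τ j * j.u 2 1) :=
    (((((x1 hX hT hU hφ).sub ((x1 hX hT hU hξ).mul (.coord 1 0))).sub
      ((x1 hX hT hU hτ).mul (.coord 0 1))).sub ((x0 hX hT hU hξ).mul (.coord 2 0))).sub
      ((x0 hX hT hU hτ).mul (.coord 1 1))).congr hX hT hU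
      (fun j _ => by simp only [pr10])
      (fun j _ => by simp only [pr20, dirX_u]; ring)
  have h3 : HasDirDeriv X T U dirX (fun j => v.pr20 j
      - liftJet v.ξ j * j.u 3 0 - liftJet v.τ j * j.u 2 1) (fun j => v.pr30 j
      - liftJet v.ξ j * j.u 4 0 - liftJet v.τ j * j.u 3 1) :=
    (((((x2 hX hT hU hφ).sub (((x2 hX hT hU hξ).mul (.coord 1 0)).add
      (((x1 hX hT hU hξ).const_mul 2).mul (.coord 2 0)))).sub
      (((x2 hX hT hU hτ).mul (.coord 0 1)).add
      (((x1 hX hT hU hτ).const_mul 2).mul (.coord 1 1)))).sub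
      ((x0 hX hT hU hξ).mul (.coord 3 0))).sub
      ((x0 hX hT hU hτ).mul (.coord 2 1))).congr hX hT hU
      (fun j _ => by simp only [pr20])
      (fun j _ => by simp only [pr30, dirX_u]; ring)
  have h4 : HasDirDeriv X T U dirX (fun j => v.pr30 j
      - liftJet v.ξ j * j.u 4 0 - liftJet v.τ j * j.u 3 1) (fun j => v.pr40 j
      - liftJet v.ξ j * j.u 5 0 - liftJet v.τ j * j.u 4 1) :=
    (((((x3 hX hT hU hφ).sub ((((x3 hX hT hU hξ).mul (.coord 1 0)).add
      (((x2 hX hT hU hξ).const_mul 3).mul (.coord 2 0))).add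
      (((x1 hX hT hU hξ).const_mul 3).mul (.coord 3 0)))).sub
      ((((x3 hX hT hU hτ).mul (.coord 0 1)).add
      (((x2 hX hT hU hτ).const_mul 3).mul (.coord 1 1))).add
      (((x1 hX hT hU hτ).const_mul 3).mul (.coord 2 1)))).sub
      ((x0 hX hT hU hξ).mul (.coord 4 0))).sub
      ((x0 hX hT hU hτ).mul (.coord 3 1))).congr hX hT hU
      (fun j _ => by simp only [pr30])
      (fun j _ => by simp only [pr40, dirX_u]; ring)
  have e1 : ∀ j : Jet, j.Over X T U → totalDx (fun j => -v.surface j) j = v.pr10 j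
      - liftJet v.ξ j * j.u 2 0 - liftJet v.τ j * j.u 1 1 := fun j hj => h1.totalDx_eq hj
  have e2 : ∀ j : Jet, j.Over X T U → totalDx (totalDx (fun j => -v.surface j)) j = v.pr20 j
      - liftJet v.ξ j * j.u 3 0 - liftJet v.τ j * j.u 2 1 := fun j hj => by
    rw [totalDx_congr hX hT hU e1 hj, h2.totalDx_eq hj]
  have e3 : ∀ j : Jet, j.Over X T U → totalDx (totalDx (totalDx (fun j => -v.surface j))) j
      = v.pr30 j - liftJet v.ξ j * j.u 4 0 - liftJet v.τ j * j.u 3 1 := fun j hj => by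
    rw [totalDx_congr hX hT hU e2 hj, h3.totalDx_eq hj]
  have e4 : ∀ j : Jet, j.Over X T U →
      totalDx (totalDx (totalDx (totalDx (fun j => -v.surface j)))) j
      = v.pr40 j - liftJet v.ξ j * j.u 5 0 - liftJet v.τ j * j.u 4 1 := fun j hj => by
    rw [totalDx_congr hX hT hU e3 hj, h4.totalDx_eq hj]
  refine ⟨?_, ?_, ?_, ?_⟩ <;>
    simp only [prCoeff, Function.iterate_succ, Function.iterate_zero, Function.comp, id,
      e1 j hj, e2 j hj, e3 j hj, e4 j hj, liftJet] <;> ring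

theorem prCoeff_zero_two (hX : IsOpen X) (hT : IsOpen T) (hU : IsOpen U)
    {v : PointField} (hξ : SmoothOnBox X T U v.ξ) (hτ : SmoothOnBox X T U v.τ)
    (hφ : SmoothOnBox X T U v.φ) {j : Jet} (hj : j.Over X T U) :
    v.prCoeff 0 2 j = v.pr02 j := by
  have t0 := @hasDirDeriv_tD0 X T U
  have t1 := @hasDirDeriv_tD1 X T U
  have h1 : HasDirDeriv X T U dirT (fun j => -v.surface j) (fun j =>
      tD1 v.φ j.x j.t (j.u 0 0) (j.u 0 1) - tD1 v.ξ j.x j.t (j.u 0 0) (j.u 0 1) * j.u 1 0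
      - tD1 v.τ j.x j.t (j.u 0 0) (j.u 0 1) * j.u 0 1
      - liftJet v.ξ j * j.u 1 1 - liftJet v.τ j * j.u 0 2) :=
    (((t0 hX hT hU hφ).sub ((t0 hX hT hU hξ).mul (.coord 1 0))).sub
      ((t0 hX hT hU hτ).mul (.coord 0 1))).congr hX hT hU
      (fun j _ => by simp only [surface, liftJet]; ring)
      (fun j _ => by simp only [dirT_u]; ring)
  have h2 : HasDirDeriv X T U dirT (fun j =>
      tD1 v.φ j.x j.t (j.u 0 0) (j.u 0 1) - tD1 v.ξ j.x j.t (j.u 0 0) (j.u 0 1) * j.u 1 0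
      - tD1 v.τ j.x j.t (j.u 0 0) (j.u 0 1) * j.u 0 1
      - liftJet v.ξ j * j.u 1 1 - liftJet v.τ j * j.u 0 2) (fun j => v.pr02 j
      - liftJet v.ξ j * j.u 1 2 - liftJet v.τ j * j.u 0 3) :=
    (((((t1 hX hT hU hφ).sub ((t1 hX hT hU hξ).mul (.coord 1 0))).sub
      ((t1 hX hT hU hτ).mul (.coord 0 1))).sub ((t0 hX hT hU hξ).mul (.coord 1 1))).sub
      ((t0 hX hT hU hτ).mul (.coord 0 2))).congr hX hT hU
      (fun j _ => rfl)
      (fun j _ => by simp only [pr02, dirT_u]; ring)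
  simp only [prCoeff, Function.iterate_succ, Function.iterate_zero, Function.comp, id]
  rw [totalDt_congr hX hT hU (fun j hj => h1.totalDt_eq hj) hj, h2.totalDt_eq hj]
  simp only [liftJet]
  ring

/-- The prolonged field applied to `Δ` (with `μ = 0`), in terms of the explicit prolongation
coefficients. -/
theorem pr_Delta (hX : IsOpen X) (hT : IsOpen T) (hU : IsOpen U) (α β γ κ : ℝ)
    {v : PointField} (hξ : SmoothOnBox X T U v.ξ) (hτ : SmoothOnBox X T U v.τ)
    (hφ : SmoothOnBox X T U v.φ) {j : Jet} (hj : j.Over X T U) :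
    v.pr (Delta α β γ κ 0) j = v.pr02 j - κ * v.pr20 j
      - 2 * γ * (v.φ j.x j.t (j.u 0 0) * j.u 2 0 + j.u 0 0 * v.pr20 j + 2 * j.u 1 0 * v.pr10 j)
      - (v.φ j.x j.t (j.u 0 0) * j.u 4 0 + j.u 0 0 * v.pr40 j)
      - α * (v.pr10 j * j.u 3 0 + j.u 1 0 * v.pr30 j) - 2 * β * j.u 2 0 * v.pr20 j := by
  obtain ⟨p10, p20, p30, p40⟩ := prCoeff_eq_of_hasDirDeriv_x hX hT hU hξ hτ hφ hj
  have p02 := prCoeff_zero_two hX hT hU hξ hτ hφ hj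
  have p00 : v.prCoeff 0 0 j = v.φ j.x j.t (j.u 0 0) := by
    simp only [prCoeff, Function.iterate_zero, id, surface]
    ring
  rw [← p10, ← p20, ← p30, ← p40, ← p02, ← p00]
  refine HasDerivAt.deriv ?_
  have c : ∀ i k : ℕ, HasDerivAt (fun s : ℝ => j.u i k + s * v.prCoeff i k j) (v.prCoeff i k j) 0 :=
    fun i k => hasDerivAt_add_mul _ _
  have := ((((c 0 2).sub (((c 2 0).const_mul κ).add ((((c 0 0).mul (c 2 0)).add
    ((c 1 0).pow 2)).const_mul (2 * γ)))).sub ((c 0 0).mul (c 4 0))).sub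
    (((c 1 0).mul (c 3 0)).const_mul α)).sub (((c 2 0).pow 2).const_mul β)
  convert this using 1
  · funext s
    simp only [Delta, Jet.u_add_smul, Pi.sub_apply, Pi.add_apply, Pi.mul_apply, Pi.pow_apply]
    simp only [Jet.u]
    ring
  · simp
    ring

end PointField

/-! ### Jets satisfying the invariant surface condition -/

/-- The functions on jets generated by the jet coordinates and the smooth functions of `(x, t, u)`
under sums and products; two functions that agree over the box are not distinguished. -/
inductive IsJetPoly (X T U : Set ℝ) : (Jet → ℝ) → Prop
  | lift (f : ℝ → ℝ → ℝ → ℝ) (hf : SmoothOnBox X T U f) : IsJetPoly X T U (liftJet f)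
  | coord (i k : ℕ) : IsJetPoly X T U (fun j => j.u i k)
  | add (F G : Jet → ℝ) : IsJetPoly X T U F → IsJetPoly X T U G →
      IsJetPoly X T U (fun j => F j + G j)
  | mul (F G : Jet → ℝ) : IsJetPoly X T U F → IsJetPoly X T U G →
      IsJetPoly X T U (fun j => F j * G j)
  | congr (F G : Jet → ℝ) : IsJetPoly X T U F → (∀ j : Jet, j.Over X T U → G j = F j) →
      IsJetPoly X T U G

/-- `F` does not depend on the coordinates `u_{i,b}` with `b > k`. -/
def IsBelow (k : ℕ) (F : Jet → ℝ) : Prop :=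
  ∀ j j' : Jet, j.x = j'.x → j.t = j'.t → (∀ i b, b ≤ k → j.u i b = j'.u i b) → F j = F j'

section JetPoly

variable {X T U : Set ℝ} {F G : Jet → ℝ}

theorem IsJetPoly.exists_hasDirDeriv_x (hX : IsOpen X) (hT : IsOpen T) (hU : IsOpen U)
    (hF : IsJetPoly X T U F) : ∃ F', IsJetPoly X T U F' ∧ HasDirDeriv X T U dirX F F' := by
  induction hF with
  | lift f hf =>
    exact ⟨_, .add _ _ (.lift _ (hf.smooth_dX hX hT hU))
      (.mul _ _ (.lift _ (hf.smooth_dU hX hT hU)) (.coord 1 0)), hasDirDeriv_lift_x hX hT hU hf⟩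
  | coord i k => exact ⟨_, .coord (i + 1) k, .coord i k⟩
  | add F G _ _ ihF ihG =>
    obtain ⟨F', hF', dF⟩ := ihF
    obtain ⟨G', hG', dG⟩ := ihG
    exact ⟨_, .add _ _ hF' hG', dF.add dG⟩
  | mul F G hF hG ihF ihG =>
    obtain ⟨F', hF', dF⟩ := ihF
    obtain ⟨G', hG', dG⟩ := ihG
    exact ⟨_, .add _ _ (.mul _ _ hF' hG) (.mul _ _ hF hG'), dF.mul dG⟩
  | congr F G _ h ih =>
    obtain ⟨F', hF', dF⟩ := ih
    exact ⟨F', hF', dF.congr hX hT hU h fun _ _ => rfl⟩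

theorem IsJetPoly.exists_hasDirDeriv_t (hX : IsOpen X) (hT : IsOpen T) (hU : IsOpen U)
    (hF : IsJetPoly X T U F) : ∃ F', IsJetPoly X T U F' ∧ HasDirDeriv X T U dirT F F' := by
  induction hF with
  | lift f hf =>
    exact ⟨_, .add _ _ (.lift _ (hf.smooth_dT hX hT hU))
      (.mul _ _ (.lift _ (hf.smooth_dU hX hT hU)) (.coord 0 1)), hasDirDeriv_lift_t hX hT hU hf⟩
  | coord i k => exact ⟨_, .coord i (k + 1), .coord i k⟩
  | add F G _ _ ihF ihG =>
    obtain ⟨F', hF', dF⟩ := ihF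
    obtain ⟨G', hG', dG⟩ := ihG
    exact ⟨_, .add _ _ hF' hG', dF.add dG⟩
  | mul F G hF hG ihF ihG =>
    obtain ⟨F', hF', dF⟩ := ihF
    obtain ⟨G', hG', dG⟩ := ihG
    exact ⟨_, .add _ _ (.mul _ _ hF' hG) (.mul _ _ hF hG'), dF.mul dG⟩
  | congr F G _ h ih =>
    obtain ⟨F', hF', dF⟩ := ih
    exact ⟨F', hF', dF.congr hX hT hU h fun _ _ => rfl⟩

theorem IsJetPoly.totalDx (hX : IsOpen X) (hT : IsOpen T) (hU : IsOpen U)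
    (hF : IsJetPoly X T U F) : IsJetPoly X T U (totalDx F) := by
  obtain ⟨F', hF', h⟩ := hF.exists_hasDirDeriv_x hX hT hU
  exact .congr _ _ hF' fun j hj => h.totalDx_eq hj

theorem IsJetPoly.totalDt (hX : IsOpen X) (hT : IsOpen T) (hU : IsOpen U)
    (hF : IsJetPoly X T U F) : IsJetPoly X T U (totalDt F) := by
  obtain ⟨F', hF', h⟩ := hF.exists_hasDirDeriv_t hX hT hU
  exact .congr _ _ hF' fun j hj => h.totalDt_eq hj

theorem IsJetPoly.iterate_totalDx (hX : IsOpen X) (hT : IsOpen T) (hU : IsOpen U)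
    (hF : IsJetPoly X T U F) (i : ℕ) : IsJetPoly X T U (_root_.totalDx^[i] F) := by
  induction i with
  | zero => exact hF
  | succ n ih =>
    rw [Function.iterate_succ_apply']
    exact ih.totalDx hX hT hU

theorem IsJetPoly.iterate_totalDt (hX : IsOpen X) (hT : IsOpen T) (hU : IsOpen U)
    (hF : IsJetPoly X T U F) (k : ℕ) : IsJetPoly X T U (_root_.totalDt^[k] F) := by
  induction k with
  | zero => exact hF
  | succ n ih =>
    rw [Function.iterate_succ_apply']
    exact ih.totalDt hX hT hU

theorem IsJetPoly.iterate_totalDt_add_coord (hX : IsOpen X) (hT : IsOpen T) (hU : IsOpen U)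
    (hF : IsJetPoly X T U F) (k a b : ℕ) {j : Jet} (hj : j.Over X T U) :
    _root_.totalDt^[k] (fun j => F j + j.u a b) j = _root_.totalDt^[k] F j + j.u a (b + k) := by
  induction k generalizing j with
  | zero => rfl
  | succ n ih =>
    obtain ⟨F', -, h⟩ := (hF.iterate_totalDt hX hT hU n).exists_hasDirDeriv_t hX hT hU
    rw [Function.iterate_succ_apply', Function.iterate_succ_apply',
      totalDt_congr hX hT hU (fun j hj => ih hj) hj, (h.add (.coord a (b + n))).totalDt_eq hj,
      h.totalDt_eq hj, dirT_u, add_assoc b n 1]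

theorem IsJetPoly.iterate_totalDx_add_coord (hX : IsOpen X) (hT : IsOpen T) (hU : IsOpen U)
    (hF : IsJetPoly X T U F) {a b : ℕ} (hG : ∀ j : Jet, j.Over X T U → G j = F j + j.u a b) (i : ℕ)
    {j : Jet} (hj : j.Over X T U) :
    _root_.totalDx^[i] G j = _root_.totalDx^[i] F j + j.u (a + i) b := by
  induction i generalizing j with
  | zero => exact hG j hj
  | succ n ih =>
    obtain ⟨F', -, h⟩ := (hF.iterate_totalDx hX hT hU n).exists_hasDirDeriv_x hX hT hU
    rw [Function.iterate_succ_apply', Function.iterate_succ_apply',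
      totalDx_congr hX hT hU (fun j hj => ih hj) hj, (h.add (.coord (a + n) b)).totalDx_eq hj,
      h.totalDx_eq hj, dirX_u, add_assoc a n 1]

theorem IsBelow.totalDx {k : ℕ} (h : IsBelow k F) : IsBelow k (totalDx F) := by
  intro j j' hx ht hu
  refine congrArg (fun f : ℝ → ℝ => deriv f 0) (funext fun s => h _ _ ?_ ?_ ?_)
  · simp only [Jet.x_add_smul, hx]; rfl
  · simp only [Jet.t_add_smul, ht]; rfl
  · intro i b hb
    simp only [Jet.u_add_smul, hu i b hb]
    exact congrArg (fun r => j'.u i b + s * r) (hu (i + 1) b hb)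

theorem IsBelow.totalDt {k : ℕ} (h : IsBelow k F) : IsBelow (k + 1) (totalDt F) := by
  intro j j' hx ht hu
  refine congrArg (fun f : ℝ → ℝ => deriv f 0) (funext fun s => h _ _ ?_ ?_ ?_)
  · simp only [Jet.x_add_smul, hx]; rfl
  · simp only [Jet.t_add_smul, ht]; rfl
  · intro i b hb
    simp only [Jet.u_add_smul, hu i b (by omega)]
    exact congrArg (fun r => j'.u i b + s * r) (hu i (b + 1) (by omega))

theorem IsBelow.iterate (h : IsBelow 0 F) (i k : ℕ) :
    IsBelow k (_root_.totalDx^[i] (_root_.totalDt^[k] F)) := by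
  have hk : IsBelow k (_root_.totalDt^[k] F) := by
    induction k with
    | zero => exact h
    | succ n ih =>
      rw [Function.iterate_succ_apply']
      exact ih.totalDt
  induction i with
  | zero => exact hk
  | succ n ih =>
    rw [Function.iterate_succ_apply']
    exact ih.totalDx

end JetPoly

/-- The jets obtained by solving `D_x^i D_t^k (F + u_t) = 0` for `u_{i,k+1}`, one order in `t` at a
time, starting from the values `a i` of `u_{i,0}`. -/
noncomputable def solveJet (F : Jet → ℝ) (x t : ℝ) (a : ℕ → ℝ) : ℕ → Jet
  | 0 => (x, t, fun i b => if b = 0 then a i else 0)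
  | n + 1 => (x, t, fun i b => if b = n + 1 then
      -(totalDx^[i] (totalDt^[n] F) (solveJet F x t a n)) else (solveJet F x t a n).u i b)

theorem solveJet_u_of_le (F : Jet → ℝ) (x t : ℝ) (a : ℕ → ℝ) (i b n : ℕ) (h : b ≤ n) :
    (solveJet F x t a n).u i b = (solveJet F x t a b).u i b := by
  induction n, h using Nat.le_induction with
  | base => rfl
  | succ n hn ih =>
    rw [← ih]
    exact if_neg (by omega)

/-- There is a jet with prescribed `x`-derivatives which satisfies the invariant surface condition
`ξ u_x + u_t - φ = 0` together with all its differential consequences. -/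
theorem exists_jet_surface {X T U : Set ℝ} (hX : IsOpen X) (hT : IsOpen T) (hU : IsOpen U)
    {ξ φ : ℝ → ℝ → ℝ → ℝ} (hξ : SmoothOnBox X T U ξ) (hφ : SmoothOnBox X T U φ) {x t : ℝ}
    (a : ℕ → ℝ) (hx : x ∈ X) (ht : t ∈ T) (ha : a 0 ∈ U) :
    ∃ j : Jet, j.x = x ∧ j.t = t ∧ (∀ i, j.u i 0 = a i) ∧
      ∀ i k, totalDx^[i] (totalDt^[k] (PointField.unitTau ξ φ).surface) j = 0 := by
  set F : Jet → ℝ := fun j => liftJet ξ j * j.u 1 0 + liftJet (fun x t u => -φ x t u) j with hF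
  have hFp : IsJetPoly X T U F :=
    .add _ _ (.mul _ _ (.lift _ hξ) (.coord 1 0)) (.lift _ (ContDiffOn.neg hφ))
  have hF0 : IsBelow 0 F := by
    intro j j' hx ht hu
    simp only [hF, liftJet, hx, ht, hu 0 0 le_rfl, hu 1 0 le_rfl]
  have hS : (PointField.unitTau ξ φ).surface = fun j => F j + j.u 0 1 := by
    funext j
    simp only [PointField.surface, PointField.unitTau, hF, liftJet]
    ring
  have hxt : ∀ n, (solveJet F x t a n).x = x ∧ (solveJet F x t a n).t = t := by
    intro n
    cases n <;> exact ⟨rfl, rfl⟩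
  refine ⟨(x, t, fun i b => (solveJet F x t a b).u i b), rfl, rfl, fun i => by simp [Jet.u, solveJet], ?_⟩
  intro i k
  set j : Jet := (x, t, fun i b => (solveJet F x t a b).u i b) with hj
  have hjo : j.Over X T U := ⟨hx, ht, ha⟩
  have h1 := hFp.iterate_totalDt hX hT hU k
  rw [hS, h1.iterate_totalDx_add_coord hX hT hU
    (fun j hj => hFp.iterate_totalDt_add_coord hX hT hU k 0 1 hj) i hjo]
  have h2 : totalDx^[i] (totalDt^[k] F) j = totalDx^[i] (totalDt^[k] F) (solveJet F x t a k) :=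
    hF0.iterate i k _ _ (hxt k).1.symm (hxt k).2.symm
      fun i b hb => (solveJet_u_of_le F x t a i b k hb).symm
  have h3 : j.u (0 + i) (1 + k) = -(totalDx^[i] (totalDt^[k] F) (solveJet F x t a k)) := by
    rw [zero_add, add_comm 1 k]
    exact if_pos rfl
  rw [h2, h3, add_neg_cancel]

/-! ### The reduced symmetry condition -/

section Reduced

variable (ξ φ : ℝ → ℝ → ℝ → ℝ) (x t u u₁ u₂ u₃ u₄ : ℝ)

/-- `u_t` expressed by the invariant surface condition. -/
def surfT : ℝ := φ x t u - ξ x t u * u₁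

/-- `u_xt` expressed by the invariant surface condition. -/
noncomputable def surfXT : ℝ := xD1 φ x t u u₁ - xD1 ξ x t u u₁ * u₁ - ξ x t u * u₂

/-- `u_tt` expressed by the invariant surface condition. -/
noncomputable def surfTT : ℝ :=
  tD1 φ x t u (surfT ξ φ x t u u₁) - tD1 ξ x t u (surfT ξ φ x t u u₁) * u₁
    - ξ x t u * surfXT ξ φ x t u u₁ u₂

/-- The coefficient of `∂/∂u_x` in the prolongation of `ξ ∂_x + ∂_t + φ ∂_u`. -/
noncomputable def red1 : ℝ := xD1 φ x t u u₁ - xD1 ξ x t u u₁ * u₁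

/-- The coefficient of `∂/∂u_xx` in the prolongation of `ξ ∂_x + ∂_t + φ ∂_u`. -/
noncomputable def red2 : ℝ :=
  xD2 φ x t u u₁ u₂ - (xD2 ξ x t u u₁ u₂ * u₁ + 2 * xD1 ξ x t u u₁ * u₂)

/-- The coefficient of `∂/∂u_xxx` in the prolongation of `ξ ∂_x + ∂_t + φ ∂_u`. -/
noncomputable def red3 : ℝ :=
  xD3 φ x t u u₁ u₂ u₃ - (xD3 ξ x t u u₁ u₂ u₃ * u₁ + 3 * xD2 ξ x t u u₁ u₂ * u₂
    + 3 * xD1 ξ x t u u₁ * u₃)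

/-- The coefficient of `∂/∂u_xxxx` in the prolongation of `ξ ∂_x + ∂_t + φ ∂_u`. -/
noncomputable def red4 : ℝ :=
  xD4 φ x t u u₁ u₂ u₃ u₄ - (xD4 ξ x t u u₁ u₂ u₃ u₄ * u₁ + 4 * xD3 ξ x t u u₁ u₂ u₃ * u₂
    + 6 * xD2 ξ x t u u₁ u₂ * u₃ + 4 * xD1 ξ x t u u₁ * u₄)

/-- The coefficient of `∂/∂u_tt` in the prolongation of `ξ ∂_x + ∂_t + φ ∂_u`, on jets satisfying
the invariant surface condition. -/
noncomputable def redTT : ℝ :=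
  tD2 φ x t u (surfT ξ φ x t u u₁) (surfTT ξ φ x t u u₁ u₂)
    - (tD2 ξ x t u (surfT ξ φ x t u u₁) (surfTT ξ φ x t u u₁ u₂) * u₁
      + 2 * tD1 ξ x t u (surfT ξ φ x t u u₁) * surfXT ξ φ x t u u₁ u₂)

/-- `Δ` on jets satisfying the invariant surface condition. -/
noncomputable def redDelta (α β γ κ : ℝ) : ℝ :=
  surfTT ξ φ x t u u₁ u₂ - (κ * u₂ + 2 * γ * (u * u₂ + u₁ ^ 2)) - u * u₄ - α * (u₁ * u₃)
    - β * u₂ ^ 2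

/-- `pr v (Δ)` on jets satisfying the invariant surface condition. -/
noncomputable def redPr (α β γ κ : ℝ) : ℝ :=
  redTT ξ φ x t u u₁ u₂ - κ * red2 ξ φ x t u u₁ u₂
    - 2 * γ * (φ x t u * u₂ + u * red2 ξ φ x t u u₁ u₂ + 2 * u₁ * red1 ξ φ x t u u₁)
    - (φ x t u * u₄ + u * red4 ξ φ x t u u₁ u₂ u₃ u₄)
    - α * (red1 ξ φ x t u u₁ * u₃ + u₁ * red3 ξ φ x t u u₁ u₂ u₃)
    - 2 * β * u₂ * red2 ξ φ x t u u₁ u₂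

end Reduced

theorem dX_const (c : ℝ) : dX (fun _ _ _ => c) = fun _ _ _ => 0 := by
  funext x t u
  simp [dX]

theorem dT_const (c : ℝ) : dT (fun _ _ _ => c) = fun _ _ _ => 0 := by
  funext x t u
  simp [dT]

theorem dU_const (c : ℝ) : dU (fun _ _ _ => c) = fun _ _ _ => 0 := by
  funext x t u
  simp [dU]

/-- The nonclassical symmetry condition, after elimination of the `t`-derivatives by the invariant
surface condition, is a condition on the free coordinates `x, t, u, u_x, …, u_xxxx`. -/
theorem isNonclassicalSymmetry_iff {X T U : Set ℝ} (hX : IsOpen X) (hT : IsOpen T) (hU : IsOpen U)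
    {ξ φ : ℝ → ℝ → ℝ → ℝ} (hξ : SmoothOnBox X T U ξ) (hφ : SmoothOnBox X T U φ) (α β γ κ : ℝ) :
    IsNonclassicalSymmetry α β γ κ 0 X T U ξ φ ↔
      ∀ x ∈ X, ∀ t ∈ T, ∀ u ∈ U, u ≠ 0 → ∀ u₁ u₂ u₃ u₄ : ℝ,
        redDelta ξ φ x t u u₁ u₂ u₃ u₄ α β γ κ = 0 → redPr ξ φ x t u u₁ u₂ u₃ u₄ α β γ κ = 0 := by
  have h1 : SmoothOnBox X T U (PointField.unitTau ξ φ).τ := contDiffOn_const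
  have key : ∀ j : Jet, j.Over X T U → (∀ i k : ℕ, i + k ≤ 3 →
      totalDx^[i] (totalDt^[k] (PointField.unitTau ξ φ).surface) j = 0) →
      Delta α β γ κ 0 j = redDelta ξ φ j.x j.t (j.u 0 0) (j.u 1 0) (j.u 2 0) (j.u 3 0) (j.u 4 0)
        α β γ κ ∧
      (PointField.unitTau ξ φ).pr (Delta α β γ κ 0) j =
        redPr ξ φ j.x j.t (j.u 0 0) (j.u 1 0) (j.u 2 0) (j.u 3 0) (j.u 4 0) α β γ κ := by
    intro j hj hs
    have e00 := hs 0 0 (by norm_num)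
    have e10 := hs 1 0 (by norm_num)
    have e01 := hs 0 1 (by norm_num)
    simp only [Function.iterate_succ, Function.iterate_zero, Function.comp, id] at e00 e10 e01
    have hS : (PointField.unitTau ξ φ).surface
        = fun j => liftJet ξ j * j.u 1 0 + j.u 0 1 - liftJet φ j := by
      funext j
      simp [PointField.surface, PointField.unitTau, liftJet]
    rw [hS] at e00 e10 e01
    rw [((((hasDirDeriv_xD0 hX hT hU hξ).mul (.coord 1 0)).add (.coord 0 1)).sub
      (hasDirDeriv_xD0 hX hT hU hφ)).totalDx_eq hj] at e10
    rw [((((hasDirDeriv_tD0 hX hT hU hξ).mul (.coord 1 0)).add (.coord 0 1)).sub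
      (hasDirDeriv_tD0 hX hT hU hφ)).totalDt_eq hj] at e01
    simp only [liftJet, dirX_u, dirT_u, zero_add, Nat.reduceAdd] at e00 e10 e01
    have v01 : j.u 0 1 = surfT ξ φ j.x j.t (j.u 0 0) (j.u 1 0) := by
      simp only [surfT]; linarith
    have v11 : j.u 1 1 = surfXT ξ φ j.x j.t (j.u 0 0) (j.u 1 0) (j.u 2 0) := by
      simp only [surfXT]; linarith
    have v02 : j.u 0 2 = surfTT ξ φ j.x j.t (j.u 0 0) (j.u 1 0) (j.u 2 0) := by
      simp only [surfTT, ← v01, ← v11]; linarith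
    constructor
    · simp only [Delta, redDelta, v02]
      ring
    · rw [PointField.pr_Delta hX hT hU α β γ κ hξ h1 hφ hj]
      simp only [PointField.pr10, PointField.pr20, PointField.pr30, PointField.pr40,
        PointField.pr02, PointField.unitTau, redPr, red1, red2, red3, red4, redTT, v01, v11, v02]
      have z1 : ∀ x t u a, xD1 (fun _ _ _ => (1 : ℝ)) x t u a = 0 := by
        intros; simp [xD1, dX_const, dU_const]
      have z2 : ∀ x t u a b, xD2 (fun _ _ _ => (1 : ℝ)) x t u a b = 0 := by
        intros; simp [xD2, dX_const, dU_const]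
      have z3 : ∀ x t u a b c, xD3 (fun _ _ _ => (1 : ℝ)) x t u a b c = 0 := by
        intros; simp [xD3, dX_const, dU_const]
      have z4 : ∀ x t u a b c d, xD4 (fun _ _ _ => (1 : ℝ)) x t u a b c d = 0 := by
        intros; simp [xD4, dX_const, dU_const]
      have y1 : ∀ x t u a, tD1 (fun _ _ _ => (1 : ℝ)) x t u a = 0 := by
        intros; simp [tD1, dT_const, dU_const]
      have y2 : ∀ x t u a b, tD2 (fun _ _ _ => (1 : ℝ)) x t u a b = 0 := by
        intros; simp [tD2, dT_const, dU_const]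
      simp only [z1, z2, z3, z4, y1, y2]
      ring
  constructor
  · intro h x hx t ht u hu hu0 u₁ u₂ u₃ u₄ hΔ
    obtain ⟨j, jx, jt, ju, hs⟩ := exists_jet_surface hX hT hU hξ hφ
      (fun i => if i = 0 then u else if i = 1 then u₁ else if i = 2 then u₂ else
        if i = 3 then u₃ else u₄) hx ht (by simpa using hu)
    have v0 : j.u 0 0 = u := by simp [ju]
    have v1 : j.u 1 0 = u₁ := by simp [ju]
    have v2 : j.u 2 0 = u₂ := by simp [ju]
    have v3 : j.u 3 0 = u₃ := by simp [ju]
    have v4 : j.u 4 0 = u₄ := by simp [ju]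
    have hj : j.Over X T U := ⟨jx ▸ hx, jt ▸ ht, v0 ▸ hu⟩
    obtain ⟨k1, k2⟩ := key j hj fun i k _ => hs i k
    rw [jx, jt, v0, v1, v2, v3, v4] at k1 k2
    rw [← k2]
    exact h j hj.1 hj.2.1 hj.2.2 (by rw [v0]; simpa using hu0) (k1.trans hΔ) fun i k _ => hs i k
  · intro h j hx ht hu hu0 hΔ hs
    obtain ⟨k1, k2⟩ := key j ⟨hx, ht, hu⟩ hs
    rw [k2]
    exact h _ hx _ ht _ hu (by simpa using hu0) _ _ _ _ (k1.symm.trans hΔ)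

/-! ### Smooth functions on intervals -/

section OneVariable

variable {I : Set ℝ} {f g : ℝ → ℝ} {t : ℝ}

theorem smooth_hasDerivAt (hI : IsOpen I) (hf : ContDiffOn ℝ ∞ f I) (ht : t ∈ I) :
    HasDerivAt f (deriv f t) t :=
  ((hf.contDiffAt (hI.mem_nhds ht)).differentiableAt (by simp)).hasDerivAt

theorem smooth_deriv (hI : IsOpen I) (hf : ContDiffOn ℝ ∞ f I) : ContDiffOn ℝ ∞ (deriv f) I :=
  ((contDiffOn_infty_iff_deriv_of_isOpen hI).1 hf).2

theorem deriv_congr_of_eqOn (hI : IsOpen I) (h : EqOn f g I) (ht : t ∈ I) :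
    deriv f t = deriv g t :=
  Filter.EventuallyEq.deriv_eq (Filter.eventuallyEq_of_mem (hI.mem_nhds ht) h)

theorem hasDerivAt_of_eqOn (hI : IsOpen I) (h : EqOn f g I) (ht : t ∈ I) {d : ℝ}
    (hg : HasDerivAt g d t) : HasDerivAt f d t :=
  hg.congr_of_eventuallyEq (Filter.eventuallyEq_of_mem (hI.mem_nhds ht) h)

/-- Two functions with the same derivative on an interval differ by a constant. -/
theorem exists_eq_add_const (hI : IsOpen I) (hI' : IsPreconnected I) {d : ℝ → ℝ}
    (hf : ∀ t ∈ I, HasDerivAt f (d t) t) (hg : ∀ t ∈ I, HasDerivAt g (d t) t) :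
    ∃ c : ℝ, ∀ t ∈ I, f t = g t + c := by
  obtain ⟨c, hc⟩ := hI.exists_is_const_of_deriv_eq_zero hI' (f := fun t => f t - g t)
    (fun t ht => ((hf t ht).sub (hg t ht)).differentiableAt.differentiableWithinAt)
    (fun t ht => by
      have := ((hf t ht).sub (hg t ht)).deriv
      rw [sub_self] at this
      exact this)
  exact ⟨c, fun t ht => by linarith [hc t ht]⟩

theorem eq_of_hasDerivAt_zero (hI : IsOpen I) (hI' : IsPreconnected I)
    (hf : ∀ t ∈ I, HasDerivAt f 0 t) {s : ℝ} (hs : s ∈ I) (ht : t ∈ I) : f s = f t := by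
  obtain ⟨c, hc⟩ := exists_eq_add_const hI hI' (g := fun _ => 0) hf
    (fun t _ => hasDerivAt_const t 0)
  rw [hc s hs, hc t ht]

theorem exists_primitive (hI : IsOpen I) (hI' : IsPreconnected I) (hf : ContDiffOn ℝ ∞ f I) :
    ∃ F : ℝ → ℝ, ContDiffOn ℝ ∞ F I ∧ ∀ t ∈ I, HasDerivAt F (f t) t := by
  rcases I.eq_empty_or_nonempty with rfl | ⟨a, ha⟩
  · exact ⟨fun _ => 0, contDiffOn_const, by simp⟩
  have hd : ∀ t ∈ I, HasDerivAt (fun t => ∫ s in a..t, f s) (f t) t := by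
    intro t ht
    have hsub : uIcc a t ⊆ I := hI'.ordConnected.uIcc_subset ha ht
    refine intervalIntegral.integral_hasDerivAt_right
      ((hf.continuousOn.mono hsub).intervalIntegrable) ?_
      (hf.continuousOn.continuousAt (hI.mem_nhds ht))
    exact hf.continuousOn.stronglyMeasurableAtFilter hI t ht
  refine ⟨fun t => ∫ s in a..t, f s, ?_, hd⟩
  rw [contDiffOn_infty_iff_deriv_of_isOpen hI]
  exact ⟨fun t ht => (hd t ht).differentiableAt.differentiableWithinAt,
    hf.congr fun t ht => (hd t ht).deriv⟩

/-- There is a positive smooth solution of `l' = m l`. -/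
theorem exists_exp_primitive (hI : IsOpen I) (hI' : IsPreconnected I) (hf : ContDiffOn ℝ ∞ f I) :
    ∃ l : ℝ → ℝ, ContDiffOn ℝ ∞ l I ∧ ∀ t ∈ I, 0 < l t ∧ HasDerivAt l (f t * l t) t := by
  obtain ⟨F, hF, hd⟩ := exists_primitive hI hI' hf
  refine ⟨fun t => Real.exp (F t), hF.exp, fun t ht => ⟨Real.exp_pos _, ?_⟩⟩
  simpa [mul_comm] using (hd t ht).exp

/-- Uniqueness for the linear equation `y' = m y`. -/
theorem eq_zero_of_linear_ode (hI : IsOpen I) (hI' : IsPreconnected I) {m y : ℝ → ℝ}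
    (hm : ContDiffOn ℝ ∞ m I) (hy : ∀ t ∈ I, HasDerivAt y (m t * y t) t) {t₀ : ℝ} (ht₀ : t₀ ∈ I)
    (h0 : y t₀ = 0) : ∀ t ∈ I, y t = 0 := by
  obtain ⟨l, -, hl⟩ := exists_exp_primitive hI hI' (hm.neg)
  intro t ht
  have h := eq_of_hasDerivAt_zero hI hI' (f := fun t => l t * y t) (fun t ht =>
    ((hl t ht).2.mul (hy t ht)).congr_deriv (by ring)) ht ht₀
  rw [h0, mul_zero] at h
  exact (mul_eq_zero.1 h).resolve_left (hl t ht).1.ne'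

/-- If `f h = 0`, and `h` vanishes at the interior points of the zero set of `f`, then `h = 0`. -/
theorem eq_zero_of_mul_eq_zero_of_interior {E : Type*} [TopologicalSpace E] {S : Set E}
    (hS : IsOpen S) {f h : E → ℝ} (hh : ContinuousOn h S) (hfh : ∀ p ∈ S, f p * h p = 0)
    (hint : ∀ p ∈ S, (∀ᶠ q in nhds p, f q = 0) → h p = 0) : ∀ p ∈ S, h p = 0 := by
  intro p hp
  by_contra hne
  refine hne (hint p hp ?_)
  filter_upwards [(hh.continuousAt (hS.mem_nhds hp)).eventually_ne hne, hS.mem_nhds hp]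
    with q hq hqS
  exact (mul_eq_zero.1 (hfh q hqS)).resolve_right hq

/-- A polynomial of degree at most eight vanishing on an infinite set is zero. -/
theorem coeffs_eq_zero_of_infinite {S : Set ℝ} (hS : S.Infinite)
    {a₀ a₁ a₂ a₃ a₄ a₅ a₆ a₇ a₈ : ℝ}
    (h : ∀ u ∈ S, a₀ + a₁ * u + a₂ * u ^ 2 + a₃ * u ^ 3 + a₄ * u ^ 4 + a₅ * u ^ 5 + a₆ * u ^ 6
      + a₇ * u ^ 7 + a₈ * u ^ 8 = 0) :
    a₀ = 0 ∧ a₁ = 0 ∧ a₂ = 0 ∧ a₃ = 0 ∧ a₄ = 0 ∧ a₅ = 0 ∧ a₆ = 0 ∧ a₇ = 0 ∧ a₈ = 0 := by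
  open Polynomial in
  have hp : (C a₀ + C a₁ * X + C a₂ * X ^ 2 + C a₃ * X ^ 3 + C a₄ * X ^ 4 + C a₅ * X ^ 5
      + C a₆ * X ^ 6 + C a₇ * X ^ 7 + C a₈ * X ^ 8 : ℝ[X]) = 0 := by
    refine Polynomial.eq_zero_of_infinite_isRoot _ (hS.mono fun u hu => ?_)
    simpa using h u hu
  have hc := fun n => congrArg (fun p => Polynomial.coeff p n) hp
  have h0 := hc 0
  have h1 := hc 1
  have h2 := hc 2
  have h3 := hc 3
  have h4 := hc 4
  have h5 := hc 5
  have h6 := hc 6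
  have h7 := hc 7
  have h8 := hc 8
  simp [Polynomial.coeff_X, Polynomial.coeff_X_pow] at h0 h1 h2 h3 h4 h5 h6 h7 h8
  exact ⟨h0, h1, h2, h3, h4, h5, h6, h7, h8⟩

theorem IsOpen.infinite_of_mem (hI : IsOpen I) (ht : t ∈ I) : I.Infinite :=
  infinite_of_mem_nhds t (hI.mem_nhds ht)

theorem IsOpen.infinite_diff_zero (hI : IsOpen I) (ht : t ∈ I) : (I \ {0}).Infinite :=
  (hI.infinite_of_mem ht).sdiff (finite_singleton 0)

end OneVariable

/-! ### Smooth functions of `(x, t)` -/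

/-- The partial derivative `∂a/∂x` of a function of `(x, t)`. -/
noncomputable def px (a : ℝ → ℝ → ℝ) (x t : ℝ) : ℝ := deriv (fun s => a s t) x

/-- The partial derivative `∂a/∂t` of a function of `(x, t)`. -/
noncomputable def pt (a : ℝ → ℝ → ℝ) (x t : ℝ) : ℝ := deriv (fun s => a x s) t

section TwoVariables

variable {X T U : Set ℝ} {a b : ℝ → ℝ → ℝ} {x t : ℝ}

theorem SmoothOnRect.lift (h : SmoothOnRect X T a) (U : Set ℝ) :
    SmoothOnBox X T U (fun x t _ => a x t) :=
  ContDiffOn.comp (t := X ×ˢ T) h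
    (contDiff_fst.prodMk (contDiff_fst.comp contDiff_snd)).contDiffOn
    fun _ hp => ⟨hp.1, hp.2.1⟩

theorem SmoothOnBox.restrict {f : ℝ → ℝ → ℝ → ℝ} (h : SmoothOnBox X T U f) {u : ℝ} (hu : u ∈ U) :
    SmoothOnRect X T (fun x t => f x t u) :=
  ContDiffOn.comp (t := X ×ˢ T ×ˢ U) h
    (contDiff_fst.prodMk (contDiff_snd.prodMk contDiff_const)).contDiffOn
    fun _ hp => ⟨hp.1, hp.2, hu⟩

theorem SmoothOnRect.smooth_px (hX : IsOpen X) (hT : IsOpen T) (h : SmoothOnRect X T a) :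
    SmoothOnRect X T (px a) :=
  ((h.lift univ).smooth_dX hX hT isOpen_univ).restrict (mem_univ 0)

theorem SmoothOnRect.smooth_pt (hX : IsOpen X) (hT : IsOpen T) (h : SmoothOnRect X T a) :
    SmoothOnRect X T (pt a) :=
  ((h.lift univ).smooth_dT hX hT isOpen_univ).restrict (mem_univ 0)

theorem SmoothOnRect.hasDerivAt_x (hX : IsOpen X) (hT : IsOpen T) (h : SmoothOnRect X T a)
    (hx : x ∈ X) (ht : t ∈ T) : HasDerivAt (fun s => a s t) (px a x t) x :=
  (h.lift univ).hasDerivAt_x hX hT isOpen_univ hx ht (mem_univ 0)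

theorem SmoothOnRect.hasDerivAt_t (hX : IsOpen X) (hT : IsOpen T) (h : SmoothOnRect X T a)
    (hx : x ∈ X) (ht : t ∈ T) : HasDerivAt (fun s => a x s) (pt a x t) t :=
  (h.lift univ).hasDerivAt_t hX hT isOpen_univ hx ht (mem_univ 0)

theorem SmoothOnRect.pt_px (hX : IsOpen X) (hT : IsOpen T) (h : SmoothOnRect X T a)
    (hx : x ∈ X) (ht : t ∈ T) : pt (px a) x t = px (pt a) x t :=
  (h.lift univ).dT_dX hX hT isOpen_univ x hx t ht 0 (mem_univ 0)

theorem SmoothOnRect.slice_x (h : SmoothOnRect X T a) (ht : t ∈ T) :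
    ContDiffOn ℝ ∞ (fun s => a s t) X :=
  ContDiffOn.comp (t := X ×ˢ T) h (contDiff_id.prodMk contDiff_const).contDiffOn
    fun _ hp => ⟨hp, ht⟩

theorem SmoothOnRect.slice_t (h : SmoothOnRect X T a) (hx : x ∈ X) :
    ContDiffOn ℝ ∞ (fun s => a x s) T :=
  ContDiffOn.comp (t := X ×ˢ T) h (contDiff_const.prodMk contDiff_id).contDiffOn
    fun _ hp => ⟨hx, hp⟩

end TwoVariables

/-! ### Determining equations for infinitesimals affine in `u` -/

section Congr

variable {X T U : Set ℝ} {f g ξ ξ' φ φ' : ℝ → ℝ → ℝ → ℝ} {x t u : ℝ}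

theorem EqOnBox.xD1_eq (hX : IsOpen X) (hU : IsOpen U) (h : EqOnBox X T U f g)
    (hx : x ∈ X) (ht : t ∈ T) (hu : u ∈ U) (u₁ : ℝ) : xD1 f x t u u₁ = xD1 g x t u u₁ := by
  simp only [xD1, h.congr_dX hX x hx t ht u hu, h.congr_dU hU x hx t ht u hu]

theorem EqOnBox.xD2_eq (hX : IsOpen X) (hU : IsOpen U) (h : EqOnBox X T U f g)
    (hx : x ∈ X) (ht : t ∈ T) (hu : u ∈ U) (u₁ u₂ : ℝ) :
    xD2 f x t u u₁ u₂ = xD2 g x t u u₁ u₂ := by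
  simp only [xD2, h.congr_dU hU x hx t ht u hu, (h.congr_dX hX).congr_dX hX x hx t ht u hu,
    (h.congr_dU hU).congr_dX hX x hx t ht u hu, (h.congr_dU hU).congr_dU hU x hx t ht u hu]

theorem EqOnBox.xD3_eq (hX : IsOpen X) (hU : IsOpen U) (h : EqOnBox X T U f g)
    (hx : x ∈ X) (ht : t ∈ T) (hu : u ∈ U) (u₁ u₂ u₃ : ℝ) :
    xD3 f x t u u₁ u₂ u₃ = xD3 g x t u u₁ u₂ u₃ := by
  have hXX := (h.congr_dX hX).congr_dX hX
  have hXU := (h.congr_dU hU).congr_dX hX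
  have hUU := (h.congr_dU hU).congr_dU hU
  simp only [xD3, h.congr_dU hU x hx t ht u hu, hXX.congr_dX hX x hx t ht u hu,
    hXU.congr_dX hX x hx t ht u hu, hXU x hx t ht u hu, hUU x hx t ht u hu,
    hUU.congr_dX hX x hx t ht u hu, hUU.congr_dU hU x hx t ht u hu]

theorem EqOnBox.xD4_eq (hX : IsOpen X) (hU : IsOpen U) (h : EqOnBox X T U f g)
    (hx : x ∈ X) (ht : t ∈ T) (hu : u ∈ U) (u₁ u₂ u₃ u₄ : ℝ) :
    xD4 f x t u u₁ u₂ u₃ u₄ = xD4 g x t u u₁ u₂ u₃ u₄ := by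
  have hXX := (h.congr_dX hX).congr_dX hX
  have hXU := (h.congr_dU hU).congr_dX hX
  have hUU := (h.congr_dU hU).congr_dU hU
  have hUUU := hUU.congr_dU hU
  simp only [xD4, h.congr_dU hU x hx t ht u hu,
    (hXX.congr_dX hX).congr_dX hX x hx t ht u hu, (hXU.congr_dX hX).congr_dX hX x hx t ht u hu,
    (hUU.congr_dX hX).congr_dX hX x hx t ht u hu, hUUU.congr_dX hX x hx t ht u hu,
    hUUU.congr_dU hU x hx t ht u hu, hUUU x hx t ht u hu,
    hXU.congr_dX hX x hx t ht u hu, hXU x hx t ht u hu, hUU x hx t ht u hu,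
    hUU.congr_dX hX x hx t ht u hu]

theorem EqOnBox.tD1_eq (hT : IsOpen T) (hU : IsOpen U) (h : EqOnBox X T U f g)
    (hx : x ∈ X) (ht : t ∈ T) (hu : u ∈ U) (v : ℝ) : tD1 f x t u v = tD1 g x t u v := by
  simp only [tD1, h.congr_dT hT x hx t ht u hu, h.congr_dU hU x hx t ht u hu]

theorem EqOnBox.tD2_eq (hT : IsOpen T) (hU : IsOpen U) (h : EqOnBox X T U f g)
    (hx : x ∈ X) (ht : t ∈ T) (hu : u ∈ U) (v w : ℝ) : tD2 f x t u v w = tD2 g x t u v w := by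
  simp only [tD2, h.congr_dU hU x hx t ht u hu, (h.congr_dT hT).congr_dT hT x hx t ht u hu,
    (h.congr_dU hU).congr_dT hT x hx t ht u hu, (h.congr_dU hU).congr_dU hU x hx t ht u hu]

theorem isNonclassicalSymmetry_congr (hX : IsOpen X) (hT : IsOpen T) (hU : IsOpen U)
    (hξ : SmoothOnBox X T U ξ) (hφ : SmoothOnBox X T U φ) (h₁ : EqOnBox X T U ξ' ξ)
    (h₂ : EqOnBox X T U φ' φ) {α β γ κ : ℝ} :
    IsNonclassicalSymmetry α β γ κ 0 X T U ξ' φ' ↔ IsNonclassicalSymmetry α β γ κ 0 X T U ξ φ := by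
  rw [isNonclassicalSymmetry_iff hX hT hU hξ hφ,
    isNonclassicalSymmetry_iff hX hT hU (hξ.congr h₁) (hφ.congr h₂)]
  refine forall₂_congr fun x hx => forall₂_congr fun t ht => forall₂_congr fun u hu => ?_
  have e0 := h₁ x hx t ht u hu
  have e0' := h₂ x hx t ht u hu
  have e1 := h₁.xD1_eq hX hU hx ht hu
  have e1' := h₂.xD1_eq hX hU hx ht hu
  have e2 := h₁.xD2_eq hX hU hx ht hu
  have e2' := h₂.xD2_eq hX hU hx ht hu
  have e3 := h₁.xD3_eq hX hU hx ht hu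
  have e3' := h₂.xD3_eq hX hU hx ht hu
  have e4 := h₁.xD4_eq hX hU hx ht hu
  have e4' := h₂.xD4_eq hX hU hx ht hu
  have f1 := h₁.tD1_eq hT hU hx ht hu
  have f1' := h₂.tD1_eq hT hU hx ht hu
  have f2 := h₁.tD2_eq hT hU hx ht hu
  have f2' := h₂.tD2_eq hT hU hx ht hu
  simp only [redDelta, redPr, redTT, surfTT, surfXT, surfT, red1, red2, red3, red4, e0, e0',
    e1, e1', e2, e2', e3, e3', e4, e4', f1, f1', f2, f2']

end Congr

/-- The function `A(x, t) + C(x, t) u`. -/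
def affineU (A C : ℝ → ℝ → ℝ) (x t u : ℝ) : ℝ := A x t + C x t * u

/-- The function `ξ(x, t)` regarded as a function of `(x, t, u)`. -/
def constU (ξ : ℝ → ℝ → ℝ) (x t _u : ℝ) : ℝ := ξ x t

section Affine

variable {X T U : Set ℝ} {ξ A C : ℝ → ℝ → ℝ} {x t : ℝ}

theorem smoothOnBox_constU (hξ : SmoothOnRect X T ξ) : SmoothOnBox X T U (constU ξ) := hξ.lift U

theorem smoothOnBox_affineU (hA : SmoothOnRect X T A) (hC : SmoothOnRect X T C) :
    SmoothOnBox X T U (affineU A C) :=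
  ContDiffOn.add (hA.lift U) (ContDiffOn.mul (hC.lift U)
    (contDiff_snd.comp contDiff_snd).contDiffOn)

theorem dX_constU (a : ℝ → ℝ → ℝ) : dX (constU a) = constU (px a) := rfl
theorem dT_constU (a : ℝ → ℝ → ℝ) : dT (constU a) = constU (pt a) := rfl
theorem dU_constU (a : ℝ → ℝ → ℝ) : dU (constU a) = constU (fun _ _ => 0) := by
  funext x t u
  simp [dU, constU]

theorem px_zero : px (fun _ _ => 0) = fun _ _ => 0 := by
  funext x t
  simp [px]

theorem pt_zero : pt (fun _ _ => 0) = fun _ _ => 0 := by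
  funext x t
  simp [pt]

theorem dU_affineU (A C : ℝ → ℝ → ℝ) : dU (affineU A C) = constU C := by
  funext x t u
  simp [dU, affineU, constU]

theorem dX_affineU (hX : IsOpen X) (hT : IsOpen T) (hA : SmoothOnRect X T A)
    (hC : SmoothOnRect X T C) : EqOnBox X T U (dX (affineU A C)) (affineU (px A) (px C)) :=
  fun _ hx _ ht u _ =>
    ((hA.hasDerivAt_x hX hT hx ht).add ((hC.hasDerivAt_x hX hT hx ht).mul_const u)).deriv

theorem dT_affineU (hX : IsOpen X) (hT : IsOpen T) (hA : SmoothOnRect X T A)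
    (hC : SmoothOnRect X T C) : EqOnBox X T U (dT (affineU A C)) (affineU (pt A) (pt C)) :=
  fun _ hx _ ht u _ =>
    ((hA.hasDerivAt_t hX hT hx ht).add ((hC.hasDerivAt_t hX hT hx ht).mul_const u)).deriv

/-- The determining equations at `(x, t)` of the nonclassical symmetries `ξ ∂_x + ∂_t + φ ∂_u` with
`ξ = ξ(x, t)` and `φ = A(x, t) + C(x, t) u`.  A field is named after the jet monomial from whose
coefficient it stems; a final number is the power of `u`, with `m1` for `-1`. -/
structure AffineSystem (α β γ κ : ℝ) (ξ A C : ℝ → ℝ → ℝ) (x t : ℝ) : Prop where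
  u1u3 : α * A x t = 0
  u2u2 : β * A x t = 0
  u3_0 : α * px A x t = 0
  u3_1 : 6 * px (px ξ) x t = (4 + α) * px C x t
  u1u2 : (3 * α + 4 * β) * px C x t = (3 * α + 2 * β) * px (px ξ) x t
  u2_m1 : A x t * (ξ x t ^ 2 - κ) = 0
  u2_0 : -(C x t - 2 * px ξ x t) * (ξ x t ^ 2 - κ) + 2 * ξ x t * pt ξ x t
    + 2 * ξ x t ^ 2 * px ξ x t - 2 * β * px (px A) x t = 0
  u2_1 : -(4 * γ * px ξ x t) - 6 * px (px C) x t + 4 * px (px (px ξ)) x t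
    - 2 * β * px (px C) x t = 0
  u1u1_m1 : γ * A x t = 0
  u1u1_0 : 4 * γ * px ξ x t + α * (3 * px (px C) x t - px (px (px ξ)) x t) = 0
  u1_m1 : A x t * (-(2 * ξ x t * C x t) - pt ξ x t + ξ x t * px ξ x t) = 0
  u1_0 : -(C x t - 4 * px ξ x t) * (-(2 * ξ x t * C x t) - pt ξ x t + ξ x t * px ξ x t)
    - 2 * ξ x t * pt C x t - pt (pt ξ) x t - 2 * pt ξ x t * (C x t - px ξ x t)
    - κ * (2 * px C x t - px (px ξ) x t) - 4 * γ * px A x t - α * px (px (px A)) x t = 0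
  u1_1 : -(2 * γ * (2 * px C x t - px (px ξ) x t)) - 4 * γ * px C x t
    - (4 + α) * px (px (px C)) x t + px (px (px (px ξ))) x t = 0
  u0_m1 : A x t * (pt A x t + A x t * C x t - ξ x t * px A x t) = 0
  u0_0 : -(C x t - 4 * px ξ x t) * (pt A x t + A x t * C x t - ξ x t * px A x t)
    - A x t * (pt C x t + C x t ^ 2 - ξ x t * px C x t) + pt (pt A) x t + 2 * pt C x t * A x t
    - 2 * pt ξ x t * px A x t - κ * px (px A) x t = 0
  u0_1 : -(C x t - 4 * px ξ x t) * (pt C x t + C x t ^ 2 - ξ x t * px C x t) + pt (pt C) x t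
    + 2 * C x t * pt C x t - 2 * pt ξ x t * px C x t - κ * px (px C) x t
    - 2 * γ * px (px A) x t - px (px (px (px A))) x t = 0
  u0_2 : 2 * γ * px (px C) x t + px (px (px (px C))) x t = 0

/-- Elimination of `u_xxxx` from `pr v (Δ)` by means of `Δ = 0`, sorted by monomials. -/
theorem red_affine_identity (hX : IsOpen X) (hT : IsOpen T) (hA : SmoothOnRect X T A)
    (hC : SmoothOnRect X T C) (hx : x ∈ X) (ht : t ∈ T)
    (α β γ κ u u₁ u₂ u₃ u₄ : ℝ) :
    u * redPr (constU ξ) (affineU A C) x t u u₁ u₂ u₃ u₄ α β γ κ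
      - (A x t + u * (2 * C x t - 4 * px ξ x t))
        * redDelta (constU ξ) (affineU A C) x t u u₁ u₂ u₃ u₄ α β γ κ =
    (α * A x t) * (u₁ * u₃) + (β * A x t) * u₂ ^ 2
    + (-(α * px A x t) * u + (6 * px (px ξ) x t - (4 + α) * px C x t) * u ^ 2) * u₃
    + ((3 * α + 2 * β) * px (px ξ) x t - (3 * α + 4 * β) * px C x t) * u * (u₁ * u₂)
    + (-(A x t * (ξ x t ^ 2 - κ))
      + (-(C x t - 2 * px ξ x t) * (ξ x t ^ 2 - κ) + 2 * ξ x t * pt ξ x t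
        + 2 * ξ x t ^ 2 * px ξ x t - 2 * β * px (px A) x t) * u
      + (-(4 * γ * px ξ x t) - 6 * px (px C) x t + 4 * px (px (px ξ)) x t
        - 2 * β * px (px C) x t) * u ^ 2) * u₂
    + (2 * (γ * A x t)
      + -(4 * γ * px ξ x t + α * (3 * px (px C) x t - px (px (px ξ)) x t)) * u) * u₁ ^ 2
    + (-(A x t * (-(2 * ξ x t * C x t) - pt ξ x t + ξ x t * px ξ x t))
      + (-(C x t - 4 * px ξ x t) * (-(2 * ξ x t * C x t) - pt ξ x t + ξ x t * px ξ x t)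
        - 2 * ξ x t * pt C x t - pt (pt ξ) x t - 2 * pt ξ x t * (C x t - px ξ x t)
        - κ * (2 * px C x t - px (px ξ) x t) - 4 * γ * px A x t - α * px (px (px A)) x t) * u
      + (-(2 * γ * (2 * px C x t - px (px ξ) x t)) - 4 * γ * px C x t
        - (4 + α) * px (px (px C)) x t + px (px (px (px ξ))) x t) * u ^ 2) * u₁
    + (-(A x t * (pt A x t + A x t * C x t - ξ x t * px A x t))
      + (-(C x t - 4 * px ξ x t) * (pt A x t + A x t * C x t - ξ x t * px A x t)
        - A x t * (pt C x t + C x t ^ 2 - ξ x t * px C x t) + pt (pt A) x t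
        + 2 * pt C x t * A x t - 2 * pt ξ x t * px A x t - κ * px (px A) x t) * u
      + (-(C x t - 4 * px ξ x t) * (pt C x t + C x t ^ 2 - ξ x t * px C x t) + pt (pt C) x t
        + 2 * C x t * pt C x t - 2 * pt ξ x t * px C x t - κ * px (px C) x t
        - 2 * γ * px (px A) x t - px (px (px (px A))) x t) * u ^ 2
      + -(2 * γ * px (px C) x t + px (px (px (px C))) x t) * u ^ 3) := by
  have sA := hA.smooth_px hX hT
  have sC := hC.smooth_px hX hT
  have sAA := sA.smooth_px hX hT
  have sCC := sC.smooth_px hX hT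
  have sA3 := sAA.smooth_px hX hT
  have sC3 := sCC.smooth_px hX hT
  have tA := hA.smooth_pt hX hT
  have tC := hC.smooth_pt hX hT
  have x1 : EqOnBox X T univ _ _ := dX_affineU hX hT hA hC
  have x2 : EqOnBox X T univ (dX (dX (affineU A C))) (affineU (px (px A)) (px (px C))) :=
    fun x hx t ht u hu => (x1.congr_dX hX x hx t ht u hu).trans
      (dX_affineU hX hT sA sC x hx t ht u hu)
  have x3 : EqOnBox X T univ (dX (dX (dX (affineU A C))))
      (affineU (px (px (px A))) (px (px (px C)))) :=
    fun x hx t ht u hu => (x2.congr_dX hX x hx t ht u hu).trans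
      (dX_affineU hX hT sAA sCC x hx t ht u hu)
  have x4 : EqOnBox X T univ (dX (dX (dX (dX (affineU A C)))))
      (affineU (px (px (px (px A)))) (px (px (px (px C))))) :=
    fun x hx t ht u hu => (x3.congr_dX hX x hx t ht u hu).trans
      (dX_affineU hX hT sA3 sC3 x hx t ht u hu)
  have t1 : EqOnBox X T univ _ _ := dT_affineU hX hT hA hC
  have t2 : EqOnBox X T univ (dT (dT (affineU A C))) (affineU (pt (pt A)) (pt (pt C))) :=
    fun x hx t ht u hu => (t1.congr_dT hT x hx t ht u hu).trans
      (dT_affineU hX hT tA tC x hx t ht u hu)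
  simp only [redDelta, redPr, redTT, surfTT, surfXT, surfT, red1, red2, red3, red4, xD1, xD2, xD3,
    xD4, tD1, tD2, x1 x hx t ht u (mem_univ u), x2 x hx t ht u (mem_univ u),
    x3 x hx t ht u (mem_univ u), x4 x hx t ht u (mem_univ u), t1 x hx t ht u (mem_univ u),
    t2 x hx t ht u (mem_univ u), dU_affineU, dU_constU, dX_constU, dT_constU, px_zero, pt_zero]
  simp only [constU, affineU]
  ring

theorem AffineSystem.red_eq_zero (hX : IsOpen X) (hT : IsOpen T) (hA : SmoothOnRect X T A)
    (hC : SmoothOnRect X T C) (hx : x ∈ X) (ht : t ∈ T) {α β γ κ : ℝ}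
    (h : AffineSystem α β γ κ ξ A C x t) {u u₁ u₂ u₃ u₄ : ℝ} (hu : u ≠ 0)
    (hΔ : redDelta (constU ξ) (affineU A C) x t u u₁ u₂ u₃ u₄ α β γ κ = 0) :
    redPr (constU ξ) (affineU A C) x t u u₁ u₂ u₃ u₄ α β γ κ = 0 := by
  have hid := red_affine_identity (ξ := ξ) hX hT hA hC hx ht α β γ κ u u₁ u₂ u₃ u₄
  rw [hΔ, h.u1u3, h.u2u2, h.u3_0, h.u3_1, h.u1u2, h.u2_m1, h.u2_0, h.u2_1, h.u1u1_m1, h.u1u1_0,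
    h.u1_m1, h.u1_0, h.u1_1, h.u0_m1, h.u0_0, h.u0_1, h.u0_2] at hid
  have h0 : u * redPr (constU ξ) (affineU A C) x t u u₁ u₂ u₃ u₄ α β γ κ = 0 := by
    linear_combination hid
  exact (mul_eq_zero.1 h0).resolve_left hu

/-- A polynomial in `u, u₁, u₂, u₃` of the shape met in `red_affine_identity` vanishes identically
only if its coefficients do. -/
theorem coeffs_eq_zero_of_forall {S : Set ℝ} (hS : S.Infinite)
    {a b c₁ c₂ d e₀ e₁ e₂ f₀ f₁ g₀ g₁ g₂ h₀ h₁ h₂ h₃ : ℝ}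
    (h : ∀ u ∈ S, ∀ u₁ u₂ u₃ : ℝ, a * (u₁ * u₃) + b * u₂ ^ 2 + (c₁ * u + c₂ * u ^ 2) * u₃
      + d * u * (u₁ * u₂) + (e₀ + e₁ * u + e₂ * u ^ 2) * u₂ + (f₀ + f₁ * u) * u₁ ^ 2
      + (g₀ + g₁ * u + g₂ * u ^ 2) * u₁ + (h₀ + h₁ * u + h₂ * u ^ 2 + h₃ * u ^ 3) = 0) :
    (a = 0 ∧ b = 0 ∧ c₁ = 0 ∧ c₂ = 0 ∧ d = 0) ∧ (e₀ = 0 ∧ e₁ = 0 ∧ e₂ = 0) ∧ (f₀ = 0 ∧ f₁ = 0) ∧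
      (g₀ = 0 ∧ g₁ = 0 ∧ g₂ = 0) ∧ (h₀ = 0 ∧ h₁ = 0 ∧ h₂ = 0 ∧ h₃ = 0) := by
  have P : ∀ {a₀ a₁ a₂ a₃ : ℝ}, (∀ u ∈ S, a₀ + a₁ * u + a₂ * u ^ 2 + a₃ * u ^ 3 = 0) →
      a₀ = 0 ∧ a₁ = 0 ∧ a₂ = 0 ∧ a₃ = 0 := by
    intro a₀ a₁ a₂ a₃ hu
    obtain ⟨h0, h1, h2, h3, -⟩ := coeffs_eq_zero_of_infinite (a₀ := a₀) (a₁ := a₁)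
      (a₂ := a₂) (a₃ := a₃) (a₄ := 0) (a₅ := 0) (a₆ := 0) (a₇ := 0) (a₈ := 0) hS
      fun u hS => by linear_combination hu u hS
    exact ⟨h0, h1, h2, h3⟩
  obtain ⟨k0, k1, k2, k3⟩ := P (a₀ := h₀) (a₁ := h₁) (a₂ := h₂) (a₃ := h₃)
    fun u hu => by linear_combination h u hu 0 0 0
  obtain ⟨-, r1, r2, -⟩ := P (a₀ := 0) (a₁ := c₁) (a₂ := c₂) (a₃ := 0)
    fun u hu => by linear_combination h u hu 0 0 1 - h u hu 0 0 0
  obtain ⟨s0, s1, s2, -⟩ := P (a₀ := e₀) (a₁ := e₁) (a₂ := e₂) (a₃ := 0)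
    fun u hu => by linear_combination (h u hu 0 1 0 - h u hu 0 (-1) 0) / 2
  obtain ⟨p0, -⟩ := P (a₀ := b) (a₁ := 0) (a₂ := 0) (a₃ := 0)
    fun u hu => by linear_combination (h u hu 0 1 0 + h u hu 0 (-1) 0) / 2 - h u hu 0 0 0
  obtain ⟨m0, m1, m2, -⟩ := P (a₀ := g₀) (a₁ := g₁) (a₂ := g₂) (a₃ := 0)
    fun u hu => by linear_combination (h u hu 1 0 0 - h u hu (-1) 0 0) / 2
  obtain ⟨n0, n1, -⟩ := P (a₀ := f₀) (a₁ := f₁) (a₂ := 0) (a₃ := 0)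
    fun u hu => by linear_combination (h u hu 1 0 0 + h u hu (-1) 0 0) / 2 - h u hu 0 0 0
  obtain ⟨o0, -⟩ := P (a₀ := a) (a₁ := 0) (a₂ := 0) (a₃ := 0)
    fun u hu => by linear_combination h u hu 1 0 1 - h u hu 1 0 0 - h u hu 0 0 1 + h u hu 0 0 0
  obtain ⟨-, q1, -⟩ := P (a₀ := 0) (a₁ := d) (a₂ := 0) (a₃ := 0)
    fun u hu => by linear_combination h u hu 1 1 0 - h u hu 1 0 0 - h u hu 0 1 0 + h u hu 0 0 0
  exact ⟨⟨o0, p0, r1, r2, q1⟩, ⟨s0, s1, s2⟩, ⟨n0, n1⟩, ⟨m0, m1, m2⟩, k0, k1, k2, k3⟩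

theorem affineSystem_of_red (hX : IsOpen X) (hT : IsOpen T) (hA : SmoothOnRect X T A)
    (hC : SmoothOnRect X T C) (hx : x ∈ X) (ht : t ∈ T) {α β γ κ : ℝ} {S : Set ℝ}
    (hS : S.Infinite) (hS0 : ∀ u ∈ S, u ≠ 0)
    (h : ∀ u ∈ S, ∀ u₁ u₂ u₃ u₄ : ℝ,
      redDelta (constU ξ) (affineU A C) x t u u₁ u₂ u₃ u₄ α β γ κ = 0 →
      redPr (constU ξ) (affineU A C) x t u u₁ u₂ u₃ u₄ α β γ κ = 0) :
    AffineSystem α β γ κ ξ A C x t := by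
  obtain ⟨⟨a, b, c₁, c₂, d⟩, ⟨e₀, e₁, e₂⟩, ⟨f₀, f₁⟩, ⟨g₀, g₁, g₂⟩, h₀, h₁, h₂, h₃⟩ :=
    coeffs_eq_zero_of_forall hS fun u hu u₁ u₂ u₃ => by
      have hΔ : redDelta (constU ξ) (affineU A C) x t u u₁ u₂ u₃
          (redDelta (constU ξ) (affineU A C) x t u u₁ u₂ u₃ 0 α β γ κ / u) α β γ κ = 0 := by
        have := hS0 u hu
        simp only [redDelta]
        field_simp
        ring
      have hid := red_affine_identity (ξ := ξ) hX hT hA hC hx ht α β γ κ u u₁ u₂ u₃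
        (redDelta (constU ξ) (affineU A C) x t u u₁ u₂ u₃ 0 α β γ κ / u)
      rw [hΔ, h u hu u₁ u₂ u₃ _ hΔ, mul_zero, mul_zero, sub_zero] at hid
      exact hid.symm
  exact ⟨a, b, by linarith, by linarith, by linarith, by linarith, e₁, e₂, by linarith,
    by linarith, by linarith, g₁, g₂, by linarith, h₁, h₂, by linarith⟩

end Affine

/-! ### Nonclassical infinitesimals are affine in `u` -/

section Structure

variable {X T U : Set ℝ} {ξ φ : ℝ → ℝ → ℝ → ℝ} {α β γ κ : ℝ}

theorem IsNonclassicalSymmetry.mono {X' T' U' : Set ℝ}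
    (h : IsNonclassicalSymmetry α β γ κ 0 X T U ξ φ) (hX : X' ⊆ X) (hT : T' ⊆ T) (hU : U' ⊆ U) :
    IsNonclassicalSymmetry α β γ κ 0 X' T' U' ξ φ :=
  fun j hx ht hu => h j (hX hx) (hT ht) (hU hu)

theorem SmoothOnBox.mono {X' T' U' : Set ℝ} {f : ℝ → ℝ → ℝ → ℝ}
    (h : SmoothOnBox X T U f) (hX : X' ⊆ X) (hT : T' ⊆ T) (hU : U' ⊆ U) :
    SmoothOnBox X' T' U' f :=
  ContDiffOn.mono h (prod_mono hX (prod_mono hT hU))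

/-- A continuous function on an open set that vanishes away from `0` vanishes. -/
theorem eq_zero_on_box_of_ne_zero (hU : IsOpen U) {f : ℝ → ℝ} (hf : ContinuousOn f U)
    (h : ∀ u ∈ U, u ≠ 0 → f u = 0) : ∀ u ∈ U, f u = 0 :=
  eq_zero_of_mul_eq_zero_of_interior hU (f := id) hf
    (fun u hu => by
      by_cases h0 : u = 0
      · simp [h0]
      · simp [h u hu h0])
    (fun u _ hev => by
      exfalso
      have h1 : ∀ᶠ q : ℝ in nhdsWithin u {u}ᶜ, id q = 0 := hev.filter_mono nhdsWithin_le_nhds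
      have h2 : ∀ᶠ q : ℝ in nhdsWithin u {u}ᶜ, q ≠ u := eventually_mem_nhdsWithin
      have hu0 : u = 0 := hev.self_of_nhds
      obtain ⟨q, hq1, hq2⟩ := (h1.and h2).exists
      exact hq2 (by simpa [hu0] using hq1))

theorem SmoothOnBox.slice_u {f : ℝ → ℝ → ℝ → ℝ} (h : SmoothOnBox X T U f) {x t : ℝ} (hx : x ∈ X)
    (ht : t ∈ T) : ContDiffOn ℝ ∞ (fun u => f x t u) U :=
  ContDiffOn.comp (t := X ×ˢ T ×ˢ U) h
    (contDiff_const.prodMk (contDiff_const.prodMk contDiff_id)).contDiffOn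
    fun _ hp => ⟨hx, ht, hp⟩

/-- `Δ = 0` solved for `u_xxxx` and inserted into `pr v (Δ) = 0`. -/
theorem redPr_solved {x t u : ℝ} (hu : u ≠ 0) (H : ∀ u₁ u₂ u₃ u₄ : ℝ,
      redDelta ξ φ x t u u₁ u₂ u₃ u₄ α β γ κ = 0 → redPr ξ φ x t u u₁ u₂ u₃ u₄ α β γ κ = 0)
    (u₁ u₂ u₃ : ℝ) :
    redPr ξ φ x t u u₁ u₂ u₃ (redDelta ξ φ x t u u₁ u₂ u₃ 0 α β γ κ / u) α β γ κ = 0 := by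
  apply H
  simp only [redDelta]
  field_simp
  ring

/-- The coefficient of `u_xx u_xxx` shows that `ξ` does not depend on `u`. -/
theorem IsNonclassicalSymmetry.dU_xi (hX : IsOpen X) (hT : IsOpen T) (hU : IsOpen U)
    (hξ : SmoothOnBox X T U ξ) (hφ : SmoothOnBox X T U φ)
    (h : IsNonclassicalSymmetry α β γ κ 0 X T U ξ φ) :
    EqOnBox X T U (dU ξ) (fun _ _ _ => 0) := by
  rw [isNonclassicalSymmetry_iff hX hT hU hξ hφ] at h
  intro x hx t ht
  refine eq_zero_on_box_of_ne_zero hU ((hξ.smooth_dU hX hT hU).slice_u hx ht).continuousOn ?_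
  intro u hu hu0
  have E := redPr_solved hu0 (h x hx t ht u hu hu0) 0
  have e11 := E 1 1
  have e10 := E 1 0
  have e01 := E 0 1
  have e00 := E 0 0
  simp only [redDelta, redPr, redTT, surfTT, surfXT, surfT, red1, red2, red3, red4, xD1, xD2, xD3,
    xD4, tD1, tD2] at e11 e10 e01 e00
  have : 10 * u * dU ξ x t u = 0 := by linear_combination e11 - e10 - e01 + e00
  simpa [hu0] using this

theorem exists_eq_constU (hX : IsOpen X) (hT : IsOpen T) (hU : IsOpen U) (hU' : IsPreconnected U)
    (hU'' : U.Nonempty) {f : ℝ → ℝ → ℝ → ℝ} (hf : SmoothOnBox X T U f)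
    (h : EqOnBox X T U (dU f) (fun _ _ _ => 0)) :
    ∃ a : ℝ → ℝ → ℝ, SmoothOnRect X T a ∧ EqOnBox X T U f (constU a) := by
  obtain ⟨u₀, hu₀⟩ := hU''
  refine ⟨fun x t => f x t u₀, hf.restrict hu₀, fun x hx t ht u hu => ?_⟩
  refine eq_of_hasDerivAt_zero hU hU' (f := fun u => f x t u) (fun u hu => ?_) hu hu₀
  have := hf.hasDerivAt_u hX hT hU hx ht hu
  rwa [h x hx t ht u hu] at this

/-- If `ξ = a(x, t)`, eliminating `u_xxxx` leaves an equation in `u_x, u_xx, u_xxx`. -/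
theorem red_eliminated {a : ℝ → ℝ → ℝ} {x t u : ℝ} (hu : u ≠ 0) (H : ∀ u₁ u₂ u₃ u₄ : ℝ,
      redDelta (constU a) φ x t u u₁ u₂ u₃ u₄ α β γ κ = 0 →
      redPr (constU a) φ x t u u₁ u₂ u₃ u₄ α β γ κ = 0) (u₁ u₂ u₃ : ℝ) :
    u * redPr (constU a) φ x t u u₁ u₂ u₃ 0 α β γ κ
      - (φ x t u + u * (dU φ x t u - 4 * px a x t))
        * redDelta (constU a) φ x t u u₁ u₂ u₃ 0 α β γ κ = 0 := by
  have hind : ∀ u₄ : ℝ, u * redPr (constU a) φ x t u u₁ u₂ u₃ u₄ α β γ κ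
      - (φ x t u + u * (dU φ x t u - 4 * px a x t))
        * redDelta (constU a) φ x t u u₁ u₂ u₃ u₄ α β γ κ =
      u * redPr (constU a) φ x t u u₁ u₂ u₃ 0 α β γ κ
      - (φ x t u + u * (dU φ x t u - 4 * px a x t))
        * redDelta (constU a) φ x t u u₁ u₂ u₃ 0 α β γ κ := by
    intro u₄
    simp only [redDelta, redPr, red4, xD4, xD1, dU_constU, dX_constU, px_zero]
    simp only [constU]
    ring
  have hΔ : redDelta (constU a) φ x t u u₁ u₂ u₃
      (redDelta (constU a) φ x t u u₁ u₂ u₃ 0 α β γ κ / u) α β γ κ = 0 := by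
    simp only [redDelta]
    field_simp
    ring
  rw [← hind (redDelta (constU a) φ x t u u₁ u₂ u₃ 0 α β γ κ / u), hΔ, H _ _ _ _ hΔ]
  ring

/-- The coefficients of `u_x u_xxx`, `u_xx²` and `u_x² u_xx`. -/
theorem redPr_coeffs {a : ℝ → ℝ → ℝ} {x t u : ℝ} (hu : u ≠ 0) (H : ∀ u₁ u₂ u₃ u₄ : ℝ,
      redDelta (constU a) φ x t u u₁ u₂ u₃ u₄ α β γ κ = 0 →
      redPr (constU a) φ x t u u₁ u₂ u₃ u₄ α β γ κ = 0) :
    α * (φ x t u - u * dU φ x t u) = 4 * u ^ 2 * dU (dU φ) x t u ∧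
    β * (φ x t u - u * dU φ x t u) = 3 * u ^ 2 * dU (dU φ) x t u ∧
    6 * u * dU (dU (dU φ)) x t u + (3 * α + 2 * β) * dU (dU φ) x t u = 0 := by
  have E := red_eliminated hu H
  simp only [redDelta, redPr, redTT, surfTT, surfXT, surfT, red1, red2, red3, red4, xD1, xD2, xD3,
    xD4, tD1, tD2, dU_constU, dX_constU, dT_constU, px_zero, pt_zero] at E
  simp only [constU] at E
  refine ⟨?_, ?_, ?_⟩
  · linear_combination E 1 0 1 - E 1 0 0 - E 0 0 1 + E 0 0 0
  · linear_combination (E 0 1 0 + E 0 (-1) 0) / 2 - E 0 0 0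
  · have : u * (6 * u * dU (dU (dU φ)) x t u + (3 * α + 2 * β) * dU (dU φ) x t u) = 0 := by
      linear_combination
        -((E 1 1 0 + E (-1) 1 0) / 2 - (E 1 0 0 + E (-1) 0 0) / 2 - E 0 1 0 + E 0 0 0)
    exact (mul_eq_zero.1 this).resolve_left hu

end Structure

/-! ### Exclusion of infinitesimals `A/u + C u` -/

/-- The function `A(x, t) m(u) + C(x, t) n(u)`. -/
def mixU (A C : ℝ → ℝ → ℝ) (m n : ℝ → ℝ) (x t u : ℝ) : ℝ := A x t * m u + C x t * n u

section Laurent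

variable {X T U : Set ℝ} {φ : ℝ → ℝ → ℝ → ℝ} {α β γ κ : ℝ} {A C a : ℝ → ℝ → ℝ}

theorem dX_mixU (hX : IsOpen X) (hT : IsOpen T) (hA : SmoothOnRect X T A)
    (hC : SmoothOnRect X T C) (m n : ℝ → ℝ) :
    EqOnBox X T U (dX (mixU A C m n)) (mixU (px A) (px C) m n) :=
  fun _ hx _ ht u _ => (((hA.hasDerivAt_x hX hT hx ht).mul_const (m u)).add
    ((hC.hasDerivAt_x hX hT hx ht).mul_const (n u))).deriv

theorem dT_mixU (hX : IsOpen X) (hT : IsOpen T) (hA : SmoothOnRect X T A)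
    (hC : SmoothOnRect X T C) (m n : ℝ → ℝ) :
    EqOnBox X T U (dT (mixU A C m n)) (mixU (pt A) (pt C) m n) :=
  fun _ hx _ ht u _ => (((hA.hasDerivAt_t hX hT hx ht).mul_const (m u)).add
    ((hC.hasDerivAt_t hX hT hx ht).mul_const (n u))).deriv

theorem dU_mixU {m n m' n' : ℝ → ℝ} (hm : ∀ u ∈ U, HasDerivAt m (m' u) u)
    (hn : ∀ u ∈ U, HasDerivAt n (n' u) u) :
    EqOnBox X T U (dU (mixU A C m n)) (mixU A C m' n') :=
  fun x _ t _ u hu => (((hm u hu).const_mul (A x t)).add ((hn u hu).const_mul (C x t))).deriv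

theorem EqOnBox.trans {f g h : ℝ → ℝ → ℝ → ℝ} (h₁ : EqOnBox X T U f g) (h₂ : EqOnBox X T U g h) :
    EqOnBox X T U f h :=
  fun x hx t ht u hu => (h₁ x hx t ht u hu).trans (h₂ x hx t ht u hu)

theorem hasDerivAt_const_mul_inv_pow (c : ℝ) (k : ℕ) {u : ℝ} (hu : u ≠ 0) :
    HasDerivAt (fun u : ℝ => c * u⁻¹ ^ k) (-(c * k) * u⁻¹ ^ (k + 1)) u := by
  have h := ((hasDerivAt_inv hu).pow k).const_mul c
  refine h.congr_deriv ?_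
  rcases k with _ | k
  · simp
  · simp only [Nat.add_sub_cancel, inv_pow]
    field_simp
    ring

/-- The partial derivatives of `φ = A(x, t)/u + C(x, t) u` entering `pr v (Δ)`. -/
theorem laurent_partials (hX : IsOpen X) (hT : IsOpen T) (hU : IsOpen U)
    (hU0 : ∀ u ∈ U, u ≠ 0) (hA : SmoothOnRect X T A) (hC : SmoothOnRect X T C)
    (hφ : EqOnBox X T U φ (fun x t u => A x t / u + C x t * u)) {x t u : ℝ} (hx : x ∈ X)
    (ht : t ∈ T) (hu : u ∈ U) :
    (φ x t u = A x t / u + C x t * u ∧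
    dX φ x t u = px A x t / u + px C x t * u ∧
    dX (dX φ) x t u = px (px A) x t / u + px (px C) x t * u ∧
    dX (dX (dX φ)) x t u = px (px (px A)) x t / u + px (px (px C)) x t * u ∧
    dX (dX (dX (dX φ))) x t u
      = px (px (px (px A))) x t / u + px (px (px (px C))) x t * u) ∧
    (dU φ x t u = -A x t / u ^ 2 + C x t ∧
    dX (dU φ) x t u = -px A x t / u ^ 2 + px C x t ∧
    dX (dX (dU φ)) x t u = -px (px A) x t / u ^ 2 + px (px C) x t ∧
    dX (dX (dX (dU φ))) x t u = -px (px (px A)) x t / u ^ 2 + px (px (px C)) x t) ∧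
    (dU (dU φ) x t u = 2 * A x t / u ^ 3 ∧
    dX (dU (dU φ)) x t u = 2 * px A x t / u ^ 3 ∧
    dX (dX (dU (dU φ))) x t u = 2 * px (px A) x t / u ^ 3) ∧
    (dU (dU (dU φ)) x t u = -6 * A x t / u ^ 4 ∧
    dX (dU (dU (dU φ))) x t u = -6 * px A x t / u ^ 4) ∧
    dU (dU (dU (dU φ))) x t u = 24 * A x t / u ^ 5 ∧
    (dT φ x t u = pt A x t / u + pt C x t * u ∧
    dT (dT φ) x t u = pt (pt A) x t / u + pt (pt C) x t * u ∧
    dT (dU φ) x t u = -pt A x t / u ^ 2 + pt C x t) := by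
  have sA := hA.smooth_px hX hT
  have sC := hC.smooth_px hX hT
  have sAA := sA.smooth_px hX hT
  have sCC := sC.smooth_px hX hT
  have sA3 := sAA.smooth_px hX hT
  have sC3 := sCC.smooth_px hX hT
  have tA := hA.smooth_pt hX hT
  have tC := hC.smooth_pt hX hT
  have m : ∀ (c : ℝ) (k : ℕ) (d : ℝ), d = -(c * k) → ∀ u ∈ U,
      HasDerivAt (fun u : ℝ => c * u⁻¹ ^ k) (d * u⁻¹ ^ (k + 1)) u := by
    rintro c k d rfl u hu
    exact hasDerivAt_const_mul_inv_pow c k (hU0 u hu)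
  have n0 : ∀ u ∈ U, HasDerivAt (fun u : ℝ => u) 1 u := fun u _ => hasDerivAt_id u
  have n1 : ∀ c : ℝ, ∀ u ∈ U, HasDerivAt (fun _ : ℝ => c) 0 u := fun c u _ => hasDerivAt_const u c
  have f : EqOnBox X T U φ (mixU A C (fun u => 1 * u⁻¹ ^ 1) (fun u => u)) :=
    hφ.trans fun x _ t _ u _ => by simp [mixU, div_eq_mul_inv]
  have fx := (f.congr_dX hX).trans (dX_mixU hX hT hA hC _ _)
  have fxx := (fx.congr_dX hX).trans (dX_mixU hX hT sA sC _ _)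
  have fxxx := (fxx.congr_dX hX).trans (dX_mixU hX hT sAA sCC _ _)
  have fxxxx := (fxxx.congr_dX hX).trans (dX_mixU hX hT sA3 sC3 _ _)
  have fu := (f.congr_dU hU).trans (dU_mixU (m 1 1 (-1) (by norm_num)) n0)
  have fxu := (fu.congr_dX hX).trans (dX_mixU hX hT hA hC _ _)
  have fxxu := (fxu.congr_dX hX).trans (dX_mixU hX hT sA sC _ _)
  have fxxxu := (fxxu.congr_dX hX).trans (dX_mixU hX hT sAA sCC _ _)
  have fuu := (fu.congr_dU hU).trans (dU_mixU (m (-1) 2 2 (by norm_num)) (n1 1))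
  have fxuu := (fuu.congr_dX hX).trans (dX_mixU hX hT hA hC _ _)
  have fxxuu := (fxuu.congr_dX hX).trans (dX_mixU hX hT sA sC _ _)
  have fuuu := (fuu.congr_dU hU).trans (dU_mixU (m 2 3 (-6) (by norm_num)) (n1 0))
  have fxuuu := (fuuu.congr_dX hX).trans (dX_mixU hX hT hA hC _ _)
  have fuuuu := (fuuu.congr_dU hU).trans (dU_mixU (m (-6) 4 24 (by norm_num)) (n1 0))
  have ft := (f.congr_dT hT).trans (dT_mixU hX hT hA hC _ _)
  have ftt := (ft.congr_dT hT).trans (dT_mixU hX hT tA tC _ _)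
  have ftu := (fu.congr_dT hT).trans (dT_mixU hX hT hA hC _ _)
  rw [f x hx t ht u hu, fx x hx t ht u hu, fxx x hx t ht u hu, fxxx x hx t ht u hu,
    fxxxx x hx t ht u hu, fu x hx t ht u hu, fxu x hx t ht u hu, fxxu x hx t ht u hu,
    fxxxu x hx t ht u hu, fuu x hx t ht u hu, fxuu x hx t ht u hu, fxxuu x hx t ht u hu,
    fuuu x hx t ht u hu, fxuuu x hx t ht u hu, fuuuu x hx t ht u hu, ft x hx t ht u hu,
    ftt x hx t ht u hu, ftu x hx t ht u hu]
  simp only [mixU]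
  refine ⟨⟨?_, ?_, ?_, ?_, ?_⟩, ⟨?_, ?_, ?_, ?_⟩, ⟨?_, ?_, ?_⟩, ⟨?_, ?_⟩, ?_, ?_, ?_, ?_⟩ <;> ring

/-- The coefficients of `u_xxx` and `u_xx` for `φ = A/u + C u`, `α = 4`, `β = 3`. -/
theorem laurent_first (hX : IsOpen X) (hT : IsOpen T) (hU : IsOpen U) (hUi : U.Infinite)
    (hU0 : ∀ u ∈ U, u ≠ 0) (hA : SmoothOnRect X T A) (hC : SmoothOnRect X T C)
    (hφ : EqOnBox X T U φ (fun x t u => A x t / u + C x t * u)) {x t : ℝ} (hx : x ∈ X)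
    (ht : t ∈ T) (H : ∀ u ∈ U, ∀ u₁ u₂ u₃ u₄ : ℝ,
      redDelta (constU a) φ x t u u₁ u₂ u₃ u₄ 4 3 γ κ = 0 →
      redPr (constU a) φ x t u u₁ u₂ u₃ u₄ 4 3 γ κ = 0) :
    8 * px C x t = 6 * px (px a) x t ∧ A x t * (a x t ^ 2 - κ) = 0 := by
  have key : ∀ u ∈ U, 8 * px C x t = 6 * px (px a) x t ∧
      -(A x t * (a x t ^ 2 - κ)) + 0 * u
      + (-((C x t - 2 * px a x t) * (a x t ^ 2 - κ)) + 2 * a x t * pt a x t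
        + 2 * a x t ^ 2 * px a x t) * u ^ 2
      + (-4 * γ * px a x t - 12 * px (px C) x t + 4 * px (px (px a)) x t) * u ^ 3
      + 0 * u ^ 4 + 0 * u ^ 5 + 0 * u ^ 6 + 0 * u ^ 7 + 0 * u ^ 8 = 0 := by
    intro u hu
    have hu0 := hU0 u hu
    have E := red_eliminated hu0 (H u hu)
    obtain ⟨⟨v0, v1, v2, v3, v4⟩, ⟨w0, w1, w2, w3⟩, ⟨y0, y1, y2⟩, ⟨z0, z1⟩, r, q0, q1, q2⟩ :=
      laurent_partials hX hT hU hU0 hA hC hφ hx ht hu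
    simp only [redDelta, redPr, redTT, surfTT, surfXT, surfT, red1, red2, red3, red4, xD1, xD2,
      xD3, xD4, tD1, tD2, dU_constU, dX_constU, dT_constU, px_zero, pt_zero, v0, v1, v2, v3, v4,
      w0, w1, w2, w3, y0, y1, y2, z0, z1, r, q0, q1, q2] at E
    simp only [constU] at E
    constructor
    · have h : u ^ 6 * (8 * px C x t - 6 * px (px a) x t) = 0 := by
        have h := (E 0 0 0).trans (E 0 0 1).symm
        field_simp at h
        linear_combination h
      have := (mul_eq_zero.1 h).resolve_left (pow_ne_zero 6 hu0)
      linarith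
    · have h := (E 0 1 0).trans (E 0 (-1) 0).symm
      field_simp at h
      refine (mul_eq_zero.1 (?_ : u ^ 3 * _ = 0)).resolve_left (pow_ne_zero 3 hu0)
      linear_combination h / 2
  obtain ⟨u, hu⟩ := hUi.nonempty
  refine ⟨(key u hu).1, ?_⟩
  have := (coeffs_eq_zero_of_infinite hUi fun u hu => (key u hu).2).1
  linarith

/-- The coefficients of `u_x` and `1` for `φ = A/u + C u`, `ξ = s`, `α = 4`, `β = 3`, `κ = s²`. -/
theorem laurent_second (hX : IsOpen X) (hT : IsOpen T) (hU : IsOpen U) (hUi : U.Infinite)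
    (hU0 : ∀ u ∈ U, u ≠ 0) (hA : SmoothOnRect X T A) (hC : SmoothOnRect X T C) {s : ℝ}
    (hφ : EqOnBox X T U φ (fun x t u => A x t / u + C x t * u)) {x t : ℝ} (hx : x ∈ X)
    (ht : t ∈ T) (hCx : px C x t = 0) (hCxx : px (px C) x t = 0)
    (hCxxx : px (px (px C)) x t = 0) (hCxxxx : px (px (px (px C))) x t = 0)
    (H : ∀ u ∈ U, ∀ u₁ u₂ u₃ u₄ : ℝ,
      redDelta (constU fun _ _ => s) φ x t u u₁ u₂ u₃ u₄ 4 3 γ (s ^ 2) = 0 →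
      redPr (constU fun _ _ => s) φ x t u u₁ u₂ u₃ u₄ 4 3 γ (s ^ 2) = 0) :
    A x t = 0 := by
  have key : ∀ u ∈ U,
      -6 * s * A x t ^ 2 + 0 * u
      + (2 * s ^ 2 * px A x t + 2 * s * pt A x t - 4 * s * C x t * A x t) * u ^ 2 + 0 * u ^ 3
      + (2 * s * C x t ^ 2 - 2 * s * pt C x t) * u ^ 4 + 0 * u ^ 5 + 0 * u ^ 6 + 0 * u ^ 7
      + 0 * u ^ 8 = 0 ∧
      (s = 0 → 3 * A x t ^ 3 + 0 * u + (-3 * A x t * pt A x t + 5 * A x t ^ 2 * C x t) * u ^ 2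
      + 0 * u ^ 3 + (pt (pt A) x t - 3 * pt A x t * C x t + A x t * pt C x t
        + A x t * C x t ^ 2) * u ^ 4 + (-px (px (px (px A))) x t - 2 * γ * px (px A) x t) * u ^ 5
      + (pt (pt C) x t + C x t * pt C x t - C x t ^ 3) * u ^ 6 + 0 * u ^ 7 + 0 * u ^ 8 = 0) := by
    intro u hu
    have hu0 := hU0 u hu
    have E := red_eliminated hu0 (H u hu)
    obtain ⟨⟨v0, v1, v2, v3, v4⟩, ⟨w0, w1, w2, w3⟩, ⟨y0, y1, y2⟩, ⟨z0, z1⟩, r, q0, q1, q2⟩ :=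
      laurent_partials hX hT hU hU0 hA hC hφ hx ht hu
    simp only [redDelta, redPr, redTT, surfTT, surfXT, surfT, red1, red2, red3, red4, xD1, xD2,
      xD3, xD4, tD1, tD2, dU_constU, dX_constU, dT_constU, px_zero, pt_zero, v0, v1, v2, v3, v4,
      w0, w1, w2, w3, y0, y1, y2, z0, z1, r, q0, q1, q2, hCx, hCxx, hCxxx, hCxxxx] at E
    have c1 : px (fun _ _ => s) = fun _ _ => 0 := by funext x t; simp [px]
    have c2 : pt (fun _ _ => s) = fun _ _ => 0 := by funext x t; simp [pt]
    simp only [constU, c1, c2, px_zero, pt_zero] at E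
    constructor
    · have h := (E 1 0 0).trans (E (-1) 0 0).symm
      field_simp at h
      refine (mul_eq_zero.1 (?_ : u * _ = 0)).resolve_left hu0
      linear_combination h / 2
    · rintro rfl
      have h := E 0 0 0
      field_simp at h
      linear_combination h
  have h1 := (coeffs_eq_zero_of_infinite hUi fun u hu => (key u hu).1).1
  by_cases hs : s = 0
  · have h2 := (coeffs_eq_zero_of_infinite hUi fun u hu => (key u hu).2 hs).1
    have : A x t ^ 3 = 0 := by linarith
    exact pow_eq_zero_iff (by norm_num) |>.1 this
  · have : A x t ^ 2 = 0 := by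
      have : s * A x t ^ 2 = 0 := by linarith
      exact (mul_eq_zero.1 this).resolve_left hs
    exact pow_eq_zero_iff (by norm_num) |>.1 this

end Laurent

section AffineStructure

variable {X T U : Set ℝ} {ξ φ : ℝ → ℝ → ℝ → ℝ} {α β γ κ : ℝ} {a : ℝ → ℝ → ℝ}

theorem exists_preconnected_nhd {S : Set ℝ} {x : ℝ} (hS : S ∈ nhds x) :
    ∃ I ⊆ S, IsOpen I ∧ IsPreconnected I ∧ x ∈ I := by
  obtain ⟨r, hr, h⟩ := Metric.mem_nhds_iff.1 hS
  exact ⟨Metric.ball x r, h, Metric.isOpen_ball, (convex_ball x r).isPreconnected,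
    Metric.mem_ball_self hr⟩

theorem SmoothOnRect.mono {X' T' : Set ℝ} (h : SmoothOnRect X T a) (hX : X' ⊆ X) (hT : T' ⊆ T) :
    SmoothOnRect X' T' a :=
  ContDiffOn.mono h (prod_mono hX hT)

/-- A smooth function whose square is constant on a rectangle is constant. -/
theorem eq_const_of_sq_eq (hX : IsOpen X) (hX' : IsPreconnected X) (hT : IsOpen T)
    (hT' : IsPreconnected T) (ha : SmoothOnRect X T a)
    (h : ∀ x ∈ X, ∀ t ∈ T, a x t ^ 2 = κ) {x₀ t₀ : ℝ} (hx₀ : x₀ ∈ X) (ht₀ : t₀ ∈ T) :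
    ∀ x ∈ X, ∀ t ∈ T, a x t = a x₀ t₀ := by
  by_cases hκ : κ = 0
  · intro x hx t ht
    have h1 := h x hx t ht
    have h2 := h x₀ hx₀ t₀ ht₀
    rw [hκ] at h1 h2
    rw [pow_eq_zero_iff (by norm_num) |>.1 h1, pow_eq_zero_iff (by norm_num) |>.1 h2]
  have hne : ∀ x ∈ X, ∀ t ∈ T, a x t ≠ 0 := by
    intro x hx t ht h0
    have := h x hx t ht
    rw [h0] at this
    exact hκ (by simpa using this.symm)
  have hx : ∀ x ∈ X, ∀ t ∈ T, px a x t = 0 := by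
    intro x hx t ht
    have h1 := (ha.hasDerivAt_x hX hT hx ht).pow 2
    have h2 := hasDerivAt_of_eqOn hX (f := fun s => a s t ^ 2) (g := fun _ => κ)
      (fun s hs => h s hs t ht) hx (hasDerivAt_const x κ)
    have h3 := h1.unique h2
    simpa [hne x hx t ht] using h3
  have ht : ∀ x ∈ X, ∀ t ∈ T, pt a x t = 0 := by
    intro x hx t ht
    have h1 := (ha.hasDerivAt_t hX hT hx ht).pow 2
    have h2 := hasDerivAt_of_eqOn hT (f := fun s => a x s ^ 2) (g := fun _ => κ)
      (fun s hs => h x hx s hs) ht (hasDerivAt_const t κ)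
    have h3 := h1.unique h2
    simpa [hne x hx t ht] using h3
  intro x hx' t ht'
  rw [eq_of_hasDerivAt_zero hX hX' (f := fun s => a s t) (fun s hs => by
      rw [← hx s hs t ht']; exact ha.hasDerivAt_x hX hT hs ht') hx' hx₀]
  exact eq_of_hasDerivAt_zero hT hT' (f := fun s => a x₀ s) (fun s hs => by
      rw [← ht x₀ hx₀ s hs]; exact ha.hasDerivAt_t hX hT hx₀ hs) ht' ht₀

/-- `φ = A/u + C u` is only possible with `A = 0`. -/
theorem laurent_eq_zero (hX : IsOpen X) (hT : IsOpen T) (hU : IsOpen U) (hUi : U.Infinite)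
    (hU0 : ∀ u ∈ U, u ≠ 0) {A C : ℝ → ℝ → ℝ} (ha : SmoothOnRect X T a) (hA : SmoothOnRect X T A)
    (hC : SmoothOnRect X T C) (hφ : EqOnBox X T U φ (fun x t u => A x t / u + C x t * u))
    (hφs : SmoothOnBox X T U φ)
    (h : IsNonclassicalSymmetry 4 3 γ κ 0 X T U (constU a) φ) {x₀ t₀ : ℝ} (hx₀ : x₀ ∈ X)
    (ht₀ : t₀ ∈ T) : A x₀ t₀ = 0 := by
  by_contra hne
  have hcont : ContinuousAt (fun p : ℝ × ℝ => A p.1 p.2) (x₀, t₀) :=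
    (ContDiffOn.continuousOn hA).continuousAt ((hX.prod hT).mem_nhds ⟨hx₀, ht₀⟩)
  obtain ⟨V, hV, W, hW, hVW⟩ := mem_nhds_prod_iff.1 (hcont.eventually_ne hne)
  obtain ⟨X', hX'V, hX'o, hX'c, hxX'⟩ :=
    exists_preconnected_nhd (Filter.inter_mem hV (hX.mem_nhds hx₀))
  obtain ⟨T', hT'W, hT'o, hT'c, htT'⟩ :=
    exists_preconnected_nhd (Filter.inter_mem hW (hT.mem_nhds ht₀))
  have hX'X : X' ⊆ X := fun x hx => (hX'V hx).2
  have hT'T : T' ⊆ T := fun t ht => (hT'W ht).2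
  have hAne : ∀ x ∈ X', ∀ t ∈ T', A x t ≠ 0 := fun x hx t ht =>
    hVW (mk_mem_prod (hX'V hx).1 (hT'W ht).1)
  have H := (isNonclassicalSymmetry_iff hX hT hU (smoothOnBox_constU ha) hφs 4 3 γ κ).1 h
  have hfirst : ∀ x ∈ X, ∀ t ∈ T, 8 * px C x t = 6 * px (px a) x t
      ∧ A x t * (a x t ^ 2 - κ) = 0 := fun x hx t ht =>
    laurent_first hX hT hU hUi hU0 hA hC hφ hx ht fun u hu => H x hx t ht u hu (hU0 u hu)
  have hsq : ∀ x ∈ X', ∀ t ∈ T', a x t ^ 2 = κ := fun x hx t ht => by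
    have := (hfirst x (hX'X hx) t (hT'T ht)).2
    have := (mul_eq_zero.1 this).resolve_left (hAne x hx t ht)
    linarith
  have hconst := eq_const_of_sq_eq hX'o hX'c hT'o hT'c (ha.mono hX'X hT'T) hsq hxX' htT'
  have heq : EqOnBox X' T' U (constU fun _ _ => a x₀ t₀) (constU a) :=
    fun x hx t ht u _ => (hconst x hx t ht).symm
  have hCx : EqOnBox X' T' U (constU (px C)) (constU fun _ _ => 0) := by
    intro x hx t ht u hu
    have h1 := (heq.congr_dX hX'o).congr_dX hX'o x hx t ht u hu
    rw [dX_constU, dX_constU, dX_constU, dX_constU] at h1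
    have c1 : px (fun _ _ => a x₀ t₀) = fun _ _ => 0 := by funext x t; simp [px]
    simp only [c1, px_zero, constU] at h1
    have := (hfirst x (hX'X hx) t (hT'T ht)).1
    simp only [constU]
    linarith
  have z : ∀ {c : ℝ → ℝ → ℝ}, EqOnBox X' T' U (constU c) (constU fun _ _ => 0) →
      EqOnBox X' T' U (constU (px c)) (constU fun _ _ => 0) := by
    intro c hc x hx t ht u hu
    have := hc.congr_dX hX'o x hx t ht u hu
    rwa [dX_constU, dX_constU, px_zero] at this
  obtain ⟨u₀, hu₀⟩ := hUi.nonempty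
  have hκ : κ = a x₀ t₀ ^ 2 := (hsq x₀ hxX' t₀ htT').symm
  have h' := (isNonclassicalSymmetry_congr hX'o hT'o hU
    (smoothOnBox_constU (ha.mono hX'X hT'T)) (hφs.mono hX'X hT'T subset_rfl) heq
    (fun _ _ _ _ _ _ => rfl)).2 (h.mono hX'X hT'T subset_rfl)
  rw [hκ, isNonclassicalSymmetry_iff hX'o hT'o hU
    (show SmoothOnBox X' T' U (constU fun _ _ => a x₀ t₀) from contDiffOn_const)
    (hφs.mono hX'X hT'T subset_rfl)] at h'
  refine hne (laurent_second hX'o hT'o hU hUi hU0 (hA.mono hX'X hT'T) (hC.mono hX'X hT'T)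
    (fun x hx t ht u hu => hφ x (hX'X hx) t (hT'T ht) u hu) hxX' htT'
    (hCx x₀ hxX' t₀ htT' u₀ hu₀) (z hCx x₀ hxX' t₀ htT' u₀ hu₀)
    (z (z hCx) x₀ hxX' t₀ htT' u₀ hu₀) (z (z (z hCx)) x₀ hxX' t₀ htT' u₀ hu₀)
    fun u hu => h' x₀ hxX' t₀ htT' u hu (hU0 u hu))

/-- `φ` is affine in `u`. -/
theorem IsNonclassicalSymmetry.dU_dU_phi (hX : IsOpen X) (hT : IsOpen T) (hU : IsOpen U)
    (ha : SmoothOnRect X T a) (hφ : SmoothOnBox X T U φ)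
    (h : IsNonclassicalSymmetry α β γ κ 0 X T U (constU a) φ) :
    EqOnBox X T U (dU (dU φ)) (fun _ _ _ => 0) := by
  have hφu := hφ.smooth_dU hX hT hU
  have hφuu := hφu.smooth_dU hX hT hU
  have H := (isNonclassicalSymmetry_iff hX hT hU (smoothOnBox_constU ha) hφ α β γ κ).1 h
  have Q : ∀ x ∈ X, ∀ t ∈ T, ∀ u ∈ U, u ≠ 0 → _ := fun x hx t ht u hu hu0 =>
    redPr_coeffs hu0 (H x hx t ht u hu hu0)
  intro x₀ hx₀ t₀ ht₀
  refine eq_zero_on_box_of_ne_zero hU (hφuu.slice_u hx₀ ht₀).continuousOn ?_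
  intro u₀ hu₀ hu0
  by_contra hne
  -- Comparing the three coefficients leaves only `α = 4`, `β = 3`.
  obtain ⟨q1, q2, q3⟩ := Q x₀ hx₀ t₀ ht₀ u₀ hu₀ hu0
  have hD : α * (-(u₀ * dU (dU φ) x₀ t₀ u₀)) = 8 * u₀ * dU (dU φ) x₀ t₀ u₀
      + 4 * u₀ ^ 2 * dU (dU (dU φ)) x₀ t₀ u₀ := by
    have hl := ((hφ.hasDerivAt_u hX hT hU hx₀ ht₀ hu₀).sub
      ((hasDerivAt_id u₀).mul (hφu.hasDerivAt_u hX hT hU hx₀ ht₀ hu₀))).const_mul α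
    have hr := (((hasDerivAt_id u₀).pow 2).const_mul 4).mul
      (hφuu.hasDerivAt_u hX hT hU hx₀ ht₀ hu₀)
    have hev : ∀ᶠ u in nhds u₀, α * (φ x₀ t₀ u - u * dU φ x₀ t₀ u)
        = 4 * u ^ 2 * dU (dU φ) x₀ t₀ u := by
      filter_upwards [hU.mem_nhds hu₀, isOpen_ne.mem_nhds hu0] with u hu hu0
      exact (Q x₀ hx₀ t₀ ht₀ u hu hu0).1
    have := hl.unique (hr.congr_of_eventuallyEq hev)
    simp at this
    linarith
  have h24 : 3 * α + 4 * β = 24 := by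
    have : u₀ * dU (dU φ) x₀ t₀ u₀ * (3 * α + 4 * β - 24) = 0 := by
      linear_combination 3 * hD + 2 * u₀ * q3
    have := (mul_eq_zero.1 this).resolve_left (mul_ne_zero hu0 hne)
    linarith
  have h34 : 3 * α = 4 * β := by
    have hD0 : φ x₀ t₀ u₀ - u₀ * dU φ x₀ t₀ u₀ ≠ 0 := by
      intro h0
      rw [h0, mul_zero] at q1
      exact mul_ne_zero (mul_ne_zero four_ne_zero (pow_ne_zero 2 hu0)) hne q1.symm
    have : (φ x₀ t₀ u₀ - u₀ * dU φ x₀ t₀ u₀) * (3 * α - 4 * β) = 0 := by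
      linear_combination 3 * q1 - 4 * q2
    have := (mul_eq_zero.1 this).resolve_left hD0
    linarith
  obtain rfl : α = 4 := by linarith
  obtain rfl : β = 3 := by linarith
  -- Euler's equation `φ - u φ_u = u² φ_uu` gives `φ = A/u + C u` near `u₀`.
  obtain ⟨V, hVU, hVo, hVc, huV⟩ :=
    exists_preconnected_nhd (Filter.inter_mem (hU.mem_nhds hu₀) (isOpen_ne.mem_nhds hu0))
  have hV0 : ∀ u ∈ V, u ≠ 0 := fun u hu => (hVU hu).2
  have hVU' : V ⊆ U := fun u hu => (hVU hu).1
  have euler : ∀ x ∈ X, ∀ t ∈ T, ∀ u ∈ V, φ x t u - u * dU φ x t u = u ^ 2 * dU (dU φ) x t u :=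
    fun x hx t ht u hu => by
      have := (Q x hx t ht u (hVU' hu) (hV0 u hu)).1
      linarith
  have hφV := hφ.mono (Subset.refl X) (Subset.refl T) hVU'
  have hφuV := hφu.mono (Subset.refl X) (Subset.refl T) hVU'
  have hid : SmoothOnBox X T V (fun _ _ u => u) := (contDiff_snd.comp contDiff_snd).contDiffOn
  obtain ⟨A, hA, hAeq⟩ := exists_eq_constU hX hT hVo hVc ⟨u₀, huV⟩
    (f := fun x t u => u * (φ x t u - u * dU φ x t u) / 2)
    (ContDiffOn.div_const (ContDiffOn.mul hid (ContDiffOn.sub hφV (ContDiffOn.mul hid hφuV))) 2)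
    (fun x hx t ht u hu => by
      have := (((hasDerivAt_id u).mul ((hφ.hasDerivAt_u hX hT hU hx ht (hVU' hu)).sub
        ((hasDerivAt_id u).mul (hφu.hasDerivAt_u hX hT hU hx ht (hVU' hu))))).div_const 2)
      refine this.deriv.trans ?_
      have e := euler x hx t ht u hu
      simp only [Pi.sub_apply, Pi.mul_apply, id]
      linear_combination e / 2)
  obtain ⟨C, hC, hCeq⟩ := exists_eq_constU hX hT hVo hVc ⟨u₀, huV⟩
    (f := fun x t u => (φ x t u - A x t / u) / u)
    (ContDiffOn.div (ContDiffOn.sub hφV (ContDiffOn.div (hA.lift V) hid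
      fun p hp => hV0 _ hp.2.2)) hid fun p hp => hV0 _ hp.2.2)
    (fun x hx t ht u hu => by
      have u0 := hV0 u hu
      have := (((hφ.hasDerivAt_u hX hT hU hx ht (hVU' hu)).sub
        ((hasDerivAt_const u (A x t)).div (hasDerivAt_id u) u0)).div (hasDerivAt_id u) u0)
      refine this.deriv.trans ?_
      have e := euler x hx t ht u hu
      have eA : u * (φ x t u - u * dU φ x t u) / 2 = A x t := hAeq x hx t ht u hu
      simp only [Pi.sub_apply, Pi.div_apply, id]
      rw [← eA]
      field_simp
      ring)
  have hrep : EqOnBox X T V φ (fun x t u => A x t / u + C x t * u) := by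
    intro x hx t ht u hu
    have u0 := hV0 u hu
    have := hCeq x hx t ht u hu
    simp only [constU] at this
    simp only [← this]
    field_simp
    ring
  have hA0 := laurent_eq_zero hX hT hVo (hVo.infinite_of_mem huV) hV0 ha hA hC hrep hφV
    (h.mono subset_rfl subset_rfl hVU') hx₀ ht₀
  have := hAeq x₀ hx₀ t₀ ht₀ u₀ huV
  simp only [constU, hA0] at this
  rw [euler x₀ hx₀ t₀ ht₀ u₀ huV] at this
  simp [hu0, hne] at this

/-- A nonclassical symmetry has `ξ = ξ(x, t)` and `φ = A(x, t) + C(x, t) u`, and these functions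
satisfy the determining equations. -/
theorem IsNonclassicalSymmetry.exists_affineSystem (hX : IsOpen X) (hT : IsOpen T) (hU : IsOpen U)
    (hU' : IsPreconnected U) (hU'' : U.Nonempty) (hξ : SmoothOnBox X T U ξ)
    (hφ : SmoothOnBox X T U φ) (h : IsNonclassicalSymmetry α β γ κ 0 X T U ξ φ) :
    ∃ a A C : ℝ → ℝ → ℝ, SmoothOnRect X T a ∧ SmoothOnRect X T A ∧ SmoothOnRect X T C ∧
      EqOnBox X T U ξ (constU a) ∧ EqOnBox X T U φ (affineU A C) ∧
      ∀ x ∈ X, ∀ t ∈ T, AffineSystem α β γ κ a A C x t := by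
  obtain ⟨a, ha, hξa⟩ := exists_eq_constU hX hT hU hU' hU'' hξ (h.dU_xi hX hT hU hξ hφ)
  have h1 : IsNonclassicalSymmetry α β γ κ 0 X T U (constU a) φ :=
    (isNonclassicalSymmetry_congr hX hT hU hξ hφ hξa.symm fun _ _ _ _ _ _ => rfl).2 h
  have h2 := h1.dU_dU_phi hX hT hU ha hφ
  obtain ⟨C, hC, hCeq⟩ := exists_eq_constU hX hT hU hU' hU'' (hφ.smooth_dU hX hT hU) h2
  obtain ⟨A, hA, hAeq⟩ := exists_eq_constU hX hT hU hU' hU''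
    (f := fun x t u => φ x t u - C x t * u)
    (ContDiffOn.sub hφ (ContDiffOn.mul (hC.lift U) (contDiff_snd.comp contDiff_snd).contDiffOn))
    (fun x hx t ht u hu => by
      have := (hφ.hasDerivAt_u hX hT hU hx ht hu).sub ((hasDerivAt_id u).const_mul (C x t))
      refine this.deriv.trans ?_
      have e := hCeq x hx t ht u hu
      simp only [constU] at e
      rw [e]
      ring)
  have hφA : EqOnBox X T U φ (affineU A C) := by
    intro x hx t ht u hu
    have := hAeq x hx t ht u hu
    simp only [constU] at this
    simp only [affineU]
    linarith
  refine ⟨a, A, C, ha, hA, hC, hξa, hφA, fun x hx t ht => ?_⟩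
  have h3 := (isNonclassicalSymmetry_congr hX hT hU hξ hφ hξa.symm hφA.symm).2 h
  rw [isNonclassicalSymmetry_iff hX hT hU (smoothOnBox_constU ha)
    (smoothOnBox_affineU hA hC)] at h3
  obtain ⟨u, hu⟩ := hU''
  exact affineSystem_of_red hX hT hA hC hx ht (hU.infinite_diff_zero hu) (fun u hu => hu.2)
    fun u hu => h3 x hx t ht u hu.1 hu.2

theorem isNonclassicalSymmetry_of_affineSystem (hX : IsOpen X) (hT : IsOpen T) (hU : IsOpen U)
    {A C : ℝ → ℝ → ℝ} (ha : SmoothOnRect X T a) (hA : SmoothOnRect X T A)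
    (hC : SmoothOnRect X T C) (hξ : EqOnBox X T U ξ (constU a))
    (hφ : EqOnBox X T U φ (affineU A C))
    (h : ∀ x ∈ X, ∀ t ∈ T, AffineSystem α β γ κ a A C x t) :
    IsNonclassicalSymmetry α β γ κ 0 X T U ξ φ := by
  rw [isNonclassicalSymmetry_congr hX hT hU (smoothOnBox_constU ha) (smoothOnBox_affineU hA hC)
    hξ hφ, isNonclassicalSymmetry_iff hX hT hU (smoothOnBox_constU ha)
    (smoothOnBox_affineU hA hC)]
  intro x hx t ht u _ hu0 u₁ u₂ u₃ u₄ hΔ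
  exact (h x hx t ht).red_eq_zero hX hT hA hC hx ht hu0 hΔ

end AffineStructure

/-! ### Classical symmetries -/

section Classical

variable {X T U : Set ℝ} {ξ φ : ℝ → ℝ → ℝ → ℝ} {α β γ κ : ℝ} {a A C : ℝ → ℝ → ℝ}

theorem smooth_fun_t {f : ℝ → ℝ} (hf : ContDiffOn ℝ ∞ f T) :
    SmoothOnRect X T (fun _ t => f t) :=
  ContDiffOn.comp (t := T) hf contDiff_snd.contDiffOn fun _ hp => hp.2

theorem smooth_fun_x {f : ℝ → ℝ} (hf : ContDiffOn ℝ ∞ f X) :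
    SmoothOnRect X T (fun x _ => f x) :=
  ContDiffOn.comp (t := X) hf contDiff_fst.contDiffOn fun _ hp => hp.1

theorem px_congr {a b : ℝ → ℝ → ℝ} (hX : IsOpen X) (h : ∀ x ∈ X, ∀ t ∈ T, a x t = b x t) :
    ∀ x ∈ X, ∀ t ∈ T, px a x t = px b x t :=
  fun _ hx t ht => deriv_congr_of_eqOn hX (fun s hs => h s hs t ht) hx

theorem pt_congr {a b : ℝ → ℝ → ℝ} (hT : IsOpen T) (h : ∀ x ∈ X, ∀ t ∈ T, a x t = b x t) :
    ∀ x ∈ X, ∀ t ∈ T, pt a x t = pt b x t :=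
  fun x hx _ ht => deriv_congr_of_eqOn hT (fun s hs => h x hx s hs) ht

theorem px_fun_t_mul (l : ℝ → ℝ) (a : ℝ → ℝ → ℝ) :
    px (fun x t => l t * a x t) = fun x t => l t * px a x t := by
  funext x t
  simp [px]

/-- The fields `Ξ(x) ∂_x + τ(t) ∂_t + (4 Ξ' - 2 τ') u ∂_u`, `τ'' = 0`, subject to the determining
equations that do not involve `t`-derivatives, are classical symmetries. -/
theorem isClassicalSymmetry_of_equations (hX : IsOpen X) (hT : IsOpen T) (hU : IsOpen U)
    {v : PointField} {Ξ τ : ℝ → ℝ → ℝ} (hΞ : SmoothOnRect X T Ξ) (hτ : SmoothOnRect X T τ)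
    (hC : SmoothOnRect X T C) (h1 : EqOnBox X T U v.ξ (constU Ξ))
    (h2 : EqOnBox X T U v.τ (constU τ)) (h3 : EqOnBox X T U v.φ (affineU (fun _ _ => 0) C))
    (hΞt : ∀ x ∈ X, ∀ t ∈ T, pt Ξ x t = 0) (hτx : ∀ x ∈ X, ∀ t ∈ T, px τ x t = 0)
    (hτt : ∀ x ∈ X, ∀ t ∈ T, pt (pt τ) x t = 0) (hCt : ∀ x ∈ X, ∀ t ∈ T, pt C x t = 0)
    (hCeq : ∀ x ∈ X, ∀ t ∈ T, C x t = 4 * px Ξ x t - 2 * pt τ x t)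
    (hκ : ∀ x ∈ X, ∀ t ∈ T, κ * (px Ξ x t - pt τ x t) = 0
      ∧ κ * px C x t = 0 ∧ κ * px (px Ξ) x t = 0 ∧ κ * px (px C) x t = 0)
    (e1 : ∀ x ∈ X, ∀ t ∈ T, 6 * px (px Ξ) x t = (4 + α) * px C x t)
    (e2 : ∀ x ∈ X, ∀ t ∈ T,
      (3 * α + 4 * β) * px C x t = (3 * α + 2 * β) * px (px Ξ) x t)
    (e3 : ∀ x ∈ X, ∀ t ∈ T, -(4 * γ * px Ξ x t) - 6 * px (px C) x t + 4 * px (px (px Ξ)) x t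
      - 2 * β * px (px C) x t = 0)
    (e4 : ∀ x ∈ X, ∀ t ∈ T,
      4 * γ * px Ξ x t + α * (3 * px (px C) x t - px (px (px Ξ)) x t) = 0)
    (e5 : ∀ x ∈ X, ∀ t ∈ T, -(2 * γ * (2 * px C x t - px (px Ξ) x t)) - 4 * γ * px C x t
      - (4 + α) * px (px (px C)) x t + px (px (px (px Ξ))) x t = 0)
    (e6 : ∀ x ∈ X, ∀ t ∈ T, 2 * γ * px (px C) x t + px (px (px (px C))) x t = 0) :
    IsClassicalSymmetry α β γ κ 0 X T U v := by
  intro j hx ht hu hΔ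
  have s0 : SmoothOnRect X T (fun _ _ => (0 : ℝ)) := contDiffOn_const
  have sC := hC.smooth_px hX hT
  have sCC := sC.smooth_px hX hT
  have sC3 := sCC.smooth_px hX hT
  have ev1 := (smoothOnBox_constU (U := U) hΞ).congr h1
  have ev2 := (smoothOnBox_constU (U := U) hτ).congr h2
  have ev3 := (smoothOnBox_affineU (U := U) s0 hC).congr h3
  have x1 : EqOnBox X T U (dX (affineU (fun _ _ => 0) C)) _ := dX_affineU hX hT s0 hC
  rw [px_zero] at x1
  have x2 := (x1.congr_dX hX).trans (dX_affineU hX hT s0 sC)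
  rw [px_zero] at x2
  have x3 := (x2.congr_dX hX).trans (dX_affineU hX hT s0 sCC)
  rw [px_zero] at x3
  have x4 := (x3.congr_dX hX).trans (dX_affineU hX hT s0 sC3)
  rw [px_zero] at x4
  have t1 : EqOnBox X T U (dT (affineU (fun _ _ => 0) C)) (fun _ _ _ => 0) :=
    (dT_affineU hX hT s0 hC).trans fun x hx t ht u hu => by
      simp [affineU, pt_zero, hCt x hx t ht]
  have t2 := t1.congr_dT hT
  rw [dT_const] at t2
  have zτ := px_congr hX hτx
  rw [px_zero] at zτ
  have zτ3 := px_congr hX zτ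
  rw [px_zero] at zτ3
  have zτ4 := px_congr hX zτ3
  rw [px_zero] at zτ4
  have zΞ := pt_congr hT hΞt
  rw [pt_zero] at zΞ
  rw [PointField.pr_Delta hX hT hU α β γ κ ev1 ev2 ev3 ⟨hx, ht, hu⟩]
  simp only [PointField.pr10, PointField.pr20, PointField.pr30, PointField.pr40, PointField.pr02,
    h1.xD1_eq hX hU hx ht hu, h1.xD2_eq hX hU hx ht hu, h1.xD3_eq hX hU hx ht hu,
    h1.xD4_eq hX hU hx ht hu, h2.xD1_eq hX hU hx ht hu, h2.xD2_eq hX hU hx ht hu,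
    h2.xD3_eq hX hU hx ht hu, h2.xD4_eq hX hU hx ht hu, h3.xD1_eq hX hU hx ht hu,
    h3.xD2_eq hX hU hx ht hu, h3.xD3_eq hX hU hx ht hu, h3.xD4_eq hX hU hx ht hu,
    h1.tD1_eq hT hU hx ht hu, h1.tD2_eq hT hU hx ht hu, h2.tD1_eq hT hU hx ht hu,
    h2.tD2_eq hT hU hx ht hu, h3.tD2_eq hT hU hx ht hu, h3 _ hx _ ht _ hu]
  simp only [xD1, xD2, xD3, xD4, tD1, tD2, dX_constU, dT_constU, dU_constU, dU_affineU,
    px_zero, pt_zero, x1 _ hx _ ht _ hu, x2 _ hx _ ht _ hu, x3 _ hx _ ht _ hu, x4 _ hx _ ht _ hu,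
    t2 _ hx _ ht _ hu]
  simp only [constU, affineU, hτx _ hx _ ht, zτ _ hx _ ht, zτ3 _ hx _ ht, zτ4 _ hx _ ht,
    hτt _ hx _ ht, hΞt _ hx _ ht, zΞ _ hx _ ht, hCt _ hx _ ht]
  simp only [Delta] at hΔ
  obtain ⟨k1, k2, k3, k4⟩ := hκ _ hx _ ht
  have hc := hCeq _ hx _ ht
  generalize C j.x j.t = c at *
  have f1 := e1 _ hx _ ht
  have f2 := e2 _ hx _ ht
  have f3 := e3 _ hx _ ht
  have f4 := e4 _ hx _ ht
  have f5 := e5 _ hx _ ht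
  have f6 := e6 _ hx _ ht
  subst hc
  linear_combination (4 * px Ξ j.x j.t - 4 * pt τ j.x j.t) * hΔ
    + j.u 0 0 * j.u 3 0 * f1 - j.u 1 0 * j.u 2 0 * f2 + j.u 0 0 * j.u 2 0 * f3
    - j.u 1 0 ^ 2 * f4 + j.u 0 0 * j.u 1 0 * f5 - j.u 0 0 ^ 2 * f6
    + 2 * j.u 2 0 * k1 - 2 * j.u 1 0 * k2 + j.u 1 0 * k3 - j.u 0 0 * k4

/-- The factor is `exp (-∫ m)`: it makes the coefficient of `∂_x` independent of `t` and that of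
`∂_t` affine in `t`. -/
theorem isClassicalUpToFactor_of_affineSystem (hX : IsOpen X) (hT : IsOpen T)
    (hT' : IsPreconnected T) (hU : IsOpen U) (ha : SmoothOnRect X T a) (hC : SmoothOnRect X T C)
    (h1 : EqOnBox X T U ξ (constU a)) (h3 : EqOnBox X T U φ (affineU (fun _ _ => 0) C))
    {m : ℝ → ℝ} (hm : ContDiffOn ℝ ∞ m T) (hm' : ∀ t ∈ T, HasDerivAt m (m t ^ 2) t)
    (hat : ∀ x ∈ X, ∀ t ∈ T, pt a x t = m t * a x t)
    (hCeq : ∀ x ∈ X, ∀ t ∈ T, C x t = 4 * px a x t + 2 * m t)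
    (hκ : ∀ x ∈ X, ∀ t ∈ T, κ * (px a x t + m t) = 0)
    (hS : ∀ x ∈ X, ∀ t ∈ T, AffineSystem α β γ κ a A C x t) :
    IsClassicalUpToFactor α β γ κ 0 X T U ξ φ := by
  obtain ⟨l, hl, hl'⟩ := exists_exp_primitive hT hT' hm.neg
  have rl : SmoothOnRect X T (fun _ t => l t) := smooth_fun_t hl
  have dl : ∀ t ∈ T, HasDerivAt l (-m t * l t) t := fun t ht => (hl' t ht).2
  have ddl : ∀ t ∈ T, HasDerivAt (fun s => -m s * l s) 0 t := fun t ht =>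
    ((hm' t ht).neg.mul (dl t ht)).congr_deriv (by simp only [Pi.neg_apply]; ring)
  have ptl : ∀ x ∈ X, ∀ t ∈ T, pt (fun _ t => l t) x t = -m t * l t :=
    fun x _ t ht => (dl t ht).deriv
  have pttl : ∀ x ∈ X, ∀ t ∈ T, pt (pt (fun _ t => l t)) x t = 0 := fun x hx t ht =>
    (pt_congr (a := pt (fun _ t => l t)) (b := fun _ t => -m t * l t) hT ptl x hx t ht).trans
      (ddl t ht).deriv
  have sΞ : SmoothOnRect X T (fun x t => l t * a x t) := rl.mul ha
  have sC : SmoothOnRect X T (fun x t => l t * C x t) := rl.mul hC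
  have ptΞ : ∀ x ∈ X, ∀ t ∈ T, pt (fun x t => l t * a x t) x t = 0 := fun x hx t ht =>
    ((dl t ht).mul (ha.hasDerivAt_t hX hT hx ht)).deriv.trans (by rw [hat x hx t ht]; ring)
  have ptpxΞ : ∀ x ∈ X, ∀ t ∈ T, pt (px (fun x t => l t * a x t)) x t = 0 := fun x hx t ht => by
    rw [sΞ.pt_px hX hT hx ht, px_congr hX ptΞ x hx t ht, px_zero]
  have hCeq' : ∀ x ∈ X, ∀ t ∈ T, l t * C x t
      = 4 * px (fun x t => l t * a x t) x t - 2 * pt (fun _ t => l t) x t := fun x hx t ht => by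
    rw [hCeq x hx t ht, ptl x hx t ht, px_fun_t_mul]
    ring
  have px1C : ∀ x ∈ X, ∀ t ∈ T, px C x t = 4 * px (px a) x t := fun x hx t ht =>
    (px_congr hX hCeq x hx t ht).trans
      ((((ha.smooth_px hX hT).hasDerivAt_x hX hT hx ht).const_mul 4).add_const _).deriv
  have px2C : ∀ x ∈ X, ∀ t ∈ T, px (px C) x t = 4 * px (px (px a)) x t := fun x hx t ht =>
    (px_congr (b := fun x t => 4 * px (px a) x t) hX px1C x hx t ht).trans
      ((((ha.smooth_px hX hT).smooth_px hX hT).hasDerivAt_x hX hT hx ht).const_mul 4).deriv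
  have κ2 : ∀ x ∈ X, ∀ t ∈ T, κ * px (px a) x t = 0 := fun x hx t ht => by
    have := px_congr hX hκ x hx t ht
    rw [px_zero] at this
    exact ((((ha.smooth_px hX hT).hasDerivAt_x hX hT hx ht).add_const _).const_mul κ).deriv.symm.trans
      this
  have κ3 : ∀ x ∈ X, ∀ t ∈ T, κ * px (px (px a)) x t = 0 := fun x hx t ht => by
    have := px_congr (a := fun x t => κ * px (px a) x t) hX κ2 x hx t ht
    rw [px_zero] at this
    exact ((((ha.smooth_px hX hT).smooth_px hX hT).hasDerivAt_x hX hT hx ht).const_mul κ).deriv.symm.trans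
      this
  refine ⟨fun _ t _ => l t, rl.lift U, fun _ _ t ht _ _ => (hl' t ht).1.ne', ?_⟩
  refine isClassicalSymmetry_of_equations (Ξ := fun x t => l t * a x t) (τ := fun _ t => l t)
    (C := fun x t => l t * C x t) hX hT hU sΞ rl sC ?_ ?_ ?_ ptΞ ?_ pttl ?_ hCeq' ?_ ?_ ?_ ?_ ?_ ?_ ?_
  · intro x hx t ht u hu
    simp only [PointField.smulFun, PointField.unitTau, h1 x hx t ht u hu, constU]
  · intro x hx t ht u hu
    simp only [PointField.smulFun, PointField.unitTau, constU, mul_one]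
  · intro x hx t ht u hu
    simp only [PointField.smulFun, PointField.unitTau, h3 x hx t ht u hu, affineU]
    ring
  · intro x hx t ht
    simp [px]
  · intro x hx t ht
    rw [pt_congr hT hCeq' x hx t ht]
    refine ((((sΞ.smooth_px hX hT).hasDerivAt_t hX hT hx ht).const_mul 4).sub
      (((rl.smooth_pt hX hT).hasDerivAt_t hX hT hx ht).const_mul 2)).deriv.trans ?_
    rw [ptpxΞ x hx t ht, pttl x hx t ht]
    ring
  all_goals intro x hx t ht; simp only [px_fun_t_mul]
  · rw [ptl x hx t ht, px1C x hx t ht, px2C x hx t ht]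
    refine ⟨?_, ?_, ?_, ?_⟩
    · linear_combination l t * hκ x hx t ht
    · linear_combination 4 * l t * κ2 x hx t ht
    · linear_combination l t * κ2 x hx t ht
    · linear_combination 4 * l t * κ3 x hx t ht
  · linear_combination l t * (hS x hx t ht).u3_1
  · linear_combination l t * (hS x hx t ht).u1u2
  · linear_combination l t * (hS x hx t ht).u2_1
  · linear_combination l t * (hS x hx t ht).u1u1_0
  · linear_combination l t * (hS x hx t ht).u1_1
  · linear_combination l t * (hS x hx t ht).u0_2

/-- The jet at `(x, t)` with the given values of `u`, `u_x`, `u_t`, `u_tt`, `u_xxxt` and `u_xxxx`,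
all other coordinates being zero. -/
def mkJet (x t u u₁₀ u₀₁ u₀₂ u₃₁ u₄₀ : ℝ) : Jet :=
  (x, t, fun i k => match i, k with
    | 0, 0 => u
    | 1, 0 => u₁₀
    | 0, 1 => u₀₁
    | 0, 2 => u₀₂
    | 3, 1 => u₃₁
    | 4, 0 => u₄₀
    | _, _ => 0)

theorem mkJet_over {x t u : ℝ} (hx : x ∈ X) (ht : t ∈ T) (hu : u ∈ U) (p q r y z : ℝ) :
    (mkJet x t u p q r y z).Over X T U := ⟨hx, ht, hu⟩

/-- The coefficient of `u_xxxt` in `pr w (Δ)`, for a classical symmetry `w`, shows that the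
coefficient of `∂_t` depends on `t` only. -/
theorem IsClassicalSymmetry.tau_eq {v : PointField} (hX : IsOpen X) (hX' : IsPreconnected X)
    (hX'' : X.Nonempty) (hT : IsOpen T) (hU : IsOpen U) (hU' : IsPreconnected U)
    (hU'' : U.Nonempty) (hξ : SmoothOnBox X T U v.ξ) (hτ : SmoothOnBox X T U v.τ)
    (hφ : SmoothOnBox X T U v.φ) (h : IsClassicalSymmetry α β γ κ 0 X T U v) :
    ∃ τ : ℝ → ℝ, ContDiffOn ℝ ∞ τ T ∧ EqOnBox X T U v.τ (fun _ t _ => τ t) := by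
  have key : ∀ x ∈ X, ∀ t ∈ T, ∀ u ∈ U, ∀ p : ℝ, u ≠ 0 → dX v.τ x t u + dU v.τ x t u * p = 0 := by
    intro x hx t ht u hu p hu0
    have h0 := h (mkJet x t u p 0 (2 * γ * p ^ 2) 0 0) hx ht hu
      (by simp only [Delta, Jet.u, mkJet]; ring)
    have h1 := h (mkJet x t u p 0 (2 * γ * p ^ 2) 1 0) hx ht hu
      (by simp only [Delta, Jet.u, mkJet]; ring)
    rw [PointField.pr_Delta hX hT hU α β γ κ hξ hτ hφ (mkJet_over hx ht hu _ _ _ _ _)] at h0 h1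
    simp only [PointField.pr10, PointField.pr20, PointField.pr30, PointField.pr40,
      PointField.pr02, Jet.u, Jet.x, Jet.t, mkJet] at h0 h1
    have : u * xD1 v.τ x t u p = 0 := by linear_combination (h1 - h0) / 4
    exact (mul_eq_zero.1 this).resolve_left hu0
  have sX := hτ.smooth_dX hX hT hU
  have sU := hτ.smooth_dU hX hT hU
  have dU0 : ∀ x ∈ X, ∀ t ∈ T, ∀ u ∈ U, dU v.τ x t u = 0 := fun x hx t ht =>
    eq_zero_on_box_of_ne_zero hU (sU.slice_u hx ht).continuousOn fun u hu hu0 => by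
      linear_combination key x hx t ht u hu 1 hu0 - key x hx t ht u hu 0 hu0
  have dX0 : ∀ x ∈ X, ∀ t ∈ T, ∀ u ∈ U, dX v.τ x t u = 0 := fun x hx t ht =>
    eq_zero_on_box_of_ne_zero hU (sX.slice_u hx ht).continuousOn fun u hu hu0 => by
      linear_combination key x hx t ht u hu 0 hu0
  obtain ⟨x₀, hx₀⟩ := hX''
  obtain ⟨u₀, hu₀⟩ := hU''
  have sr := hτ.restrict hu₀
  refine ⟨fun t => v.τ x₀ t u₀, sr.slice_t hx₀, fun x hx t ht u hu => ?_⟩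
  refine (eq_of_hasDerivAt_zero hU hU' (f := fun u => v.τ x t u) (fun u hu => ?_) hu hu₀).trans
    (eq_of_hasDerivAt_zero hX hX' (f := fun x => v.τ x t u₀) (fun x hx => ?_) hx hx₀)
  · exact (hτ.hasDerivAt_u hX hT hU hx ht hu).congr_deriv (dU0 x hx t ht u hu)
  · exact (hτ.hasDerivAt_x hX hT hU hx ht hu₀).congr_deriv (dX0 x hx t ht u₀ hu₀)

/-- If `s ∂_x + ∂_t + φ ∂_u`, with `s` constant, is classical up to a factor, then this factor `τ`
is affine in `t` and the field is a combination of a scaling and of translations. -/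
theorem IsClassicalUpToFactor.exists_affine_factor (hX : IsOpen X) (hX' : IsPreconnected X)
    (hX'' : X.Nonempty) (hT : IsOpen T) (hU : IsOpen U) (hU' : IsPreconnected U)
    (hU'' : U.Nonempty) {s : ℝ} (hξ : EqOnBox X T U ξ (fun _ _ _ => s))
    (hφ : SmoothOnBox X T U φ) (h : IsClassicalUpToFactor α β γ κ 0 X T U ξ φ) :
    ∃ τ : ℝ → ℝ, ContDiffOn ℝ ∞ τ T ∧ (∀ t ∈ T, τ t ≠ 0) ∧
      (∀ x ∈ X, ∀ t ∈ T, ∀ u ∈ U, τ t * φ x t u = -2 * deriv τ t * u) ∧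
      ∀ t ∈ T, HasDerivAt (deriv τ) 0 t := by
  obtain ⟨l, hl, hl0, hc⟩ := h
  have hs : SmoothOnBox X T U (fun _ _ _ => s) := contDiffOn_const
  have hξ' := hs.congr hξ
  have h1 : SmoothOnBox X T U ((PointField.unitTau ξ φ).smulFun l).ξ := hl.mul hξ'
  have h2 : SmoothOnBox X T U ((PointField.unitTau ξ φ).smulFun l).τ := hl.mul contDiffOn_const
  have h3 : SmoothOnBox X T U ((PointField.unitTau ξ φ).smulFun l).φ := hl.mul hφ
  obtain ⟨τ, hτ, hlτ⟩ := hc.tau_eq hX hX' hX'' hT hU hU' hU'' h1 h2 h3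
  have hlτ' : ∀ x ∈ X, ∀ t ∈ T, ∀ u ∈ U, l x t u = τ t := fun x hx t ht u hu =>
    (mul_one _).symm.trans (hlτ x hx t ht u hu)
  have rτ : SmoothOnRect X T (fun _ t => τ t) := smooth_fun_t hτ
  generalize hv : (PointField.unitTau ξ φ).smulFun l = v at *
  have e1 : EqOnBox X T U v.ξ (constU fun _ t => τ t * s) := fun x hx t ht u hu => by
    simp only [← hv, PointField.smulFun, PointField.unitTau, constU, hlτ' x hx t ht u hu,
      hξ x hx t ht u hu]
  have e2 : EqOnBox X T U v.τ (constU fun _ t => τ t) := hlτ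
  have e3 : EqOnBox X T U v.φ (fun x t u => τ t * φ x t u) := fun x hx t ht u hu => by
    simp only [← hv, PointField.smulFun, PointField.unitTau, hlτ' x hx t ht u hu]
  have px0 : ∀ f : ℝ → ℝ, px (fun _ t => f t) = fun _ _ => 0 := fun f => by
    funext x t
    simp [px]
  obtain ⟨x₀, hx₀⟩ := hX''
  obtain ⟨u₀, hu₀⟩ := hU''
  have key : ∀ x ∈ X, ∀ t ∈ T, ∀ u ∈ U, v.φ x t u = -2 * deriv τ t * u := by
    intro x hx t ht u hu
    have f0 := hc (mkJet x t u 0 0 0 0 0) hx ht hu (by simp only [Delta, Jet.u, mkJet]; ring)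
    have f1 := hc (mkJet x t u 0 0 u 0 1) hx ht hu (by simp only [Delta, Jet.u, mkJet]; ring)
    rw [PointField.pr_Delta hX hT hU α β γ κ h1 h2 h3 (mkJet_over hx ht hu _ _ _ _ _)] at f0 f1
    simp only [PointField.pr10, PointField.pr20, PointField.pr30, PointField.pr40,
      PointField.pr02, Jet.u, Jet.x, Jet.t, mkJet, e1.xD1_eq hX hU hx ht hu,
      e2.xD1_eq hX hU hx ht hu, e2.tD1_eq hT hU hx ht hu] at f0 f1
    simp only [xD1, xD2, xD4, tD1, tD2, dX_constU, dT_constU, dU_constU, px0] at f0 f1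
    simp only [constU, pt] at f0 f1
    linear_combination f0 - f1
  have e4 : EqOnBox X T U v.φ (affineU (fun _ _ => 0) fun _ t => -2 * deriv τ t) :=
    fun x hx t ht u hu => by simp only [key x hx t ht u hu, affineU]; ring
  refine ⟨τ, hτ, fun t ht => hlτ' x₀ hx₀ t ht u₀ hu₀ ▸ hl0 x₀ hx₀ t ht u₀ hu₀,
    fun x hx t ht u hu => (e3 x hx t ht u hu).symm.trans (key x hx t ht u hu), fun t ht => ?_⟩
  have dτ := smooth_hasDerivAt hT (smooth_deriv hT hτ) ht
  refine dτ.congr_deriv ?_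
  have f0 := hc (mkJet x₀ t u₀ 0 0 0 0 0) hx₀ ht hu₀ (by simp only [Delta, Jet.u, mkJet]; ring)
  have f1 := hc (mkJet x₀ t u₀ 0 1 0 0 0) hx₀ ht hu₀ (by simp only [Delta, Jet.u, mkJet]; ring)
  rw [PointField.pr_Delta hX hT hU α β γ κ h1 h2 h3 (mkJet_over hx₀ ht hu₀ _ _ _ _ _)] at f0 f1
  simp only [PointField.pr10, PointField.pr20, PointField.pr30, PointField.pr40,
    PointField.pr02, Jet.u, Jet.x, Jet.t, mkJet, e1.xD1_eq hX hU hx₀ ht hu₀,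
    e2.xD1_eq hX hU hx₀ ht hu₀, e2.xD2_eq hX hU hx₀ ht hu₀, e2.xD3_eq hX hU hx₀ ht hu₀,
    e2.xD4_eq hX hU hx₀ ht hu₀, e2.tD2_eq hT hU hx₀ ht hu₀, e4.tD2_eq hT hU hx₀ ht hu₀] at f0 f1
  simp only [xD1, xD2, xD3, xD4, tD2, dX_constU, dT_constU, dU_constU, dU_affineU, px0, pt_zero]
    at f0 f1
  simp only [constU] at f0 f1
  have p1 : pt (pt fun _ t => τ t) x₀ t = deriv (deriv τ) t := rfl
  have p2 : pt (fun _ t => -2 * deriv τ t) x₀ t = -2 * deriv (deriv τ) t :=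
    (dτ.const_mul (-2)).deriv
  rw [p1, p2] at f0 f1
  linear_combination (f0 - f1) / 5

end Classical

/-! ### The determining equations: dependence on `x` -/

section DependenceOnX

theorem eq_zero_of_hasDerivAt_of_eq_zero {I : Set ℝ} {f : ℝ → ℝ} {t d : ℝ}
    (hd : HasDerivAt f d t) (hI : IsOpen I) (h : ∀ s ∈ I, f s = 0) (ht : t ∈ I) : d = 0 :=
  hd.unique (hasDerivAt_of_eqOn hI h ht (hasDerivAt_const t 0))

variable {X T : Set ℝ} {α β γ κ : ℝ} {a A C : ℝ → ℝ → ℝ}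

/-- The coefficient of `u` in `φ` is affine in `x`. If it were not, differentiating the equations
for the coefficients of `u²u_xxx`, `u u_x u_xx`, `u² u_xx`, `u u_x²`, `u² u_x` and `u³` would
give incompatible values of `α` and `β`. -/
theorem px_px_C_eq_zero (hX : IsOpen X) (hT : IsOpen T) (ha : SmoothOnRect X T a)
    (hC : SmoothOnRect X T C) (hS : ∀ x ∈ X, ∀ t ∈ T, AffineSystem α β γ κ a A C x t) :
    ∀ x ∈ X, ∀ t ∈ T, px (px C) x t = 0 := by
  intro x hx t ht
  have a1 := ha.smooth_px hX hT
  have a2 := a1.smooth_px hX hT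
  have a3 := a2.smooth_px hX hT
  have a4 := a3.smooth_px hX hT
  have c1 := hC.smooth_px hX hT
  have c2 := c1.smooth_px hX hT
  have c3 := c2.smooth_px hX hT
  have D : ∀ {f : ℝ → ℝ → ℝ}, SmoothOnRect X T f → ∀ x ∈ X,
      HasDerivAt (fun s => f s t) (px f x t) x := fun hf x hx => hf.hasDerivAt_x hX hT hx ht
  have e1 : ∀ x ∈ X, 6 * px (px (px a)) x t - (4 + α) * px (px C) x t = 0 := fun x hx =>
    eq_zero_of_hasDerivAt_of_eq_zero (((D a2 x hx).const_mul 6).sub ((D c1 x hx).const_mul (4 + α)))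
      hX (fun s hs => sub_eq_zero.2 (hS s hs t ht).u3_1) hx
  have e1' : ∀ x ∈ X, 6 * px (px (px (px a))) x t - (4 + α) * px (px (px C)) x t = 0 :=
    fun x hx => eq_zero_of_hasDerivAt_of_eq_zero
      (((D a3 x hx).const_mul 6).sub ((D c2 x hx).const_mul (4 + α))) hX e1 hx
  have e1'' : 6 * px (px (px (px (px a)))) x t - (4 + α) * px (px (px (px C))) x t = 0 :=
    eq_zero_of_hasDerivAt_of_eq_zero
      (((D a4 x hx).const_mul 6).sub ((D c3 x hx).const_mul (4 + α))) hX e1' hx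
  have e2 : (3 * α + 4 * β) * px (px C) x t - (3 * α + 2 * β) * px (px (px a)) x t = 0 :=
    eq_zero_of_hasDerivAt_of_eq_zero
      (((D c1 x hx).const_mul (3 * α + 4 * β)).sub ((D a2 x hx).const_mul (3 * α + 2 * β)))
      hX (fun s hs => sub_eq_zero.2 (hS s hs t ht).u1u2) hx
  have e5 : -(2 * γ * (2 * px (px C) x t - px (px (px a)) x t)) - 4 * γ * px (px C) x t
      - (4 + α) * px (px (px (px C))) x t + px (px (px (px (px a)))) x t = 0 :=
    eq_zero_of_hasDerivAt_of_eq_zero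
      ((((((((D c1 x hx).const_mul 2).sub (D a2 x hx)).const_mul (2 * γ)).neg).sub
        ((D c1 x hx).const_mul (4 * γ))).sub ((D c3 x hx).const_mul (4 + α))).add (D a4 x hx))
      hX (fun s hs => (hS s hs t ht).u1_1) hx
  have f3 := (hS x hx t ht).u2_1
  have f4 := (hS x hx t ht).u1u1_0
  have f6 := (hS x hx t ht).u0_2
  have f1 := e1 x hx
  by_contra hne
  by_cases hγ : γ = 0
  · subst hγ
    have m1 : (4 * α - 20 - 12 * β) * px (px C) x t = 0 := by
      linear_combination 6 * f3 - 4 * f1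
    have m2 : α * (14 - α) * px (px C) x t = 0 := by
      linear_combination 6 * f4 + α * f1
    have m3 : (6 * (3 * α + 4 * β) - (3 * α + 2 * β) * (4 + α)) * px (px C) x t = 0 := by
      linear_combination 6 * e2 + (3 * α + 2 * β) * f1
    have n1 := (mul_eq_zero.1 m1).resolve_right hne
    have n2 := (mul_eq_zero.1 m2).resolve_right hne
    have n3 := (mul_eq_zero.1 m3).resolve_right hne
    have hβ : β = (α - 5) / 3 := by linarith
    rw [hβ] at n3
    rcases mul_eq_zero.1 n2 with h | h
    · rw [h] at n3
      norm_num at n3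
    · have : α = 14 := by linarith
      rw [this] at n3
      norm_num at n3
  · -- the derivative of the equation from `u² u_x` and the equation from `u³` force `α = 0`
    have m1 : (γ * α) * px (px C) x t = 0 := by
      linear_combination e5 / 2 - e1'' / 12 - γ / 6 * f1 + 5 * (4 + α) / 12 * f6
    have hα : α = 0 := by
      simpa [hγ, hne] using m1
    subst hα
    have p0 : ∀ s ∈ X, px a s t = 0 := fun s hs => by
      simpa [hγ] using (hS s hs t ht).u1u1_0
    have q0 : ∀ s ∈ X, px (px a) s t = 0 := fun s hs =>
      eq_zero_of_hasDerivAt_of_eq_zero (D a1 s hs) hX p0 hs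
    have r0 := eq_zero_of_hasDerivAt_of_eq_zero (D a2 x hx) hX q0 hx
    apply hne
    linear_combination (3 / 2) * r0 - f1 / 4

/-- The determining equations, simplified by means of `C_xx = 0`. -/
structure ReducedSystem (α κ : ℝ) (a A C : ℝ → ℝ → ℝ) (x t : ℝ) : Prop where
  pxxC : px (px C) x t = 0
  pxxa : 6 * px (px a) x t = (4 + α) * px C x t
  pxxxa : px (px (px a)) x t = 0
  u2 : -(C x t - 2 * px a x t) * (a x t ^ 2 - κ) + 2 * a x t * pt a x t
    + 2 * a x t ^ 2 * px a x t = 0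
  u1 : -(C x t - 4 * px a x t) * (-(2 * a x t * C x t) - pt a x t + a x t * px a x t)
    - 2 * a x t * pt C x t - pt (pt a) x t - 2 * pt a x t * (C x t - px a x t)
    - κ * (2 * px C x t - px (px a) x t) = 0
  u0 : -(C x t - 4 * px a x t) * (pt C x t + C x t ^ 2 - a x t * px C x t) + pt (pt C) x t
    + 2 * C x t * pt C x t - 2 * pt a x t * px C x t - px (px (px (px A))) x t = 0

theorem reducedSystem_of_affineSystem (hX : IsOpen X) (hT : IsOpen T) (ha : SmoothOnRect X T a)
    (hA : SmoothOnRect X T A) (hC : SmoothOnRect X T C)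
    (hS : ∀ x ∈ X, ∀ t ∈ T, AffineSystem α β γ κ a A C x t) :
    ∀ x ∈ X, ∀ t ∈ T, ReducedSystem α κ a A C x t := by
  intro x hx t ht
  have a1 := ha.smooth_px hX hT
  have a2 := a1.smooth_px hX hT
  have c1 := hC.smooth_px hX hT
  have A1 := hA.smooth_px hX hT
  have A2 := A1.smooth_px hX hT
  have D : ∀ {f : ℝ → ℝ → ℝ}, SmoothOnRect X T f → ∀ x ∈ X,
      HasDerivAt (fun s => f s t) (px f x t) x := fun hf x hx => hf.hasDerivAt_x hX hT hx ht
  have Z : ∀ {f : ℝ → ℝ → ℝ} (c : ℝ), SmoothOnRect X T f → (∀ s ∈ X, c * f s t = 0) →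
      ∀ s ∈ X, c * px f s t = 0 := fun c hf h s hs =>
    eq_zero_of_hasDerivAt_of_eq_zero ((D hf s hs).const_mul c) hX h hs
  have Cxx : ∀ s ∈ X, 1 * px (px C) s t = 0 := fun s hs => by
    rw [one_mul, px_px_C_eq_zero hX hT ha hC hS s hs t ht]
  have axx : ∀ x ∈ X, 6 * px (px (px a)) x t - (4 + α) * px (px C) x t = 0 := fun x hx =>
    eq_zero_of_hasDerivAt_of_eq_zero (((D a2 x hx).const_mul 6).sub ((D c1 x hx).const_mul (4 + α)))
      hX (fun s hs => sub_eq_zero.2 (hS s hs t ht).u3_1) hx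
  have a30 : ∀ s ∈ X, 1 * px (px (px a)) s t = 0 := fun s hs => by
    linear_combination axx s hs / 6 + (4 + α) / 6 * Cxx s hs
  have βA := Z β A1 (Z β hA fun s hs => (hS s hs t ht).u2u2) x hx
  have αA := Z α A2 (Z α A1 fun s hs => (hS s hs t ht).u3_0) x hx
  have γA := Z γ hA (fun s hs => (hS s hs t ht).u1u1_m1)
  have γA2 := Z γ A1 γA x hx
  have S := hS x hx t ht
  refine ⟨by linear_combination Cxx x hx, S.u3_1, by linear_combination a30 x hx, ?_, ?_, ?_⟩
  · linear_combination S.u2_0 + 2 * βA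
  · linear_combination S.u1_0 + 4 * γA x hx + αA
  · linear_combination S.u0_1 + κ * Cxx x hx + 2 * γA2

end DependenceOnX

/-! ### The determining equations: the case `κ = 0` -/

section KappaZero

variable {X T : Set ℝ} {α β γ κ : ℝ} {a A C f : ℝ → ℝ → ℝ}

theorem exists_subrect_ne_zero (hX : IsOpen X) (hT : IsOpen T) (hf : SmoothOnRect X T f) {x₀ t₀ : ℝ}
    (hx₀ : x₀ ∈ X) (ht₀ : t₀ ∈ T) (h : f x₀ t₀ ≠ 0) :
    ∃ X' ⊆ X, ∃ T' ⊆ T, IsOpen X' ∧ IsOpen T' ∧ IsPreconnected X' ∧ IsPreconnected T' ∧ x₀ ∈ X' ∧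
      t₀ ∈ T' ∧ ∀ x ∈ X', ∀ t ∈ T', f x t ≠ 0 := by
  have hn : X ×ˢ T ∈ nhds (x₀, t₀) := prod_mem_nhds (hX.mem_nhds hx₀) (hT.mem_nhds ht₀)
  have hc : ContinuousAt (fun p : ℝ × ℝ => f p.1 p.2) (x₀, t₀) := hf.continuousOn.continuousAt hn
  obtain ⟨V, hV, W, hW, hVW⟩ := mem_nhds_prod_iff.1 (Filter.inter_mem (hc.eventually_ne h) hn)
  obtain ⟨X', hX'V, o1, p1, m1⟩ := exists_preconnected_nhd hV
  obtain ⟨T', hT'W, o2, p2, m2⟩ := exists_preconnected_nhd hW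
  have key : ∀ x ∈ X', ∀ t ∈ T', f x t ≠ 0 ∧ x ∈ X ∧ t ∈ T := fun x hx t ht => by
    have := hVW (mk_mem_prod (hX'V hx) (hT'W ht))
    exact ⟨this.1, this.2.1, this.2.2⟩
  exact ⟨X', fun x hx => (key x hx t₀ m2).2.1, T', fun t ht => (key x₀ m1 t ht).2.2, o1, o2, p1, p2,
    m1, m2, fun x hx t ht => (key x hx t ht).1⟩

theorem SmoothOnRect.hasDerivAt_pt_x (hX : IsOpen X) (hT : IsOpen T) (hf : SmoothOnRect X T f)
    {x t : ℝ} (hx : x ∈ X) (ht : t ∈ T) :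
    HasDerivAt (fun s => pt f s t) (pt (px f) x t) x :=
  ((hf.smooth_pt hX hT).hasDerivAt_x hX hT hx ht).congr_deriv (hf.pt_px hX hT hx ht).symm

theorem SmoothOnRect.hasDerivAt_pt_pt_x (hX : IsOpen X) (hT : IsOpen T) (hf : SmoothOnRect X T f)
    {x t : ℝ} (hx : x ∈ X) (ht : t ∈ T) :
    HasDerivAt (fun s => pt (pt f) s t) (pt (pt (px f)) x t) x :=
  (((hf.smooth_pt hX hT)).hasDerivAt_pt_x hX hT hx ht).congr_deriv
    (pt_congr hT (fun _ hx _ ht => (hf.pt_px hX hT hx ht).symm) x hx t ht)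

theorem pt_eq_zero (hT : IsOpen T) (h : ∀ x ∈ X, ∀ t ∈ T, f x t = 0) :
    ∀ x ∈ X, ∀ t ∈ T, pt f x t = 0 := fun x hx t ht => by
  rw [pt_congr hT h x hx t ht, pt_zero]

theorem px_eq_zero (hX : IsOpen X) (h : ∀ x ∈ X, ∀ t ∈ T, f x t = 0) :
    ∀ x ∈ X, ∀ t ∈ T, px f x t = 0 := fun x hx t ht => by
  rw [px_congr hX h x hx t ht, px_zero]

/-- Cancellation of a smooth factor `f` that is allowed to vanish: it suffices to treat the
rectangles on which `f` is identically zero. -/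
theorem eq_zero_of_mul_eq_zero_on_rect (hX : IsOpen X) (hT : IsOpen T) {h : ℝ → ℝ → ℝ}
    (hh : SmoothOnRect X T h) (hfh : ∀ x ∈ X, ∀ t ∈ T, f x t * h x t = 0)
    (hint : ∀ X' ⊆ X, ∀ T' ⊆ T, IsOpen X' → IsOpen T' →
      (∀ x ∈ X', ∀ t ∈ T', f x t = 0) → ∀ x ∈ X', ∀ t ∈ T', h x t = 0) :
    ∀ x ∈ X, ∀ t ∈ T, h x t = 0 := by
  intro x hx t ht
  by_contra hne
  obtain ⟨X', hX', T', hT', o1, o2, -, -, m1, m2, hn⟩ := exists_subrect_ne_zero hX hT hh hx ht hne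
  exact hne (hint X' hX' T' hT' o1 o2
    (fun x hx t ht => (mul_eq_zero.1 (hfh x (hX' hx) t (hT' ht))).resolve_right (hn x hx t ht))
    x m1 t m2)


/-- For `κ = 0` the coefficient of `u u_xx` gives a linear transport equation for `a`. -/
theorem two_mul_pt_eq (hX : IsOpen X) (hT : IsOpen T) (ha : SmoothOnRect X T a)
    (hC : SmoothOnRect X T C) (hS : ∀ x ∈ X, ∀ t ∈ T, ReducedSystem α 0 a A C x t) :
    ∀ x ∈ X, ∀ t ∈ T, 2 * pt a x t - (C x t - 4 * px a x t) * a x t = 0 := by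
  refine eq_zero_of_mul_eq_zero_on_rect (f := a) hX hT ?_ (fun x hx t ht => ?_)
    fun X' _ T' _ _ hT' h x hx t ht => ?_
  · exact (contDiffOn_const.mul (ha.smooth_pt hX hT)).sub
      ((hC.sub (contDiffOn_const.mul (ha.smooth_px hX hT))).mul ha)
  · linear_combination (hS x hx t ht).u2
  · rw [pt_eq_zero hT' h x hx t ht, h x hx t ht]
    ring

/-- If `φ` is linear in `u`, with a coefficient `C` that depends on `x`, then the equation
`C_tt + C C_t - C³ = 0` fails. -/
theorem px_C_eq_zero_of_cubic (hX : IsOpen X) (hT : IsOpen T) (hC : SmoothOnRect X T C)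
    (hCx : ∀ x ∈ X, ∀ t ∈ T, px (px C) x t = 0)
    (h : ∀ x ∈ X, ∀ t ∈ T, pt (pt C) x t + C x t * pt C x t - C x t ^ 3 = 0) :
    ∀ x ∈ X, ∀ t ∈ T, px C x t = 0 := by
  have sc := hC.smooth_px hX hT
  have D : ∀ x ∈ X, ∀ t ∈ T, HasDerivAt (fun s => C s t) (px C x t) x :=
    fun x hx t ht => hC.hasDerivAt_x hX hT hx ht
  have Dc : ∀ x ∈ X, ∀ t ∈ T, HasDerivAt (fun s => px C s t) 0 x :=
    fun x hx t ht => (sc.hasDerivAt_x hX hT hx ht).congr_deriv (hCx x hx t ht)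
  have Dt : ∀ x ∈ X, ∀ t ∈ T, HasDerivAt (fun s => pt C s t) (pt (px C) x t) x :=
    fun x hx t ht => hC.hasDerivAt_pt_x hX hT hx ht
  have Dct : ∀ x ∈ X, ∀ t ∈ T, HasDerivAt (fun s => pt (px C) s t) 0 x :=
    fun x hx t ht => (sc.hasDerivAt_pt_x hX hT hx ht).congr_deriv (pt_eq_zero hT hCx x hx t ht)
  have Dctt : ∀ x ∈ X, ∀ t ∈ T, HasDerivAt (fun s => pt (pt (px C)) s t) 0 x :=
    fun x hx t ht => (sc.hasDerivAt_pt_pt_x hX hT hx ht).congr_deriv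
      (pt_eq_zero hT (pt_eq_zero hT hCx) x hx t ht)
  intro x hx t ht
  have h1 : ∀ x ∈ X, pt (pt (px C)) x t + (px C x t * pt C x t + C x t * pt (px C) x t)
      - 3 * C x t ^ 2 * px C x t = 0 := fun x hx =>
    eq_zero_of_hasDerivAt_of_eq_zero (((hC.hasDerivAt_pt_pt_x hX hT hx ht).add
      ((D x hx t ht).mul (Dt x hx t ht))).sub (((D x hx t ht).pow 3).congr_deriv (by norm_num)))
      hX (fun s hs => h s hs t ht) hx
  have h2 : ∀ x ∈ X, 2 * px C x t * pt (px C) x t - 6 * C x t * px C x t ^ 2 = 0 := fun x hx =>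
    eq_zero_of_hasDerivAt_of_eq_zero ((((Dctt x hx t ht).add
      (((Dc x hx t ht).mul (Dt x hx t ht)).add ((D x hx t ht).mul (Dct x hx t ht)))).sub
      ((((D x hx t ht).pow 2).const_mul 3).mul (Dc x hx t ht))).congr_deriv
        (by simp only [Pi.pow_apply]; push_cast; ring)) hX h1 hx
  have h3 : -(6 * px C x t ^ 3) = 0 :=
    eq_zero_of_hasDerivAt_of_eq_zero (((((Dc x hx t ht).const_mul 2).mul (Dct x hx t ht)).sub
      (((D x hx t ht).const_mul 6).mul ((Dc x hx t ht).pow 2))).congr_deriv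
        (by simp only [Pi.pow_apply]; push_cast; ring)) hX h2 hx
  exact pow_eq_zero_iff (n := 3) (by norm_num) |>.1 (by linarith)

/-- For `κ = 0`, the function `C - 4 a_x` depends on `t` only. -/
theorem px_C_eq (hX : IsOpen X) (hT : IsOpen T) (ha : SmoothOnRect X T a)
    (hC : SmoothOnRect X T C)
    (hαA : ∀ x ∈ X, ∀ t ∈ T, α * A x t = 0)
    (hS : ∀ x ∈ X, ∀ t ∈ T, ReducedSystem α 0 a A C x t) :
    ∀ x ∈ X, ∀ t ∈ T, px C x t - 4 * px (px a) x t = 0 := by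
  have s1 := ha.smooth_px hX hT
  have s2 := s1.smooth_px hX hT
  have c1 := hC.smooth_px hX hT
  have D : ∀ {f : ℝ → ℝ → ℝ}, SmoothOnRect X T f → ∀ x ∈ X, ∀ t ∈ T,
      HasDerivAt (fun s => f s t) (px f x t) x := fun hf x hx t ht => hf.hasDerivAt_x hX hT hx ht
  have e0 := two_mul_pt_eq hX hT ha hC hS
  have e1 : ∀ x ∈ X, ∀ t ∈ T, 2 * pt (px a) x t - ((px C x t - 4 * px (px a) x t) * a x t
      + (C x t - 4 * px a x t) * px a x t) = 0 := fun x hx t ht =>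
    eq_zero_of_hasDerivAt_of_eq_zero (((ha.hasDerivAt_pt_x hX hT hx ht).const_mul 2).sub
      (((D hC x hx t ht).sub ((D s1 x hx t ht).const_mul 4)).mul (D ha x hx t ht))) hX
      (fun s hs => e0 s hs t ht) hx
  have e2 : ∀ x ∈ X, ∀ t ∈ T, 2 * pt (px (px a)) x t
      - (2 * (px C x t - 4 * px (px a) x t) * px a x t
        + (C x t - 4 * px a x t) * px (px a) x t) = 0 := fun x hx t ht =>
    eq_zero_of_hasDerivAt_of_eq_zero ((((s1.hasDerivAt_pt_x hX hT hx ht).const_mul 2).sub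
      ((((D c1 x hx t ht).sub ((D s2 x hx t ht).const_mul 4)).mul (D ha x hx t ht)).add
      (((D hC x hx t ht).sub ((D s1 x hx t ht).const_mul 4)).mul
        (D s1 x hx t ht)))).congr_deriv (by
          rw [(hS x hx t ht).pxxC, (hS x hx t ht).pxxxa]; simp only [Pi.sub_apply]; ring)) hX
      (fun s hs => e1 s hs t ht) hx
  have e3 : ∀ x ∈ X, ∀ t ∈ T, (px C x t - 4 * px (px a) x t) * px (px a) x t = 0 :=
      fun x hx t ht => by
    have h0 := pt_eq_zero hT (fun x hx t ht => (hS x hx t ht).pxxxa) x hx t ht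
    have := eq_zero_of_hasDerivAt_of_eq_zero (((s2.hasDerivAt_pt_x hX hT hx ht).const_mul 2).sub
      (((((D c1 x hx t ht).sub ((D s2 x hx t ht).const_mul 4)).const_mul 2).mul
        (D s1 x hx t ht)).add (((D hC x hx t ht).sub ((D s1 x hx t ht).const_mul 4)).mul
        (D s2 x hx t ht)))) hX (fun s hs => e2 s hs t ht) hx
    simp only [Pi.sub_apply, h0, (hS x hx t ht).pxxC, (hS x hx t ht).pxxxa] at this
    linear_combination -this / 3
  intro x₀ hx₀ t₀ ht₀
  by_contra hne
  have hα : 4 + α = 0 := by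
    have h1 := (mul_eq_zero.1 (e3 x₀ hx₀ t₀ ht₀)).resolve_left hne
    have h2 := (hS x₀ hx₀ t₀ ht₀).pxxa
    rw [h1] at h2 hne
    exact (mul_eq_zero.1 (h2.symm.trans (mul_zero 6))).resolve_right (by simpa using hne)
  have hα' : α ≠ 0 := fun h => by norm_num [h] at hα
  have axx : ∀ x ∈ X, ∀ t ∈ T, px (px a) x t = 0 := fun x hx t ht => by
    have := (hS x hx t ht).pxxa
    rw [hα] at this
    linarith
  have hA0 : ∀ x ∈ X, ∀ t ∈ T, A x t = 0 := fun x hx t ht =>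
    (mul_eq_zero.1 (hαA x hx t ht)).resolve_left hα'
  have A4 := px_eq_zero hX (px_eq_zero hX (px_eq_zero hX (px_eq_zero hX hA0)))
  have hc : px C x₀ t₀ ≠ 0 := by
    rw [axx x₀ hx₀ t₀ ht₀] at hne
    simpa using hne
  obtain ⟨X', hX'X, T', hT'T, oX, oT, -, -, mx, mt, hn⟩ :=
    exists_subrect_ne_zero hX hT c1 hx₀ ht₀ hc
  -- on a rectangle where `C_x ≠ 0` the equations for `a` force `a = 0`
  have ax : ∀ x ∈ X', ∀ t ∈ T', px a x t = 0 := fun x hx t ht => by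
    have h1 := e2 x (hX'X hx) t (hT'T ht)
    have h2 := pt_eq_zero hT axx x (hX'X hx) t (hT'T ht)
    rw [h2, axx x (hX'X hx) t (hT'T ht)] at h1
    have h3 : px C x t * px a x t = 0 := by linarith
    exact (mul_eq_zero.1 h3).resolve_left (hn x hx t ht)
  have a0 : ∀ x ∈ X', ∀ t ∈ T', a x t = 0 := fun x hx t ht => by
    have h1 := e1 x (hX'X hx) t (hT'T ht)
    rw [pt_eq_zero oT ax x hx t ht, axx x (hX'X hx) t (hT'T ht), ax x hx t ht] at h1
    have h3 : px C x t * a x t = 0 := by linarith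
    exact (mul_eq_zero.1 h3).resolve_left (hn x hx t ht)
  refine hc (px_C_eq_zero_of_cubic oX oT (hC.mono hX'X hT'T)
    (fun x hx t ht => (hS x (hX'X hx) t (hT'T ht)).pxxC) (fun x hx t ht => ?_) x₀ mx t₀ mt)
  have h1 := (hS x (hX'X hx) t (hT'T ht)).u0
  rw [ax x hx t ht, a0 x hx t ht, pt_eq_zero oT a0 x hx t ht,
    A4 x (hX'X hx) t (hT'T ht)] at h1
  linear_combination h1

/-- For `κ = 0`, the symmetries are governed by a function `m` of `t` alone. -/
theorem exists_rate (hX : IsOpen X) (hX' : IsPreconnected X) (hX'' : X.Nonempty) (hT : IsOpen T)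
    (hT' : IsPreconnected T) (ha : SmoothOnRect X T a)
    (hC : SmoothOnRect X T C) (hαA : ∀ x ∈ X, ∀ t ∈ T, α * A x t = 0)
    (hS : ∀ x ∈ X, ∀ t ∈ T, ReducedSystem α 0 a A C x t) :
    ∃ m : ℝ → ℝ, ContDiffOn ℝ ∞ m T ∧ (∀ x ∈ X, ∀ t ∈ T, C x t = 4 * px a x t + 2 * m t) ∧
      (∀ x ∈ X, ∀ t ∈ T, pt a x t = m t * a x t) ∧
      ((∀ x ∈ X, ∀ t ∈ T, a x t = 0) ∨ ∀ t ∈ T, HasDerivAt m (m t ^ 2) t) := by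
  obtain ⟨x₀, hx₀⟩ := hX''
  have s1 := ha.smooth_px hX hT
  have sE : SmoothOnRect X T (fun x t => C x t - 4 * px a x t) :=
    hC.sub (contDiffOn_const.mul s1)
  have hE := px_C_eq hX hT ha hC hαA hS
  have hE' : ∀ x ∈ X, ∀ t ∈ T, C x t - 4 * px a x t = C x₀ t - 4 * px a x₀ t :=
      fun x hx t ht => by
    refine eq_of_hasDerivAt_zero hX hX' (f := fun x => C x t - 4 * px a x t) (fun x hx => ?_) hx hx₀
    exact ((hC.hasDerivAt_x hX hT hx ht).sub ((s1.hasDerivAt_x hX hT hx ht).const_mul 4)).congr_deriv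
      (hE x hx t ht)
  have hm : ContDiffOn ℝ ∞ (fun t => (C x₀ t - 4 * px a x₀ t) / 2) T :=
    (sE.slice_t hx₀).div_const 2
  generalize hmm : (fun t => (C x₀ t - 4 * px a x₀ t) / 2) = m at hm
  have hmt : ∀ t, C x₀ t - 4 * px a x₀ t = 2 * m t := fun t => by
    rw [← hmm]
    ring
  have k1 : ∀ x ∈ X, ∀ t ∈ T, C x t = 4 * px a x t + 2 * m t := fun x hx t ht => by
    linear_combination hE' x hx t ht + hmt t
  have k2 : ∀ x ∈ X, ∀ t ∈ T, pt a x t = m t * a x t := fun x hx t ht => by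
    have := two_mul_pt_eq hX hT ha hC hS x hx t ht
    rw [k1 x hx t ht] at this
    linarith
  refine ⟨m, hm, k1, k2, ?_⟩
  by_cases h0 : ∀ x ∈ X, ∀ t ∈ T, a x t = 0
  · exact Or.inl h0
  right
  push Not at h0
  obtain ⟨x₁, hx₁, t₁, ht₁, hne⟩ := h0
  intro t ht
  have dm := smooth_hasDerivAt hT hm ht
  have hat : a x₁ t ≠ 0 := fun h => hne (eq_zero_of_linear_ode hT hT' hm (y := fun t => a x₁ t)
    (fun s hs => (ha.hasDerivAt_t hX hT hx₁ hs).congr_deriv (k2 x₁ hx₁ s hs)) ht h t₁ ht₁)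
  refine dm.congr_deriv ?_
  have dpt : pt (px a) x₁ t = m t * px a x₁ t := by
    rw [ha.pt_px hX hT hx₁ ht, px_congr hX k2 x₁ hx₁ t ht, px_fun_t_mul]
  have dptt : pt (pt a) x₁ t = deriv m t * a x₁ t + m t * (m t * a x₁ t) := by
    rw [pt_congr hT k2 x₁ hx₁ t ht, ← k2 x₁ hx₁ t ht]
    exact (dm.mul (ha.hasDerivAt_t hX hT hx₁ ht)).deriv
  have dCt : pt C x₁ t = 4 * (m t * px a x₁ t) + 2 * deriv m t := by
    rw [pt_congr hT k1 x₁ hx₁ t ht, ← dpt]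
    exact (((s1.hasDerivAt_t hX hT hx₁ ht).const_mul 4).add (dm.const_mul 2)).deriv
  have hu := (hS x₁ hx₁ t ht).u1
  rw [dCt, dptt, k2 x₁ hx₁ t ht, k1 x₁ hx₁ t ht] at hu
  have : a x₁ t * (deriv m t - m t ^ 2) = 0 := by linear_combination -hu / 5
  linarith [(mul_eq_zero.1 this).resolve_left hat]

end KappaZero

/-! ### Classification for `κ = 0` -/

section Polynomials

variable {I : Set ℝ} {f f₁ f₂ f₃ : ℝ → ℝ}

/-- A function with constant fourth derivative is a polynomial. -/
theorem exists_eq_quartic (hI : IsOpen I) (hI' : IsPreconnected I) {c : ℝ}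
    (h0 : ∀ x ∈ I, HasDerivAt f (f₁ x) x) (h1 : ∀ x ∈ I, HasDerivAt f₁ (f₂ x) x)
    (h2 : ∀ x ∈ I, HasDerivAt f₂ (f₃ x) x) (h3 : ∀ x ∈ I, HasDerivAt f₃ (24 * c) x) :
    ∃ c₀ c₁ c₂ c₃ : ℝ, ∀ x ∈ I, f x = quartic c₀ c₁ c₂ c₃ c x := by
  have P : ∀ (n : ℕ) (b x : ℝ), HasDerivAt (fun x => b * x ^ n) (b * (n * x ^ (n - 1))) x :=
    fun n b x => (hasDerivAt_pow n x).const_mul b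
  obtain ⟨d₃, e3⟩ := exists_eq_add_const hI hI' h3
    (fun x _ => (P 1 (24 * c) x).congr_deriv (by norm_num))
  obtain ⟨d₂, e2⟩ := exists_eq_add_const hI hI' (fun x hx => (h2 x hx).congr_deriv (e3 x hx))
    (fun x _ => ((P 2 (12 * c) x).add (P 1 d₃ x)).congr_deriv (by norm_num; ring))
  obtain ⟨d₁, e1⟩ := exists_eq_add_const hI hI' (fun x hx => (h1 x hx).congr_deriv (e2 x hx))
    (fun x _ => ((P 3 (4 * c) x).add ((P 2 (d₃ / 2) x).add (P 1 d₂ x))).congr_deriv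
      (by simp only [Pi.add_apply]; norm_num; ring))
  obtain ⟨d₀, e0⟩ := exists_eq_add_const hI hI' (fun x hx => (h0 x hx).congr_deriv (e1 x hx))
    (fun x _ => ((P 4 c x).add ((P 3 (d₃ / 6) x).add ((P 2 (d₂ / 2) x).add
      (P 1 d₁ x)))).congr_deriv (by simp only [Pi.add_apply]; norm_num; ring))
  refine ⟨d₀, d₁, d₂ / 2, d₃ / 6, fun x hx => ?_⟩
  rw [e0 x hx, quartic]
  simp only [Pi.add_apply]
  ring

theorem exists_eq_quartic_of_deriv (hI : IsOpen I) (hI' : IsPreconnected I) {c : ℝ}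
    (hf : ContDiffOn ℝ ∞ f I) (h : ∀ x ∈ I, deriv (deriv (deriv (deriv f))) x = 24 * c) :
    ∃ c₀ c₁ c₂ c₃ : ℝ, ∀ x ∈ I, f x = quartic c₀ c₁ c₂ c₃ c x := by
  have s1 := smooth_deriv hI hf
  have s2 := smooth_deriv hI s1
  have s3 := smooth_deriv hI s2
  exact exists_eq_quartic hI hI' (fun x hx => smooth_hasDerivAt hI hf hx)
    (fun x hx => smooth_hasDerivAt hI s1 hx) (fun x hx => smooth_hasDerivAt hI s2 hx)
    (fun x hx => (smooth_hasDerivAt hI s3 hx).congr_deriv (h x hx))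

end Polynomials

theorem quartic_zero (x : ℝ) : quartic 0 0 0 0 0 x = 0 := by
  rw [quartic]
  ring

section KappaZeroClassification

variable {X T U : Set ℝ} {α β γ κ : ℝ} {a A C : ℝ → ℝ → ℝ} {ξ φ : ℝ → ℝ → ℝ → ℝ}

/-- In terms of the logarithmic derivative, the third order equation for `g` has order two. -/
theorem solvesOdeThree_iff (hT : IsOpen T) {g C : ℝ → ℝ} {c₄ : ℝ} (hC : ContDiffOn ℝ ∞ C T)
    (hg : ∀ t ∈ T, HasDerivAt g (-C t * g t) t) (hg0 : ∀ t ∈ T, g t ≠ 0) :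
    SolvesOdeThree T c₄ g ↔
      ∀ t ∈ T, deriv (deriv C) t + C t * deriv C t - C t ^ 3 = 24 * c₄ * g t := by
  have dC : ∀ t ∈ T, HasDerivAt C (deriv C t) t := fun t ht => smooth_hasDerivAt hT hC ht
  have dC' : ∀ t ∈ T, HasDerivAt (deriv C) (deriv (deriv C) t) t :=
    fun t ht => smooth_hasDerivAt hT (smooth_deriv hT hC) ht
  have d1 : ∀ t ∈ T, deriv g t = -C t * g t := fun t ht => (hg t ht).deriv
  have d2 : ∀ t ∈ T, deriv (deriv g) t = (C t ^ 2 - deriv C t) * g t := fun t ht => by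
    rw [deriv_congr_of_eqOn hT d1 ht]
    refine (((dC t ht).neg).mul (hg t ht)).deriv.trans ?_
    simp only [Pi.neg_apply]
    ring
  have d3 : ∀ t ∈ T, deriv (deriv (deriv g)) t
      = (3 * C t * deriv C t - deriv (deriv C) t - C t ^ 3) * g t := fun t ht => by
    rw [deriv_congr_of_eqOn hT d2 ht]
    refine ((((dC t ht).pow 2).sub (dC' t ht)).mul (hg t ht)).deriv.trans ?_
    simp only [Pi.sub_apply, Pi.pow_apply]
    push_cast
    ring
  refine forall₂_congr fun t ht => ?_
  simp only [iteratedDeriv_succ, iteratedDeriv_zero]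
  rw [d1 t ht, d2 t ht, d3 t ht]
  constructor
  · intro h
    have : g t ^ 3 * (deriv (deriv C) t + C t * deriv C t - C t ^ 3 - 24 * c₄ * g t) = 0 := by
      linear_combination -h
    exact sub_eq_zero.1 ((mul_eq_zero.1 this).resolve_left (pow_ne_zero 3 (hg0 t ht)))
  · intro h
    linear_combination -g t ^ 3 * h

/-- The part of the classification with `κ = 0` and `φ` inhomogeneous in `u`. -/
theorem exists_kindThree (hX : IsOpen X) (hX' : IsPreconnected X) (hT : IsOpen T)
    (hT' : IsPreconnected T) (ha : SmoothOnRect X T a)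
    (hA : SmoothOnRect X T A) (hC : SmoothOnRect X T C) (h1 : EqOnBox X T U ξ (constU a))
    (h2 : EqOnBox X T U φ (affineU A C)) (hS : ∀ x ∈ X, ∀ t ∈ T, AffineSystem α β γ 0 a A C x t)
    {x₀ t₀ : ℝ} (hx₀ : x₀ ∈ X) (ht₀ : t₀ ∈ T) (hne : A x₀ t₀ ≠ 0) :
    ∃ g c₀ c₁ c₂ c₃ c₄, KindThree α β γ 0 X T U ξ φ g c₀ c₁ c₂ c₃ c₄ ∧
      ¬ (c₀ = 0 ∧ c₁ = 0 ∧ c₂ = 0 ∧ c₃ = 0 ∧ c₄ = 0) := by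
  have hα : α = 0 := (mul_eq_zero.1 (hS x₀ hx₀ t₀ ht₀).u1u3).resolve_right hne
  have hβ : β = 0 := (mul_eq_zero.1 (hS x₀ hx₀ t₀ ht₀).u2u2).resolve_right hne
  have hγ : γ = 0 := (mul_eq_zero.1 (hS x₀ hx₀ t₀ ht₀).u1u1_m1).resolve_right hne
  have hR := reducedSystem_of_affineSystem hX hT ha hA hC hS
  have hαA : ∀ x ∈ X, ∀ t ∈ T, α * A x t = 0 := fun x hx t ht => (hS x hx t ht).u1u3
  obtain ⟨m, hm, hCm, hat, -⟩ := exists_rate hX hX' ⟨x₀, hx₀⟩ hT hT' ha hC hαA hR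
  have s1 := ha.smooth_px hX hT
  have axx : ∀ x ∈ X, ∀ t ∈ T, px (px a) x t = 0 := fun x hx t ht => by
    have e1 := (hR x hx t ht).pxxa
    have e2 := px_C_eq hX hT ha hC hαA hR x hx t ht
    rw [hα] at e1
    linarith
  -- near `(x₀, t₀)`, hence on the line `t = t₀`, hence everywhere, `a = 0`
  obtain ⟨X', hX'X, T', hT'T, oX, oT, -, -, mx, mt, hn⟩ :=
    exists_subrect_ne_zero hX hT hA hx₀ ht₀ hne
  have a0' : ∀ x ∈ X', ∀ t ∈ T', a x t = 0 := fun x hx t ht => by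
    have := (mul_eq_zero.1 (hS x (hX'X hx) t (hT'T ht)).u2_m1).resolve_left (hn x hx t ht)
    exact pow_eq_zero_iff (n := 2) (by norm_num) |>.1 (by linarith)
  have p0 : ∀ x ∈ X, px a x t₀ = 0 := fun x hx =>
    (eq_of_hasDerivAt_zero hX hX' (f := fun x => px a x t₀) (fun x hx =>
      (s1.hasDerivAt_x hX hT hx ht₀).congr_deriv (axx x hx t₀ ht₀)) hx hx₀).trans
      (px_eq_zero oX a0' x₀ mx t₀ mt)
  have a0'' : ∀ x ∈ X, a x t₀ = 0 := fun x hx =>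
    (eq_of_hasDerivAt_zero hX hX' (f := fun x => a x t₀) (fun x hx =>
      (ha.hasDerivAt_x hX hT hx ht₀).congr_deriv (p0 x hx)) hx hx₀).trans (a0' x₀ mx t₀ mt)
  have a0 : ∀ x ∈ X, ∀ t ∈ T, a x t = 0 := fun x hx =>
    eq_zero_of_linear_ode hT hT' hm (y := fun t => a x t)
      (fun t ht => (ha.hasDerivAt_t hX hT hx ht).congr_deriv (hat x hx t ht)) ht₀ (a0'' x hx)
  have ax0 := px_eq_zero hX a0
  have at0 := pt_eq_zero hT a0
  have hCt : ∀ x ∈ X, ∀ t ∈ T, C x t = C x₀ t := fun x hx t ht => by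
    rw [hCm x hx t ht, hCm x₀ hx₀ t ht, ax0 x hx t ht, ax0 x₀ hx₀ t ht]
  have sC0 : ContDiffOn ℝ ∞ (fun t => C x₀ t) T := hC.slice_t hx₀
  have tA := hA.smooth_pt hX hT
  have Cx : ∀ x ∈ X, ∀ t ∈ T, px C x t = 0 := fun x hx t ht => by
    have := px_C_eq hX hT ha hC hαA hR x hx t ht
    rw [axx x hx t ht] at this
    linarith
  have b0 : ∀ x ∈ X, ∀ t ∈ T, pt A x t + A x t * C x t = 0 := by
    refine eq_zero_of_mul_eq_zero_on_rect (f := A) hX hT (tA.add (hA.mul hC)) (fun x hx t ht => ?_)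
      fun X' _ T' _ _ hT' h x hx t ht => ?_
    · have := (hS x hx t ht).u0_m1
      rw [a0 x hx t ht] at this
      linear_combination this
    · rw [pt_eq_zero hT' h x hx t ht, h x hx t ht]
      ring
  obtain ⟨g, hg, hg'⟩ := exists_exp_primitive hT hT' sC0.neg
  have g0 : ∀ t ∈ T, g t ≠ 0 := fun t ht => (hg' t ht).1.ne'
  have dg : ∀ t ∈ T, HasDerivAt g (-C x₀ t * g t) t := fun t ht => (hg' t ht).2
  have hAg : ∀ x ∈ X, ∀ t ∈ T, A x t = g t * (A x t₀ / g t₀) := fun x hx t ht => by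
    have := eq_of_hasDerivAt_zero hT hT' (f := fun t => A x t / g t) (fun s hs => by
      refine ((hA.hasDerivAt_t hX hT hx hs).div (dg s hs) (g0 s hs)).congr_deriv ?_
      have e1 : pt A x s = -(A x s * C x s) := by linarith [b0 x hx s hs]
      rw [e1, hCt x hx s hs]
      ring) ht ht₀
    rw [← this, mul_div_cancel₀ _ (g0 t ht)]
  have sQ : SmoothOnRect X T (fun x _ => A x t₀ / g t₀) :=
    smooth_fun_x ((hA.slice_x ht₀).div_const _)
  have hQ : ContDiffOn ℝ ∞ (fun x => A x t₀ / g t₀) X := sQ.slice_x ht₀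
  generalize hQQ : (fun x => A x t₀ / g t₀) = Q at hQ
  have hAQ : ∀ x ∈ X, ∀ t ∈ T, A x t = g t * Q x := fun x hx t ht => by
    rw [hAg x hx t ht, ← hQQ]
  have dQ : ∀ f : ℝ → ℝ, px (fun x t => g t * f x) = fun x t => g t * deriv f x := fun f =>
    px_fun_t_mul g (fun x _ => f x)
  have A4 : ∀ x ∈ X, ∀ t ∈ T,
      px (px (px (px A))) x t = g t * deriv (deriv (deriv (deriv Q))) x := fun x hx t ht => by
    have := px_congr hX (px_congr hX (px_congr hX (px_congr hX hAQ))) x hx t ht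
    simpa only [dQ] using this
  have Ctt : ∀ t ∈ T, deriv (deriv fun t => C x₀ t) t + C x₀ t * deriv (fun t => C x₀ t) t
      - C x₀ t ^ 3 = g t * deriv (deriv (deriv (deriv Q))) x₀ := fun t ht => by
    have := (hR x₀ hx₀ t ht).u0
    rw [ax0 x₀ hx₀ t ht, a0 x₀ hx₀ t ht, at0 x₀ hx₀ t ht, A4 x₀ hx₀ t ht] at this
    have e1 : pt C x₀ t = deriv (fun t => C x₀ t) t := rfl
    have e2 : pt (pt C) x₀ t = deriv (deriv fun t => C x₀ t) t := rfl
    rw [← e1, ← e2]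
    linear_combination this
  have Q4 : ∀ x ∈ X, deriv (deriv (deriv (deriv Q))) x
      = 24 * (deriv (deriv (deriv (deriv Q))) x₀ / 24) := fun x hx => by
    have h3 := (hR x hx t₀ ht₀).u0
    have h4 := (hR x₀ hx₀ t₀ ht₀).u0
    rw [ax0 x hx t₀ ht₀, a0 x hx t₀ ht₀, at0 x hx t₀ ht₀, A4 x hx t₀ ht₀, hCt x hx t₀ ht₀,
      pt_congr hT hCt x hx t₀ ht₀, pt_congr hT (pt_congr hT hCt) x hx t₀ ht₀] at h3
    rw [ax0 x₀ hx₀ t₀ ht₀, a0 x₀ hx₀ t₀ ht₀, at0 x₀ hx₀ t₀ ht₀, A4 x₀ hx₀ t₀ ht₀] at h4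
    have e1 : pt (fun _ t => C x₀ t) x t₀ = pt C x₀ t₀ := rfl
    have e2 : pt (pt fun _ t => C x₀ t) x t₀ = pt (pt C) x₀ t₀ := rfl
    rw [e1, e2] at h3
    have : g t₀ * (deriv (deriv (deriv (deriv Q))) x - deriv (deriv (deriv (deriv Q))) x₀) = 0 := by
      linear_combination h4 - h3
    linarith [(mul_eq_zero.1 this).resolve_left (g0 t₀ ht₀)]
  obtain ⟨c₀, c₁, c₂, c₃, hc⟩ := exists_eq_quartic_of_deriv hX hX' hQ Q4
  refine ⟨g, c₀, c₁, c₂, c₃, deriv (deriv (deriv (deriv Q))) x₀ / 24, ⟨hα, hβ, hγ, rfl, hg, g0,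
    (solvesOdeThree_iff hT sC0 dg g0).2 fun t ht => ?_, fun x hx t ht u hu => ⟨?_, ?_⟩⟩, ?_⟩
  · rw [Ctt t ht]
    ring
  · rw [h1 x hx t ht u hu, constU, a0 x hx t ht]
  · rw [h2 x hx t ht u hu, affineU, phiThree, (dg t ht).deriv, hAQ x hx t ht, hc x hx, hCt x hx t ht]
    field_simp [g0 t ht]
    ring
  · rintro ⟨r0, r1, r2, r3, r4⟩
    refine hne ?_
    rw [hAQ x₀ hx₀ t₀ ht₀, hc x₀ hx₀, r4, r0, r1, r2, r3, quartic_zero, mul_zero]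

/-- The classification for `κ = 0`. -/
theorem classification_kappa_zero (hX : IsOpen X) (hX' : IsPreconnected X) (hX'' : X.Nonempty)
    (hT : IsOpen T) (hT' : IsPreconnected T) (hU : IsOpen U) (ha : SmoothOnRect X T a)
    (hA : SmoothOnRect X T A) (hC : SmoothOnRect X T C) (h1 : EqOnBox X T U ξ (constU a))
    (h2 : EqOnBox X T U φ (affineU A C)) (hS : ∀ x ∈ X, ∀ t ∈ T, AffineSystem α β γ 0 a A C x t)
    (hcl : ¬ IsClassicalUpToFactor α β γ 0 0 X T U ξ φ) :
    (∃ g, KindOne 0 X T U ξ φ g ∧ ∃ t ∈ T, 2 * deriv g t ≠ g t ^ 2) ∨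
      (∃ g c₀ c₁ c₂ c₃ c₄, KindThree α β γ 0 X T U ξ φ g c₀ c₁ c₂ c₃ c₄ ∧
        ¬ (c₀ = 0 ∧ c₁ = 0 ∧ c₂ = 0 ∧ c₃ = 0 ∧ c₄ = 0)) := by
  by_cases hA0 : ∀ x ∈ X, ∀ t ∈ T, A x t = 0
  swap
  · push Not at hA0
    obtain ⟨x₀, hx₀, t₀, ht₀, hne⟩ := hA0
    exact Or.inr (exists_kindThree hX hX' hT hT' ha hA hC h1 h2 hS hx₀ ht₀ hne)
  left
  have hR := reducedSystem_of_affineSystem hX hT ha hA hC hS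
  obtain ⟨m, hm, hCm, hat, hor⟩ := exists_rate hX hX' hX'' hT hT' ha hC
    (fun x hx t ht => (hS x hx t ht).u1u3) hR
  have hm' : ¬ ∀ t ∈ T, HasDerivAt m (m t ^ 2) t := fun hm' => by
    have h2' : EqOnBox X T U φ (affineU (fun _ _ => 0) C) := fun x hx t ht u hu => by
      rw [h2 x hx t ht u hu, affineU, affineU, hA0 x hx t ht]
    refine hcl (isClassicalUpToFactor_of_affineSystem hX hT hT' hU ha hC h1 h2' hm hm' hat hCm
      (fun _ _ _ _ => zero_mul _) hS)
  have a0 := hor.resolve_right hm'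
  have hCm' : ∀ x ∈ X, ∀ t ∈ T, C x t = 2 * m t := fun x hx t ht => by
    rw [hCm x hx t ht, px_eq_zero hX a0 x hx t ht]
    ring
  have dm : ∀ t ∈ T, HasDerivAt m (deriv m t) t := fun t ht => smooth_hasDerivAt hT hm ht
  refine ⟨fun t => 2 * m t, ⟨rfl, contDiffOn_const.mul hm, fun t ht => ?_,
    fun x hx t ht u hu => ⟨?_, ?_⟩⟩, ?_⟩
  · obtain ⟨x₀, hx₀⟩ := hX''
    have := (hR x₀ hx₀ t ht).u0
    rw [px_eq_zero hX a0 x₀ hx₀ t ht, a0 x₀ hx₀ t ht, pt_eq_zero hT a0 x₀ hx₀ t ht,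
      pt_congr hT hCm' x₀ hx₀ t ht, pt_congr hT (pt_congr hT hCm') x₀ hx₀ t ht, hCm' x₀ hx₀ t ht,
      px_eq_zero hX (px_eq_zero hX (px_eq_zero hX (px_eq_zero hX hA0))) x₀ hx₀ t ht] at this
    simp only [iteratedDeriv_succ, iteratedDeriv_zero]
    have e1 : pt (fun _ t => 2 * m t) x₀ t = deriv (fun t => 2 * m t) t := rfl
    have e2 : pt (pt fun _ t => 2 * m t) x₀ t = deriv (deriv fun t => 2 * m t) t := rfl
    rw [← e1, ← e2]
    linear_combination this
  · rw [h1 x hx t ht u hu, constU, a0 x hx t ht]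
  · rw [h2 x hx t ht u hu, affineU, phiOne, hA0 x hx t ht, hCm' x hx t ht, zero_add]
  · by_contra hcon
    push Not at hcon
    refine hm' fun t ht => (dm t ht).congr_deriv ?_
    have h3 := hcon t ht
    rw [((dm t ht).const_mul 2).deriv] at h3
    linarith

end KappaZeroClassification

/-! ### The determining equations: the case `κ ≠ 0` -/

section KappaNonzero

variable {X T U : Set ℝ} {α β γ κ : ℝ} {a A C f : ℝ → ℝ → ℝ} {ξ φ : ℝ → ℝ → ℝ → ℝ}

theorem eq_taylor_two (hX : IsOpen X) (hX' : IsPreconnected X) (hT : IsOpen T)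
    (hf : SmoothOnRect X T f) {t : ℝ} (ht : t ∈ T) (h : ∀ x ∈ X, px (px (px f)) x t = 0) {x₀ : ℝ}
    (hx₀ : x₀ ∈ X) : ∀ x ∈ X, px f x t = px f x₀ t + px (px f) x₀ t * (x - x₀) ∧
      f x t = f x₀ t + px f x₀ t * (x - x₀) + px (px f) x₀ t / 2 * (x - x₀) ^ 2 := by
  have s1 := hf.smooth_px hX hT
  have s2 := s1.smooth_px hX hT
  have e2 : ∀ x ∈ X, px (px f) x t = px (px f) x₀ t := fun x hx =>
    eq_of_hasDerivAt_zero hX hX' (f := fun x => px (px f) x t) (fun x hx =>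
      (s2.hasDerivAt_x hX hT hx ht).congr_deriv (h x hx)) hx hx₀
  have dl : ∀ x, HasDerivAt (fun x : ℝ => x - x₀) 1 x := fun x => (hasDerivAt_id x).sub_const x₀
  have e1 : ∀ x ∈ X, px f x t = px f x₀ t + px (px f) x₀ t * (x - x₀) := fun x hx => by
    have := eq_of_hasDerivAt_zero hX hX' (f := fun x => px f x t - px (px f) x₀ t * (x - x₀))
      (fun x hx => ((s1.hasDerivAt_x hX hT hx ht).sub ((dl x).const_mul _)).congr_deriv (by
        rw [e2 x hx]; ring)) hx hx₀
    linarith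
  refine fun x hx => ⟨e1 x hx, ?_⟩
  have := eq_of_hasDerivAt_zero hX hX' (f := fun x => f x t - (px f x₀ t * (x - x₀)
      + px (px f) x₀ t / 2 * (x - x₀) ^ 2))
    (fun x hx => ((hf.hasDerivAt_x hX hT hx ht).sub (((dl x).const_mul _).add
      (((dl x).pow 2).const_mul _))).congr_deriv (by
        rw [e1 x hx]; push_cast; ring)) hx hx₀
  linarith

/-- If the polynomials `a`, `q`, `h` of degrees `2`, `1`, `3` satisfy `q (a² - κ) = 2 a h`, then
`a (q a - 2 h) = κ q`; comparison of degrees shows that `a` has degree at most one or `h` has no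
cubic term, and that `q = 0` if `a` has degree one. -/
theorem quadratic_relation {S : Set ℝ} (hS : S.Infinite) (hκ : κ ≠ 0)
    {a₀ p e q₀ q₁ h₀ h₁ h₂ h₃ : ℝ} (h : ∀ y ∈ S, (q₀ + q₁ * y) * ((a₀ + p * y + e * y ^ 2) ^ 2 - κ)
      = 2 * (a₀ + p * y + e * y ^ 2) * (h₀ + h₁ * y + h₂ * y ^ 2 + h₃ * y ^ 3)) :
    (e ≠ 0 → h₃ = 0) ∧ (e = 0 → h₂ = 0 → h₃ = 0 → p ≠ 0 → q₀ = 0 ∧ q₁ = 0) := by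
  generalize hs3 : q₁ * e - 2 * h₃ = s₃
  generalize hs2 : q₀ * e + q₁ * p - 2 * h₂ = s₂
  generalize hs1 : q₀ * p + q₁ * a₀ - 2 * h₁ = s₁
  generalize hs0 : q₀ * a₀ - 2 * h₀ = s₀
  obtain ⟨k0, k1, k2, k3, k4, k5, -⟩ := coeffs_eq_zero_of_infinite hS (a₀ := a₀ * s₀ - κ * q₀)
    (a₁ := p * s₀ + a₀ * s₁ - κ * q₁) (a₂ := e * s₀ + p * s₁ + a₀ * s₂)
    (a₃ := e * s₁ + p * s₂ + a₀ * s₃) (a₄ := e * s₂ + p * s₃) (a₅ := e * s₃) (a₆ := 0) (a₇ := 0)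
    (a₈ := 0) fun y hy => by
      rw [← hs3, ← hs2, ← hs1, ← hs0]
      linear_combination h y hy
  constructor
  · intro he
    have r3 : s₃ = 0 := by simpa [he] using k5
    have r2 : s₂ = 0 := by simpa [he, r3] using k4
    have r1 : s₁ = 0 := by simpa [he, r3, r2] using k3
    have r0 : s₀ = 0 := by simpa [he, r1, r2] using k2
    have rq : q₁ = 0 := by simpa [hκ, r0, r1] using k1
    rw [rq, r3] at hs3
    linarith
  · intro he h2 h3 hp
    have r3 : s₃ = 0 := by rw [← hs3, he, h3]; ring
    have r2 : s₂ = 0 := by simpa [he, hp, r3] using k3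
    have r1 : s₁ = 0 := by simpa [he, hp, r2] using k2
    have rq : q₁ = 0 := by simpa [he, h2, r2, hp] using hs2
    have r0 : s₀ = 0 := by simpa [hp, r1, rq] using k1
    exact ⟨by simpa [hκ, r0] using k0, rq⟩

/-- The coefficient of `u u_xx`, read as a polynomial identity in `x`. -/
theorem u2_polynomial (hX : IsOpen X) (hX' : IsPreconnected X) (hT : IsOpen T) (hκ : κ ≠ 0)
    (ha : SmoothOnRect X T a) (hC : SmoothOnRect X T C)
    (hS : ∀ x ∈ X, ∀ t ∈ T, ReducedSystem α κ a A C x t) :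
    ∀ x ∈ X, ∀ t ∈ T, px (px a) x t = 0 ∧ px a x t * (C x t - 2 * px a x t) = 0
      ∧ px a x t * px C x t = 0 := by
  have s1 := ha.smooth_px hX hT
  have key : ∀ x₀ ∈ X, ∀ t ∈ T, _ := fun x₀ hx₀ t ht => by
    have ta := eq_taylor_two hX hX' hT ha ht (fun x hx => (hS x hx t ht).pxxxa) hx₀
    have tC := eq_taylor_two hX hX' hT hC ht
      (fun x hx => px_eq_zero hX (fun x hx t ht => (hS x hx t ht).pxxC) x hx t ht) hx₀
    have m1 : ∀ x ∈ X, ∀ t ∈ T, px (pt a) x t = pt (px a) x t :=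
      fun x hx t ht => (ha.pt_px hX hT hx ht).symm
    have m2 : ∀ x ∈ X, ∀ t ∈ T, px (px (pt a)) x t = pt (px (px a)) x t := fun x hx t ht =>
      (px_congr hX m1 x hx t ht).trans (s1.pt_px hX hT hx ht).symm
    have m3 : ∀ x ∈ X, ∀ t ∈ T, px (px (px (pt a))) x t = 0 := fun x hx t ht =>
      ((px_congr hX m2 x hx t ht).trans ((s1.smooth_px hX hT).pt_px hX hT hx ht).symm).trans
        (pt_eq_zero hT (fun x hx t ht => (hS x hx t ht).pxxxa) x hx t ht)
    have tt := eq_taylor_two hX hX' hT (ha.smooth_pt hX hT) ht (fun x hx => m3 x hx t ht) hx₀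
    rw [m1 x₀ hx₀ t ht, m2 x₀ hx₀ t ht] at tt
    have hinf : ((fun x => x - x₀) '' X).Infinite :=
      (hX.infinite_of_mem hx₀).image (sub_left_injective.injOn)
    exact quadratic_relation hinf hκ (a₀ := a x₀ t) (p := px a x₀ t) (e := px (px a) x₀ t / 2)
      (q₀ := C x₀ t - 2 * px a x₀ t) (q₁ := px C x₀ t - 2 * px (px a) x₀ t)
      (h₀ := pt a x₀ t + a x₀ t * px a x₀ t)
      (h₁ := pt (px a) x₀ t + px a x₀ t ^ 2 + a x₀ t * px (px a) x₀ t)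
      (h₂ := pt (px (px a)) x₀ t / 2 + 3 / 2 * px a x₀ t * px (px a) x₀ t)
      (h₃ := px (px a) x₀ t ^ 2 / 2) (by
        rintro y ⟨x, hx, rfl⟩
        have := (hS x hx t ht).u2
        rw [(ta x hx).1, (ta x hx).2, (tC x hx).2, (hS x₀ hx₀ t ht).pxxC, (tt x hx).2] at this
        linear_combination -this)
  have axx : ∀ x ∈ X, ∀ t ∈ T, px (px a) x t = 0 := fun x hx t ht => by
    by_contra hne
    have := (key x hx t ht).1 (by simpa using hne)
    exact hne (pow_eq_zero_iff (n := 2) (by norm_num) |>.1 (by linarith))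
  intro x hx t ht
  refine ⟨axx x hx t ht, ?_⟩
  by_cases hp : px a x t = 0
  · simp [hp]
  · have := (key x hx t ht).2 (by rw [axx x hx t ht, zero_div])
      (by rw [axx x hx t ht, pt_eq_zero hT axx x hx t ht]; ring) (by rw [axx x hx t ht]; ring) hp
    rw [axx x hx t ht] at this
    exact ⟨by rw [this.1, mul_zero], by linear_combination px a x t * this.2⟩

/-- For `κ ≠ 0` the coefficient `C` does not depend on `x`. Where `C_x ≠ 0`, one has `a_x = 0`
by `u2_polynomial`, hence `a² = κ`, and two derivatives in `x` of the coefficient of `u u_x` give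
`a C_x² = 0`. -/
theorem px_C_eq_zero_of_kappa_ne (hX : IsOpen X) (hX' : IsPreconnected X) (hT : IsOpen T)
    (hκ : κ ≠ 0) (ha : SmoothOnRect X T a) (hC : SmoothOnRect X T C)
    (hS : ∀ x ∈ X, ∀ t ∈ T, ReducedSystem α κ a A C x t) :
    ∀ x ∈ X, ∀ t ∈ T, px C x t = 0 := by
  have hP := u2_polynomial hX hX' hT hκ ha hC hS
  have sc := hC.smooth_px hX hT
  intro x₀ hx₀ t₀ ht₀
  by_contra hne
  obtain ⟨X', hX'X, T', hT'T, oX, oT, -, -, mx, mt, hn⟩ :=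
    exists_subrect_ne_zero hX hT sc hx₀ ht₀ hne
  have a' := ha.mono hX'X hT'T
  have c' := hC.mono hX'X hT'T
  have sc' := sc.mono hX'X hT'T
  have p0 : ∀ x ∈ X', ∀ t ∈ T', px a x t = 0 := fun x hx t ht =>
    (mul_eq_zero.1 (hP x (hX'X hx) t (hT'T ht)).2.2).resolve_right (hn x hx t ht)
  have pt0 := pt_eq_zero oT p0
  have e3 : ∀ x ∈ X', ∀ t ∈ T', -C x t * (a x t ^ 2 - κ) + 2 * a x t * pt a x t = 0 :=
      fun x hx t ht => by
    have := (hS x (hX'X hx) t (hT'T ht)).u2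
    rw [p0 x hx t ht] at this
    linear_combination this
  have Da : ∀ x ∈ X', ∀ t ∈ T', HasDerivAt (fun s => a s t) 0 x := fun x hx t ht =>
    (a'.hasDerivAt_x oX oT hx ht).congr_deriv (p0 x hx t ht)
  have Dat : ∀ x ∈ X', ∀ t ∈ T', HasDerivAt (fun s => pt a s t) 0 x := fun x hx t ht =>
    (a'.hasDerivAt_pt_x oX oT hx ht).congr_deriv (pt0 x hx t ht)
  have DC : ∀ x ∈ X', ∀ t ∈ T', HasDerivAt (fun s => C s t) (px C x t) x := fun x hx t ht =>
    c'.hasDerivAt_x oX oT hx ht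
  have hsq : ∀ x ∈ X', ∀ t ∈ T', a x t ^ 2 = κ := fun x hx t ht => by
    have : -px C x t * (a x t ^ 2 - κ) = 0 := eq_zero_of_hasDerivAt_of_eq_zero
      ((((DC x hx t ht).neg.mul (((Da x hx t ht).pow 2).sub_const κ)).add
        (((Da x hx t ht).const_mul 2).mul (Dat x hx t ht))).congr_deriv (by
          simp only [Pi.pow_apply]; ring)) oX (fun s hs => e3 s hs t ht) hx
    linarith [(mul_eq_zero.1 this).resolve_left (neg_ne_zero.2 (hn x hx t ht))]
  have ha0 : ∀ x ∈ X', ∀ t ∈ T', a x t ≠ 0 := fun x hx t ht h0 => by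
    have := hsq x hx t ht
    rw [h0] at this
    exact hκ (by linarith)
  have at0 : ∀ x ∈ X', ∀ t ∈ T', pt a x t = 0 := fun x hx t ht => by
    have := e3 x hx t ht
    rw [hsq x hx t ht] at this
    have h2 : a x t * pt a x t = 0 := by linarith
    exact (mul_eq_zero.1 h2).resolve_left (ha0 x hx t ht)
  have att := pt_eq_zero oT at0
  have e6 : ∀ x ∈ X', ∀ t ∈ T', 2 * a x t * (C x t ^ 2 - pt C x t) - 2 * κ * px C x t = 0 :=
      fun x hx t ht => by
    have := (hS x (hX'X hx) t (hT'T ht)).u1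
    rw [p0 x hx t ht, at0 x hx t ht, att x hx t ht, (hP x (hX'X hx) t (hT'T ht)).1] at this
    linear_combination this
  have Dc : ∀ x ∈ X', ∀ t ∈ T', HasDerivAt (fun s => px C s t) 0 x := fun x hx t ht =>
    (sc'.hasDerivAt_x oX oT hx ht).congr_deriv (hS x (hX'X hx) t (hT'T ht)).pxxC
  have e7 : ∀ x ∈ X', ∀ t ∈ T', 2 * a x t * (2 * C x t * px C x t - pt (px C) x t) = 0 :=
      fun x hx t ht => eq_zero_of_hasDerivAt_of_eq_zero
    (((((Da x hx t ht).const_mul 2).mul (((DC x hx t ht).pow 2).sub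
      (c'.hasDerivAt_pt_x oX oT hx ht))).sub ((Dc x hx t ht).const_mul (2 * κ))).congr_deriv (by
        push_cast; ring)) oX (fun s hs => e6 s hs t ht) hx
  have ct : ∀ x ∈ X', ∀ t ∈ T', pt (px (px C)) x t = 0 :=
    pt_eq_zero oT fun x hx t ht => (hS x (hX'X hx) t (hT'T ht)).pxxC
  have e8 : 4 * a x₀ t₀ * px C x₀ t₀ ^ 2 = 0 := eq_zero_of_hasDerivAt_of_eq_zero
    ((((Da x₀ mx t₀ mt).const_mul 2).mul ((((DC x₀ mx t₀ mt).const_mul 2).mul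
      (Dc x₀ mx t₀ mt)).sub (sc'.hasDerivAt_pt_x oX oT mx mt))).congr_deriv (by
        rw [ct x₀ mx t₀ mt]; ring)) oX (fun s hs => e7 s hs t₀ mt) mx
  have := ha0 x₀ mx t₀ mt
  simp [this, hne] at e8

/-- On a rectangle where `a_x = 0` and `C ≠ 0`, the determining equations lead to
`15 N² + 10 κ N + 7 κ² = 0` for `N = a²`, which has no real solution. -/
theorem px_a_C_contradiction (hX : IsOpen X) (hX'' : X.Nonempty) (hT : IsOpen T)
    (hT'' : T.Nonempty) (hκ : κ ≠ 0) (ha : SmoothOnRect X T a) (hC : SmoothOnRect X T C)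
    (hS : ∀ x ∈ X, ∀ t ∈ T, AffineSystem α β γ κ a A C x t)
    (hR : ∀ x ∈ X, ∀ t ∈ T, ReducedSystem α κ a A C x t)
    (hA : SmoothOnRect X T A)
    (hCx : ∀ x ∈ X, ∀ t ∈ T, px C x t = 0) (p0 : ∀ x ∈ X, ∀ t ∈ T, px a x t = 0)
    (hn : ∀ x ∈ X, ∀ t ∈ T, C x t ≠ 0) : False := by
  have axx := px_eq_zero hX p0
  have e3 : ∀ x ∈ X, ∀ t ∈ T, -C x t * (a x t ^ 2 - κ) + 2 * a x t * pt a x t = 0 :=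
      fun x hx t ht => by
    have := (hR x hx t ht).u2
    rw [p0 x hx t ht] at this
    linear_combination this
  have ha0 : ∀ x ∈ X, ∀ t ∈ T, a x t ≠ 0 := fun x hx t ht h0 => by
    have := e3 x hx t ht
    rw [h0] at this
    have h2 : C x t * κ = 0 := by linear_combination this
    exact (mul_ne_zero (hn x hx t ht) hκ) h2
  have A0 : ∀ x ∈ X, ∀ t ∈ T, A x t = 0 := fun x hx t ht => by
    by_contra hne
    obtain ⟨X', hX'X, T', hT'T, oX, oT, -, -, mx, mt, hAn⟩ :=
      exists_subrect_ne_zero hX hT hA hx ht hne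
    have h1 := (mul_eq_zero.1 (hS x hx t ht).u2_m1).resolve_left hne
    have h2 := e3 x hx t ht
    rw [h1] at h2
    have h3 : a x t * pt a x t = 0 := by linarith
    have h4 := (mul_eq_zero.1 h3).resolve_left (ha0 x hx t ht)
    have h5 := (mul_eq_zero.1 (hS x hx t ht).u1_m1).resolve_left hne
    rw [h4, p0 x hx t ht] at h5
    have h6 : a x t * C x t = 0 := by linarith
    exact mul_ne_zero (ha0 x hx t ht) (hn x hx t ht) h6
  have A4 := px_eq_zero hX (px_eq_zero hX (px_eq_zero hX (px_eq_zero hX A0)))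
  have tC := hC.smooth_pt hX hT
  have Da : ∀ x ∈ X, ∀ t ∈ T, HasDerivAt (fun s => a x s) (pt a x t) t := fun x hx t ht =>
    ha.hasDerivAt_t hX hT hx ht
  have Dat : ∀ x ∈ X, ∀ t ∈ T, HasDerivAt (fun s => pt a x s) (pt (pt a) x t) t :=
    fun x hx t ht => (ha.smooth_pt hX hT).hasDerivAt_t hX hT hx ht
  have DC : ∀ x ∈ X, ∀ t ∈ T, HasDerivAt (fun s => C x s) (pt C x t) t := fun x hx t ht =>
    hC.hasDerivAt_t hX hT hx ht
  have DCt : ∀ x ∈ X, ∀ t ∈ T, HasDerivAt (fun s => pt C x s) (pt (pt C) x t) t :=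
    fun x hx t ht => tC.hasDerivAt_t hX hT hx ht
  have ode : ∀ x ∈ X, ∀ t ∈ T, pt (pt C) x t + C x t * pt C x t - C x t ^ 3 = 0 :=
      fun x hx t ht => by
    have := (hR x hx t ht).u0
    rw [p0 x hx t ht, hCx x hx t ht, A4 x hx t ht] at this
    linear_combination this
  have I1 : ∀ x ∈ X, ∀ t ∈ T, 2 * a x t ^ 2 * (5 * a x t ^ 2 - κ) * pt C x t
      - C x t ^ 2 * (5 * a x t ^ 4 + 2 * κ * a x t ^ 2 + κ ^ 2) = 0 := fun x hx t ht => by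
    have h1 := (hR x hx t ht).u1
    rw [p0 x hx t ht, hCx x hx t ht, axx x hx t ht] at h1
    have h2 := e3 x hx t ht
    have h3 : -pt C x t * (a x t ^ 2 - κ) - C x t * (2 * a x t * pt a x t)
        + (2 * pt a x t * pt a x t + 2 * a x t * pt (pt a) x t) = 0 :=
      eq_zero_of_hasDerivAt_of_eq_zero ((((DC x hx t ht).neg.mul
        (((Da x hx t ht).pow 2).sub_const κ)).add (((Da x hx t ht).const_mul 2).mul
        (Dat x hx t ht))).congr_deriv (by simp only [Pi.pow_apply, Pi.neg_apply]; push_cast; ring))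
        hT (fun s hs => e3 x hx s hs) ht
    linear_combination -4 * a x t ^ 3 * h1 - 2 * a x t ^ 2 * h3
      + (2 * a x t * pt a x t + C x t * (a x t ^ 2 - κ) - 4 * a x t ^ 2 * C x t) * h2
  obtain ⟨x, hx⟩ := hX''
  obtain ⟨t, ht⟩ := hT''
  have I2 : 2 * a x t * pt a x t * (20 * a x t ^ 2 - 2 * κ) * pt C x t
      + 2 * a x t ^ 2 * (5 * a x t ^ 2 - κ) * pt (pt C) x t
      - 2 * C x t * pt C x t * (5 * a x t ^ 4 + 2 * κ * a x t ^ 2 + κ ^ 2)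
      - C x t ^ 2 * (2 * a x t * pt a x t * (10 * a x t ^ 2 + 2 * κ)) = 0 :=
    eq_zero_of_hasDerivAt_of_eq_zero
    (((((((Da x hx t ht).pow 2).const_mul 2).mul ((((Da x hx t ht).pow 2).const_mul 5).sub_const
      κ)).mul (DCt x hx t ht)).sub (((DC x hx t ht).pow 2).mul
      (((((Da x hx t ht).pow 4).const_mul 5).add
        (((Da x hx t ht).pow 2).const_mul (2 * κ))).add_const (κ ^ 2)))).congr_deriv (by
          simp only [Pi.add_apply, Pi.mul_apply, Pi.pow_apply]; push_cast; ring))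
      hT (fun s hs => I1 x hx s hs) ht
  have i1 := I1 x hx t ht
  have i3 := e3 x hx t ht
  have io := ode x hx t ht
  have hc := hn x hx t ht
  have hN := ha0 x hx t ht
  have key : C x t ^ 3 * (4 * κ * a x t ^ 2
      * (15 * a x t ^ 4 + 10 * κ * a x t ^ 2 + 7 * κ ^ 2)) = 0 := by
    linear_combination C x t * ((20 * a x t ^ 2 - 2 * κ) * (a x t ^ 2 - κ)
      - 2 * a x t ^ 2 * (5 * a x t ^ 2 - κ)
      - 2 * (5 * a x t ^ 4 + 2 * κ * a x t ^ 2 + κ ^ 2)) * i1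
      - 2 * a x t ^ 2 * (5 * a x t ^ 2 - κ) * (I2
        - ((20 * a x t ^ 2 - 2 * κ) * pt C x t - C x t ^ 2 * (10 * a x t ^ 2 + 2 * κ)) * i3
        - 2 * a x t ^ 2 * (5 * a x t ^ 2 - κ) * io)
  have hpos : 0 < 15 * a x t ^ 4 + 10 * κ * a x t ^ 2 + 7 * κ ^ 2 := by
    have : 0 < κ ^ 2 := by positivity
    nlinarith [sq_nonneg (3 * a x t ^ 2 + 5 / 3 * κ)]
  exact mul_ne_zero (pow_ne_zero 3 hc) (mul_ne_zero (mul_ne_zero (mul_ne_zero four_ne_zero hκ)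
    (pow_ne_zero 2 hN)) hpos.ne') key

end KappaNonzero

/-! ### Classification for `κ ≠ 0` -/

section KappaNonzeroClassification

variable {X T U : Set ℝ} {α β γ κ : ℝ} {a A C f : ℝ → ℝ → ℝ} {ξ φ : ℝ → ℝ → ℝ → ℝ}

theorem exists_eq_const_on_rect (hX : IsOpen X) (hX' : IsPreconnected X) (hT : IsOpen T)
    (hT' : IsPreconnected T) (h1 : ∀ x ∈ X, ∀ t ∈ T, HasDerivAt (fun s => f s t) 0 x)
    (h2 : ∀ x ∈ X, ∀ t ∈ T, HasDerivAt (fun s => f x s) 0 t) :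
    ∃ c, ∀ x ∈ X, ∀ t ∈ T, f x t = c := by
  by_cases h : X.Nonempty ∧ T.Nonempty
  · obtain ⟨⟨x₀, hx₀⟩, t₀, ht₀⟩ := h
    exact ⟨f x₀ t₀, fun x hx t ht =>
      (eq_of_hasDerivAt_zero hX hX' (f := fun s => f s t) (fun s hs => h1 s hs t ht) hx hx₀).trans
      (eq_of_hasDerivAt_zero hT hT' (f := fun s => f x₀ s) (fun s hs => h2 x₀ hx₀ s hs) ht ht₀)⟩
  · exact ⟨0, fun x hx t ht => (h ⟨⟨x, hx⟩, t, ht⟩).elim⟩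

/-- A solution of `f_t = s f_x` that is a cubic polynomial in `x` is a cubic polynomial in
`x + s t`. -/
theorem exists_eq_cubic_of_transport (hX : IsOpen X) (hX' : IsPreconnected X) (hT : IsOpen T)
    (hT' : IsPreconnected T) (hf : SmoothOnRect X T f) {s : ℝ}
    (ht : ∀ x ∈ X, ∀ t ∈ T, pt f x t = s * px f x t)
    (h4 : ∀ x ∈ X, ∀ t ∈ T, px (px (px (px f))) x t = 0) :
    ∃ c₀ c₁ c₂ c₃ : ℝ, ∀ x ∈ X, ∀ t ∈ T, f x t = phiTwo s c₀ c₁ c₂ c₃ x t 0 := by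
  have s1 := hf.smooth_px hX hT
  have s2 := s1.smooth_px hX hT
  have s3 := s2.smooth_px hX hT
  have step : ∀ {f : ℝ → ℝ → ℝ}, SmoothOnRect X T f →
      (∀ x ∈ X, ∀ t ∈ T, pt f x t = s * px f x t) →
      ∀ x ∈ X, ∀ t ∈ T, pt (px f) x t = s * px (px f) x t := fun {f} hf h x hx t ht => by
    rw [hf.pt_px hX hT hx ht, px_congr hX h x hx t ht]
    exact px_fun_t_mul (fun _ => s) (px f) ▸ rfl
  have t1 := step hf ht
  have t2 := step s1 t1
  have t3 := step s2 t2
  -- subtracting a primitive of the next derivative leaves a constant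
  have red : ∀ {f : ℝ → ℝ → ℝ} {P p : ℝ → ℝ}, SmoothOnRect X T f →
      (∀ x ∈ X, ∀ t ∈ T, pt f x t = s * px f x t) → (∀ y, HasDerivAt P (p y) y) →
      (∀ x ∈ X, ∀ t ∈ T, px f x t = p (x + s * t)) →
      ∃ c, ∀ x ∈ X, ∀ t ∈ T, f x t = P (x + s * t) + c := by
    intro f P p hf h hP hp
    obtain ⟨c, hc⟩ := exists_eq_const_on_rect (f := fun x t => f x t - P (x + s * t)) hX hX' hT hT'
      (fun x hx t ht => ((hf.hasDerivAt_x hX hT hx ht).sub ((hP _).comp x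
        ((hasDerivAt_id x).add_const (s * t)))).congr_deriv (by rw [hp x hx t ht]; simp))
      (fun x hx t ht => ((hf.hasDerivAt_t hX hT hx ht).sub ((hP _).comp t
        (((hasDerivAt_id t).const_mul s).const_add x))).congr_deriv (by
          rw [h x hx t ht, hp x hx t ht]; simp only [id]; ring))
    exact ⟨c, fun x hx t ht => by linarith [hc x hx t ht]⟩
  have P : ∀ (n : ℕ) (b x : ℝ), HasDerivAt (fun x => b * x ^ n) (b * (n * x ^ (n - 1))) x :=
    fun n b x => (hasDerivAt_pow n x).const_mul b
  obtain ⟨d₃, e3⟩ := red (P := fun _ => 0) (p := fun _ => 0) s3 t3 (fun y => hasDerivAt_const y 0) h4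
  obtain ⟨d₂, e2⟩ := red s2 t2 (p := fun _ => 0 + d₃)
    (fun y => (P 1 d₃ y).congr_deriv (by norm_num)) e3
  obtain ⟨d₁, e1⟩ := red s1 t1 (p := fun y => d₃ * y ^ 1 + d₂)
    (fun y => ((P 2 (d₃ / 2) y).add (P 1 d₂ y)).congr_deriv (by norm_num; ring)) e2
  obtain ⟨d₀, e0⟩ := red hf ht (p := fun y => d₃ / 2 * y ^ 2 + d₂ * y ^ 1 + d₁)
    (fun y => ((P 3 (d₃ / 6) y).add ((P 2 (d₂ / 2) y).add (P 1 d₁ y))).congr_deriv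
      (by norm_num; ring)) e1
  refine ⟨d₀, d₁, d₂ / 2, d₃ / 6, fun x hx t ht => ?_⟩
  rw [e0 x hx t ht, phiTwo]
  simp only [Pi.add_apply]
  ring

/-- The classification for `κ ≠ 0`. -/
theorem classification_kappa_ne_zero (hX : IsOpen X) (hX' : IsPreconnected X) (hX'' : X.Nonempty)
    (hT : IsOpen T) (hT' : IsPreconnected T) (hU : IsOpen U) (hκ : κ ≠ 0)
    (ha : SmoothOnRect X T a) (hA : SmoothOnRect X T A) (hC : SmoothOnRect X T C)
    (h1 : EqOnBox X T U ξ (constU a)) (h2 : EqOnBox X T U φ (affineU A C))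
    (hS : ∀ x ∈ X, ∀ t ∈ T, AffineSystem α β γ κ a A C x t)
    (hcl : ¬ IsClassicalUpToFactor α β γ κ 0 X T U ξ φ) :
    ∃ s c₀ c₁ c₂ c₃, KindTwo α β γ κ X T U ξ φ s c₀ c₁ c₂ c₃ ∧
      ¬ (c₀ = 0 ∧ c₁ = 0 ∧ c₂ = 0 ∧ c₃ = 0) := by
  have hR := reducedSystem_of_affineSystem hX hT ha hA hC hS
  have s1 := ha.smooth_px hX hT
  have hCx := px_C_eq_zero_of_kappa_ne hX hX' hT hκ ha hC hR
  have hP := u2_polynomial hX hX' hT hκ ha hC hR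
  have hq : ∀ x ∈ X, ∀ t ∈ T, C x t - 2 * px a x t = 0 := fun x hx t ht => by
    by_contra hne
    obtain ⟨X', hX'X, T', hT'T, oX, oT, -, -, mx, mt, hn⟩ := exists_subrect_ne_zero hX hT
      (f := fun x t => C x t - 2 * px a x t) (hC.sub (contDiffOn_const.mul s1)) hx ht hne
    have p0 : ∀ x ∈ X', ∀ t ∈ T', px a x t = 0 := fun x hx t ht =>
      (mul_eq_zero.1 (hP x (hX'X hx) t (hT'T ht)).2.1).resolve_right (hn x hx t ht)
    refine px_a_C_contradiction oX ⟨x, mx⟩ oT ⟨t, mt⟩ hκ (ha.mono hX'X hT'T) (hC.mono hX'X hT'T)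
      (fun x hx t ht => hS x (hX'X hx) t (hT'T ht)) (fun x hx t ht => hR x (hX'X hx) t (hT'T ht))
      (hA.mono hX'X hT'T) (fun x hx t ht => hCx x (hX'X hx) t (hT'T ht)) p0
      fun x hx t ht h0 => hn x hx t ht ?_
    rw [h0, p0 x hx t ht]
    ring
  have hat : ∀ x ∈ X, ∀ t ∈ T, pt a x t + a x t * px a x t = 0 := by
    refine eq_zero_of_mul_eq_zero_on_rect (f := a) hX hT ((ha.smooth_pt hX hT).add (ha.mul s1))
      (fun x hx t ht => ?_) fun X' _ T' _ _ hT' h x hx t ht => ?_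
    · linear_combination (hR x hx t ht).u2 / 2
        + (a x t ^ 2 - κ) / 2 * hq x hx t ht
    · rw [pt_eq_zero hT' h x hx t ht, h x hx t ht]
      ring
  have hpt : ∀ x ∈ X, ∀ t ∈ T, pt (px a) x t + px a x t * px a x t = 0 := fun x hx t ht =>
    eq_zero_of_hasDerivAt_of_eq_zero (((ha.hasDerivAt_pt_x hX hT hx ht).add
      ((ha.hasDerivAt_x hX hT hx ht).mul (s1.hasDerivAt_x hX hT hx ht))).congr_deriv (by
        rw [(hP x hx t ht).1]; ring)) hX (fun s hs => hat s hs t ht) hx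
  obtain ⟨x₀, hx₀⟩ := hX''
  have hp : ∀ x ∈ X, ∀ t ∈ T, px a x t = px a x₀ t := fun x hx t ht =>
    eq_of_hasDerivAt_zero hX hX' (f := fun x => px a x t) (fun x hx =>
      (s1.hasDerivAt_x hX hT hx ht).congr_deriv (hP x hx t ht).1) hx hx₀
  have sm : ContDiffOn ℝ ∞ (fun t => -px a x₀ t) T := (s1.slice_t hx₀).neg
  by_cases hA0 : ∀ x ∈ X, ∀ t ∈ T, A x t = 0
  · exfalso
    have h2' : EqOnBox X T U φ (affineU (fun _ _ => 0) C) := fun x hx t ht u hu => by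
      rw [h2 x hx t ht u hu, affineU, affineU, hA0 x hx t ht]
    refine hcl (isClassicalUpToFactor_of_affineSystem hX hT hT' hU ha hC h1 h2' sm (fun t ht => ?_)
      (fun x hx t ht => ?_) (fun x hx t ht => ?_) (fun x hx t ht => ?_) hS)
    · refine (s1.hasDerivAt_t hX hT hx₀ ht).neg.congr_deriv ?_
      linear_combination -hpt x₀ hx₀ t ht
    · rw [← hp x hx t ht]
      linear_combination hat x hx t ht
    · rw [← hp x hx t ht]
      linear_combination hq x hx t ht
    · rw [← hp x hx t ht]
      ring
  push Not at hA0
  obtain ⟨x₁, hx₁, t₁, ht₁, hne⟩ := hA0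
  have hα : α = 0 := (mul_eq_zero.1 (hS x₁ hx₁ t₁ ht₁).u1u3).resolve_right hne
  have hβ : β = 0 := (mul_eq_zero.1 (hS x₁ hx₁ t₁ ht₁).u2u2).resolve_right hne
  have hγ : γ = 0 := (mul_eq_zero.1 (hS x₁ hx₁ t₁ ht₁).u1u1_m1).resolve_right hne
  have hsq := (mul_eq_zero.1 (hS x₁ hx₁ t₁ ht₁).u2_m1).resolve_left hne
  have ha1 : a x₁ t₁ ≠ 0 := fun h => hκ (by rw [h] at hsq; linarith)
  obtain ⟨X', hX'X, T', hT'T, oX, oT, -, -, mx, mt, hn⟩ :=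
    exists_subrect_ne_zero hX hT hA hx₁ ht₁ hne
  have p1 : px a x₁ t₁ = 0 := by
    have : 2 * a x₁ t₁ * px a x₁ t₁ = 0 := eq_zero_of_hasDerivAt_of_eq_zero
      ((((ha.hasDerivAt_x hX hT hx₁ ht₁).pow 2).sub_const κ).congr_deriv (by push_cast; ring)) oX
      (fun s hs => (mul_eq_zero.1 (hS s (hX'X hs) t₁ ht₁).u2_m1).resolve_left (hn s hs t₁ mt)) mx
    simpa [ha1] using this
  have p0 : ∀ x ∈ X, ∀ t ∈ T, px a x t = 0 := fun x hx t ht => by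
    rw [hp x hx t ht]
    refine eq_zero_of_linear_ode hT hT' sm (y := fun t => px a x₀ t) (fun t ht => ?_) ht₁
      ((hp x₁ hx₁ t₁ ht₁).symm.trans p1) t ht
    refine (s1.hasDerivAt_t hX hT hx₀ ht).congr_deriv ?_
    linear_combination hpt x₀ hx₀ t ht
  have at0 : ∀ x ∈ X, ∀ t ∈ T, pt a x t = 0 := fun x hx t ht => by
    have := hat x hx t ht
    rw [p0 x hx t ht] at this
    linarith
  obtain ⟨s, hs⟩ := exists_eq_const_on_rect (f := a) hX hX' hT hT'
    (fun x hx t ht => (ha.hasDerivAt_x hX hT hx ht).congr_deriv (p0 x hx t ht))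
    (fun x hx t ht => (ha.hasDerivAt_t hX hT hx ht).congr_deriv (at0 x hx t ht))
  have C0 : ∀ x ∈ X, ∀ t ∈ T, C x t = 0 := fun x hx t ht => by
    have := hq x hx t ht
    rw [p0 x hx t ht] at this
    linarith
  have hAt : ∀ x ∈ X, ∀ t ∈ T, pt A x t - s * px A x t = 0 := by
    refine eq_zero_of_mul_eq_zero_on_rect (f := A) hX hT ((hA.smooth_pt hX hT).sub
      (contDiffOn_const.mul (hA.smooth_px hX hT)))
      (fun x hx t ht => ?_) fun X' _ T' _ hX' hT' h x hx t ht => ?_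
    · have := (hS x hx t ht).u0_m1
      rw [C0 x hx t ht, hs x hx t ht] at this
      linear_combination this
    · rw [pt_eq_zero hT' h x hx t ht, px_eq_zero hX' h x hx t ht]
      ring
  have A4 : ∀ x ∈ X, ∀ t ∈ T, px (px (px (px A))) x t = 0 := fun x hx t ht => by
    have := (hR x hx t ht).u0
    rw [C0 x hx t ht, p0 x hx t ht, at0 x hx t ht, pt_eq_zero hT C0 x hx t ht,
      pt_eq_zero hT (pt_eq_zero hT C0) x hx t ht] at this
    linear_combination -this
  obtain ⟨c₀, c₁, c₂, c₃, hc⟩ := exists_eq_cubic_of_transport hX hX' hT hT' hA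
    (fun x hx t ht => sub_eq_zero.1 (hAt x hx t ht)) A4
  refine ⟨s, c₀, c₁, c₂, c₃, ⟨hα, hβ, hγ, ?_, fun x hx t ht u hu => ⟨?_, ?_⟩⟩, ?_⟩
  · rw [← hs x₁ hx₁ t₁ ht₁]
    linarith
  · rw [h1 x hx t ht u hu, constU, hs x hx t ht]
  · rw [h2 x hx t ht u hu, affineU, C0 x hx t ht, hc x hx t ht]
    simp [phiTwo]
  · rintro ⟨r0, r1, r2, r3⟩
    refine hne ?_
    rw [hc x₁ hx₁ t₁ ht₁, r0, r1, r2, r3, phiTwo]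
    ring

end KappaNonzeroClassification

/-! ### The three families of infinitesimals -/

section Families

variable {X T U : Set ℝ} {α β γ κ : ℝ} {ξ φ : ℝ → ℝ → ℝ → ℝ}

theorem px_fun_t (f : ℝ → ℝ) : px (fun _ t => f t) = fun _ _ => 0 := by
  funext x t
  simp [px]

theorem pt_fun_t (f : ℝ → ℝ) : pt (fun _ t => f t) = fun _ t => deriv f t := rfl

theorem deriv_fun_zero : deriv (fun _ : ℝ => (0 : ℝ)) = fun _ => 0 := by
  funext x
  simp

theorem isNonclassicalSymmetry_of_kindOne (hX : IsOpen X) (hT : IsOpen T) (hU : IsOpen U)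
    {g : ℝ → ℝ} (h : KindOne κ X T U ξ φ g) : IsNonclassicalSymmetry α β γ κ 0 X T U ξ φ := by
  obtain ⟨rfl, hg, hode, hξφ⟩ := h
  have s0 : SmoothOnRect X T (fun _ _ => (0 : ℝ)) := contDiffOn_const
  refine isNonclassicalSymmetry_of_affineSystem (a := fun _ _ => 0) (A := fun _ _ => 0)
    (C := fun _ t => g t) hX hT hU s0 s0 (smooth_fun_t hg)
    (fun x hx t ht u hu => (hξφ x hx t ht u hu).1)
    (fun x hx t ht u hu => (hξφ x hx t ht u hu).2.trans (zero_add _).symm) fun x hx t ht => ?_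
  have h2 := hode t ht
  simp only [iteratedDeriv_succ, iteratedDeriv_zero] at h2
  constructor
  all_goals try simp only [px_fun_t, pt_fun_t, deriv_fun_zero]
  case u0_1 => linear_combination h2
  all_goals ring

theorem isNonclassicalSymmetry_of_kindTwo (hX : IsOpen X) (hT : IsOpen T) (hU : IsOpen U)
    {s c₀ c₁ c₂ c₃ : ℝ} (h : KindTwo α β γ κ X T U ξ φ s c₀ c₁ c₂ c₃) :
    IsNonclassicalSymmetry α β γ κ 0 X T U ξ φ := by
  obtain ⟨rfl, rfl, rfl, rfl, hξφ⟩ := h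
  have s0 : ∀ c : ℝ, SmoothOnRect X T (fun _ _ => c) := fun _ => contDiffOn_const
  have hA : SmoothOnRect X T (fun x t => phiTwo s c₀ c₁ c₂ c₃ x t 0) := by
    refine ContDiff.contDiffOn ?_
    simp only [phiTwo]
    fun_prop
  refine isNonclassicalSymmetry_of_affineSystem (a := fun _ _ => s)
    (A := fun x t => phiTwo s c₀ c₁ c₂ c₃ x t 0) (C := fun _ _ => 0) hX hT hU (s0 s) hA (s0 0)
    (fun x hx t ht u hu => (hξφ x hx t ht u hu).1)
    (fun x hx t ht u hu => (hξφ x hx t ht u hu).2.trans ?_) fun x hx t ht => ?_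
  · simp [affineU, phiTwo]
  have dx : ∀ x t : ℝ, HasDerivAt (fun x => x + s * t) 1 x := fun x t =>
    (hasDerivAt_id x).add_const _
  have dt : ∀ x t : ℝ, HasDerivAt (fun t => x + s * t) s t := fun x t =>
    (((hasDerivAt_id t).const_mul s).const_add x).congr_deriv (mul_one s)
  have hp : ∀ c₀ c₁ c₂ c₃ : ℝ, px (fun x t => phiTwo s c₀ c₁ c₂ c₃ x t 0)
      = fun x t => phiTwo s c₁ (2 * c₂) (3 * c₃) 0 x t 0 := fun c₀ c₁ c₂ c₃ => by
    funext x t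
    refine ((((((dx x t).pow 3).const_mul c₃).add (((dx x t).pow 2).const_mul c₂)).add
      ((dx x t).const_mul c₁)).add_const c₀).deriv.trans ?_
    simp only [phiTwo]
    push_cast
    ring
  have ht' : ∀ c₀ c₁ c₂ c₃ : ℝ, pt (fun x t => phiTwo s c₀ c₁ c₂ c₃ x t 0)
      = fun x t => phiTwo s (s * c₁) (s * (2 * c₂)) (s * (3 * c₃)) 0 x t 0 :=
      fun c₀ c₁ c₂ c₃ => by
    funext x t
    refine ((((((dt x t).pow 3).const_mul c₃).add (((dt x t).pow 2).const_mul c₂)).add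
      ((dt x t).const_mul c₁)).add_const c₀).deriv.trans ?_
    simp only [phiTwo]
    push_cast
    ring
  have pc : pt (fun _ _ => s) = fun _ _ => 0 := by
    funext x t
    simp [pt]
  constructor
  all_goals try simp only [hp, ht', px_fun_t, pc, pt_zero]
  all_goals try simp only [phiTwo]
  all_goals ring

theorem contDiff_quartic (c₀ c₁ c₂ c₃ c₄ : ℝ) : ContDiff ℝ ∞ (quartic c₀ c₁ c₂ c₃ c₄) := by
  unfold quartic
  fun_prop

theorem isNonclassicalSymmetry_of_kindThree (hX : IsOpen X) (hT : IsOpen T) (hU : IsOpen U)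
    {g : ℝ → ℝ} {c₀ c₁ c₂ c₃ c₄ : ℝ} (h : KindThree α β γ κ X T U ξ φ g c₀ c₁ c₂ c₃ c₄) :
    IsNonclassicalSymmetry α β γ κ 0 X T U ξ φ := by
  obtain ⟨rfl, rfl, rfl, rfl, hg, hg0, hode, hξφ⟩ := h
  have s0 : SmoothOnRect X T (fun _ _ => (0 : ℝ)) := contDiffOn_const
  have sQ : SmoothOnRect X T (fun x _ => quartic c₀ c₁ c₂ c₃ c₄ x) :=
    smooth_fun_x (contDiff_quartic ..).contDiffOn
  have sg' := smooth_deriv hT hg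
  have sC : ContDiffOn ℝ ∞ (fun t => -(deriv g t / g t)) T := (sg'.div hg hg0).neg
  have hA : SmoothOnRect X T (fun x t => g t * quartic c₀ c₁ c₂ c₃ c₄ x) :=
    (smooth_fun_t hg).mul sQ
  refine isNonclassicalSymmetry_of_affineSystem (a := fun _ _ => 0)
    (A := fun x t => g t * quartic c₀ c₁ c₂ c₃ c₄ x) (C := fun _ t => -(deriv g t / g t)) hX hT hU
    s0 hA (smooth_fun_t sC) (fun x hx t ht u hu => (hξφ x hx t ht u hu).1)
    (fun x hx t ht u hu => (hξφ x hx t ht u hu).2.trans ?_) fun x hx t ht => ?_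
  · simp only [affineU, phiThree]
    ring
  have dg : ∀ t ∈ T, HasDerivAt g (-(-(deriv g t / g t)) * g t) t := fun t ht =>
    (smooth_hasDerivAt hT hg ht).congr_deriv (by field_simp [hg0 t ht])
  have hlog := (solvesOdeThree_iff hT sC dg hg0).1 hode t ht
  have hC' : deriv (fun t => -(deriv g t / g t)) t
      = -(deriv (deriv g) t * g t - deriv g t * deriv g t) / g t ^ 2 := by
    refine ((smooth_hasDerivAt hT sg' ht).div (smooth_hasDerivAt hT hg ht)
      (hg0 t ht)).neg.deriv.trans ?_
    ring
  have d1 : ∀ Q : ℝ → ℝ, px (fun x t => g t * Q x) = fun x t => g t * deriv Q x := fun Q =>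
    px_fun_t_mul g (fun x _ => Q x)
  have d2 : ∀ (f : ℝ → ℝ) (Q : ℝ → ℝ), pt (fun x t => f t * Q x) = fun x t => deriv f t * Q x :=
    fun f Q => by
      funext x t
      exact deriv_mul_const_field _
  have Q4 : deriv (deriv (deriv (deriv fun x => quartic c₀ c₁ c₂ c₃ c₄ x))) x = 24 * c₄ := by
    have P : ∀ c₀ c₁ c₂ c₃ c₄ : ℝ, deriv (fun x => quartic c₀ c₁ c₂ c₃ c₄ x)
        = fun x => quartic c₁ (2 * c₂) (3 * c₃) (4 * c₄) 0 x := fun c₀ c₁ c₂ c₃ c₄ => by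
      funext x
      refine ((((((hasDerivAt_pow 4 x).const_mul c₄).add ((hasDerivAt_pow 3 x).const_mul c₃)).add
        ((hasDerivAt_pow 2 x).const_mul c₂)).add ((hasDerivAt_id x).const_mul c₁)).add_const
        c₀).deriv.trans ?_
      simp only [quartic]
      push_cast
      ring
    simp only [P]
    simp only [quartic]
    ring
  have hg0' := hg0 t ht
  constructor
  all_goals try simp only [d1, d2, px_fun_t, pt_fun_t, deriv_fun_zero]
  case u0_1 =>
    rw [Q4]
    linear_combination hlog
  case u0_m1 =>
    field_simp
    ring
  case u0_0 =>
    rw [hC']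
    field_simp
    ring
  all_goals ring

/-- Two distinct values of `u` determine a relation that is affine in `u`. -/
theorem eq_zero_of_affine_on_isOpen (hU : IsOpen U) (hU'' : U.Nonempty) {p q : ℝ}
    (h : ∀ u ∈ U, p + q * u = 0) : p = 0 ∧ q = 0 := by
  obtain ⟨u, hu⟩ := hU''
  obtain ⟨h0, h1, -⟩ := coeffs_eq_zero_of_infinite (hU.infinite_of_mem hu) (a₀ := p) (a₁ := q)
    (a₂ := 0) (a₃ := 0) (a₄ := 0) (a₅ := 0) (a₆ := 0) (a₇ := 0) (a₈ := 0)
    fun u hu => by linear_combination h u hu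
  exact ⟨h0, h1⟩

theorem not_isClassicalUpToFactor_of_kindOne (hX : IsOpen X) (hX' : IsPreconnected X)
    (hX'' : X.Nonempty) (hT : IsOpen T) (hU : IsOpen U)
    (hU' : IsPreconnected U) (hU'' : U.Nonempty) (hφs : SmoothOnBox X T U φ)
    {g : ℝ → ℝ} (h : KindOne κ X T U ξ φ g) (hne : ∃ t ∈ T, 2 * deriv g t ≠ g t ^ 2) :
    ¬ IsClassicalUpToFactor α β γ κ 0 X T U ξ φ := by
  obtain ⟨-, hg, -, hξφ⟩ := h
  intro hcl
  obtain ⟨τ, hτ, hτ0, hτφ, hττ⟩ := hcl.exists_affine_factor hX hX' hX'' hT hU hU' hU''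
    (fun x hx t ht u hu => (hξφ x hx t ht u hu).1) hφs
  obtain ⟨t, ht, hne⟩ := hne
  obtain ⟨x₀, hx₀⟩ := hX''
  have key : ∀ t ∈ T, τ t * g t + 2 * deriv τ t = 0 := fun t ht =>
    (eq_zero_of_affine_on_isOpen (p := 0) hU hU'' fun u hu => by
      have h1 := hτφ x₀ hx₀ t ht u hu
      rw [(hξφ x₀ hx₀ t ht u hu).2, phiOne] at h1
      linear_combination h1).2
  have h1 := eq_zero_of_hasDerivAt_of_eq_zero (((smooth_hasDerivAt hT hτ ht).mul
    (smooth_hasDerivAt hT hg ht)).add ((hττ t ht).const_mul 2)) hT key ht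
  have h2 : τ t * (2 * deriv g t - g t ^ 2) = 0 := by
    linear_combination 2 * h1 - g t * key t ht
  exact hne (sub_eq_zero.1 ((mul_eq_zero.1 h2).resolve_left (hτ0 t ht)))

theorem not_isClassicalUpToFactor_of_kindTwo (hX : IsOpen X) (hX' : IsPreconnected X)
    (hX'' : X.Nonempty) (hT : IsOpen T) (hT'' : T.Nonempty) (hU : IsOpen U)
    (hU' : IsPreconnected U) (hU'' : U.Nonempty) (hφs : SmoothOnBox X T U φ)
    {s c₀ c₁ c₂ c₃ : ℝ} (h : KindTwo α β γ κ X T U ξ φ s c₀ c₁ c₂ c₃)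
    (hne : ¬ (c₀ = 0 ∧ c₁ = 0 ∧ c₂ = 0 ∧ c₃ = 0)) :
    ¬ IsClassicalUpToFactor α β γ κ 0 X T U ξ φ := by
  obtain ⟨-, -, -, -, hξφ⟩ := h
  intro hcl
  obtain ⟨τ, hτ, hτ0, hτφ, hττ⟩ := hcl.exists_affine_factor hX hX' hX'' hT hU hU' hU''
    (fun x hx t ht u hu => (hξφ x hx t ht u hu).1) hφs
  obtain ⟨x₀, hx₀⟩ := hX''
  obtain ⟨t, ht⟩ := hT''
  obtain ⟨h0, h1, h2, h3, -⟩ := coeffs_eq_zero_of_infinite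
    ((hX.infinite_of_mem hx₀).image ((add_left_injective (s * t)).injOn)) (a₀ := c₀) (a₁ := c₁)
    (a₂ := c₂) (a₃ := c₃) (a₄ := 0) (a₅ := 0) (a₆ := 0) (a₇ := 0) (a₈ := 0) (by
      rintro y ⟨x, hx, rfl⟩
      have := (eq_zero_of_affine_on_isOpen (p := τ t * phiTwo s c₀ c₁ c₂ c₃ x t 0)
        (q := 2 * deriv τ t) hU hU'' fun u hu => by
          have h1 := hτφ x hx t ht u hu
          rw [(hξφ x hx t ht u hu).2] at h1
          simp only [phiTwo] at h1 ⊢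
          linear_combination h1).1
      have := (mul_eq_zero.1 this).resolve_left (hτ0 t ht)
      simp only [phiTwo] at this
      linear_combination this)
  exact hne ⟨h0, h1, h2, h3⟩

theorem not_isClassicalUpToFactor_of_kindThree (hX : IsOpen X) (hX' : IsPreconnected X)
    (hX'' : X.Nonempty) (hT : IsOpen T) (hT'' : T.Nonempty) (hU : IsOpen U)
    (hU' : IsPreconnected U) (hU'' : U.Nonempty) (hφs : SmoothOnBox X T U φ)
    {g : ℝ → ℝ} {c₀ c₁ c₂ c₃ c₄ : ℝ} (h : KindThree α β γ κ X T U ξ φ g c₀ c₁ c₂ c₃ c₄)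
    (hne : ¬ (c₀ = 0 ∧ c₁ = 0 ∧ c₂ = 0 ∧ c₃ = 0 ∧ c₄ = 0)) :
    ¬ IsClassicalUpToFactor α β γ κ 0 X T U ξ φ := by
  obtain ⟨-, -, -, -, -, hg0, -, hξφ⟩ := h
  intro hcl
  obtain ⟨τ, hτ, hτ0, hτφ, hττ⟩ := hcl.exists_affine_factor hX hX' hX'' hT hU hU' hU''
    (fun x hx t ht u hu => (hξφ x hx t ht u hu).1) hφs
  obtain ⟨x₀, hx₀⟩ := hX''
  obtain ⟨t, ht⟩ := hT''
  obtain ⟨h0, h1, h2, h3, h4, -⟩ := coeffs_eq_zero_of_infinite (hX.infinite_of_mem hx₀)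
    (a₀ := c₀) (a₁ := c₁) (a₂ := c₂) (a₃ := c₃) (a₄ := c₄) (a₅ := 0) (a₆ := 0) (a₇ := 0)
    (a₈ := 0) (fun x hx => by
      have := (eq_zero_of_affine_on_isOpen (p := τ t * (g t * quartic c₀ c₁ c₂ c₃ c₄ x))
        (q := 2 * deriv τ t - τ t * (deriv g t / g t)) hU hU'' fun u hu => by
          have h1 := hτφ x hx t ht u hu
          rw [(hξφ x hx t ht u hu).2, phiThree] at h1
          linear_combination h1).1
      have := (mul_eq_zero.1 ((mul_eq_zero.1 this).resolve_left (hτ0 t ht))).resolve_left (hg0 t ht)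
      rw [quartic] at this
      linear_combination this)
  exact hne ⟨h0, h1, h2, h3, h4⟩

end Families

/-! ### Invariant solutions -/

section InvariantSolutions

variable {X T I : Set ℝ} {α β γ κ : ℝ}

/-- If two continuous functions on an interval have product zero and no common zero, one of them
vanishes identically. -/
theorem eq_zero_or_eq_zero_of_mul_eq_zero {f h : ℝ → ℝ} (hI : IsOpen I) (hI' : IsPreconnected I)
    (hf : ContinuousOn f I) (hh : ContinuousOn h I) (hfh : ∀ t ∈ I, f t * h t = 0)
    (hne : ∀ t ∈ I, f t = 0 → h t ≠ 0) : (∀ t ∈ I, f t = 0) ∨ ∀ t ∈ I, h t = 0 := by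
  by_contra hcon
  push Not at hcon
  obtain ⟨⟨s, hs, hfs⟩, r, hr, hhr⟩ := hcon
  obtain ⟨t, ht, ⟨-, hft⟩, -, hht⟩ := hI' _ _ (hf.isOpen_inter_preimage hI isOpen_ne)
    (hh.isOpen_inter_preimage hI isOpen_ne) (fun t ht => by
      by_cases h0 : f t = 0
      · exact Or.inr ⟨ht, hne t ht h0⟩
      · exact Or.inl ⟨ht, h0⟩) ⟨s, hs, hs, hfs⟩ ⟨r, hr, hr, hhr⟩
  exact (mul_ne_zero hft hht) (hfh t ht)

theorem isInvariantSolution_iff {ξ φ : ℝ → ℝ → ℝ → ℝ} {u : ℝ → ℝ → ℝ} :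
    IsInvariantSolution α β γ κ 0 X T ξ φ u ↔ ∀ x ∈ X, ∀ t ∈ T,
      (pt (pt u) x t - (κ * px (px u) x t + 2 * γ * (u x t * px (px u) x t + px u x t ^ 2))
        - u x t * px (px (px (px u))) x t - α * (px u x t * px (px (px u)) x t)
        - β * px (px u) x t ^ 2 = 0) ∧
      ξ x t (u x t) * px u x t + pt u x t = φ x t (u x t) := by
  have e : ∀ x t, (jetOf u x t).u 0 0 = u x t ∧ (jetOf u x t).u 1 0 = px u x t ∧
      (jetOf u x t).u 2 0 = px (px u) x t ∧ (jetOf u x t).u 3 0 = px (px (px u)) x t ∧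
      (jetOf u x t).u 4 0 = px (px (px (px u))) x t ∧ (jetOf u x t).u 0 1 = pt u x t ∧
      (jetOf u x t).u 0 2 = pt (pt u) x t := fun x t => by
    refine ⟨?_, ?_, ?_, ?_, ?_, ?_, ?_⟩ <;>
      simp only [jetOf, Jet.u, iteratedDeriv_succ, iteratedDeriv_zero] <;> rfl
  refine forall₂_congr fun x _ => forall₂_congr fun t _ => ?_
  obtain ⟨e0, e1, e2, e3, e4, f1, f2⟩ := e x t
  have ex : (jetOf u x t).x = x := rfl
  have et : (jetOf u x t).t = t := rfl
  simp only [Delta, PointField.surface, PointField.unitTau, e0, e1, e2, e3, e4, f1, f2, ex, et]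
  refine and_congr ⟨fun h => by linear_combination h, fun h => by linear_combination h⟩
    ⟨fun h => by linear_combination h, fun h => by linear_combination h⟩

theorem px_mul_fun_t (w ψ : ℝ → ℝ) : px (fun x t => w x * ψ t) = fun x t => deriv w x * ψ t := by
  funext x t
  exact deriv_mul_const_field _

theorem pt_fun_x_mul (w ψ : ℝ → ℝ) : pt (fun x t => w x * ψ t) = fun x t => w x * deriv ψ t := by
  funext x t
  exact deriv_const_mul_field _

end InvariantSolutions

/-! ### First reduction -/

section FirstReduction

variable {X T : Set ℝ} {α β γ : ℝ} {g ψ : ℝ → ℝ} {c₁ c₂ : ℝ}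

namespace IsLogPrimitive

theorem deriv_eq (h : IsLogPrimitive T g ψ c₁ c₂) {t : ℝ} (ht : t ∈ T) :
    deriv ψ t = g t * ψ t := by
  obtain ⟨h0, h1, -⟩ := h.2 t ht
  rw [h1, div_mul_cancel₀ _ h0]

/-- The second order equation for `ψ`. Differentiation of the first order equation yields it only
where `ψ' ≠ 0`; it extends to all of `T` because `ψ'' = 0` and `ψ'' = 6 c₁ ψ²` exclude each other
when `c₁ ≠ 0`. -/
theorem deriv_deriv_eq (hT : IsOpen T) (hT' : IsPreconnected T) (hg0 : ∃ t ∈ T, g t ≠ 0)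
    (h : IsLogPrimitive T g ψ c₁ c₂) :
    ∀ t ∈ T, deriv (deriv ψ) t = 6 * c₁ * ψ t ^ 2 := by
  have s1 := smooth_deriv hT h.1
  have s2 := smooth_deriv hT s1
  have D : ∀ t ∈ T, HasDerivAt ψ (deriv ψ t) t := fun t ht => smooth_hasDerivAt hT h.1 ht
  have D' : ∀ t ∈ T, HasDerivAt (deriv ψ) (deriv (deriv ψ) t) t :=
    fun t ht => smooth_hasDerivAt hT s1 ht
  have key : ∀ t ∈ T, deriv ψ t * (deriv (deriv ψ) t - 6 * c₁ * ψ t ^ 2) = 0 := fun t ht => by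
    have := eq_zero_of_hasDerivAt_of_eq_zero (((D' t ht).pow 2).sub
      ((((D t ht).pow 3).const_mul (4 * c₁)).add_const c₂)) hT
      (fun s hs => sub_eq_zero.2 (h.2 s hs).2.2) ht
    push_cast at this
    linear_combination this / 2
  have sh : ContinuousOn (fun t => deriv (deriv ψ) t - 6 * c₁ * ψ t ^ 2) T :=
    s2.continuousOn.sub (continuousOn_const.mul (h.1.continuousOn.pow 2))
  have key2 : ∀ t ∈ T, deriv (deriv ψ) t * (deriv (deriv ψ) t - 6 * c₁ * ψ t ^ 2) = 0 := by
    intro t ht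
    by_contra hne
    have hne' := right_ne_zero_of_mul hne
    refine left_ne_zero_of_mul hne ?_
    have hev : deriv ψ =ᶠ[nhds t] fun _ => 0 := by
      filter_upwards [(sh.continuousAt (hT.mem_nhds ht)).eventually_ne hne', hT.mem_nhds ht]
        with s hs hsT
      exact (mul_eq_zero.1 (key s hsT)).resolve_right hs
    rw [hev.deriv_eq, deriv_const]
  obtain ⟨t₀, ht₀, hgt⟩ := hg0
  have hψ' : deriv ψ t₀ ≠ 0 := by
    rw [h.deriv_eq ht₀]
    exact mul_ne_zero hgt (h.2 t₀ ht₀).1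
  by_cases hc : c₁ = 0
  · subst hc
    intro t ht
    have := key2 t ht
    have h2 : deriv (deriv ψ) t ^ 2 = 0 := by linear_combination this
    rw [pow_eq_zero_iff (by norm_num) |>.1 h2]
    ring
  · rcases eq_zero_or_eq_zero_of_mul_eq_zero hT hT' s2.continuousOn sh key2 (fun t ht h0 => by
      rw [h0, zero_sub]
      exact neg_ne_zero.2 (mul_ne_zero (mul_ne_zero (by norm_num) hc)
        (pow_ne_zero 2 (h.2 t ht).1))) with h0 | h0
    · exfalso
      have h1 := (mul_eq_zero.1 (key t₀ ht₀)).resolve_left hψ'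
      rw [h0 t₀ ht₀, zero_sub, neg_eq_zero] at h1
      exact mul_ne_zero (mul_ne_zero (by norm_num) hc) (pow_ne_zero 2 (h.2 t₀ ht₀).1) h1
    · exact fun t ht => sub_eq_zero.1 (h0 t ht)

theorem deriv_g_eq (hT : IsOpen T) (hT' : IsPreconnected T) (hg0 : ∃ t ∈ T, g t ≠ 0)
    (h : IsLogPrimitive T g ψ c₁ c₂) {t : ℝ} (ht : t ∈ T) :
    HasDerivAt g (6 * c₁ * ψ t - g t ^ 2) t := by
  refine hasDerivAt_of_eqOn hT (fun s hs => (h.2 s hs).2.1) ht ?_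
  refine ((smooth_hasDerivAt hT (smooth_deriv hT h.1) ht).div (smooth_hasDerivAt hT h.1 ht)
    (h.2 t ht).1).congr_deriv ?_
  have h0 := (h.2 t ht).1
  rw [h.deriv_deriv_eq hT hT' hg0 t ht, h.deriv_eq ht]
  field_simp

theorem solvesOdeOne (hT : IsOpen T) (hT' : IsPreconnected T) (hg0 : ∃ t ∈ T, g t ≠ 0)
    (h : IsLogPrimitive T g ψ c₁ c₂) : SolvesOdeOne T g := by
  intro t ht
  have h1 : ∀ t ∈ T, deriv g t = 6 * c₁ * ψ t - g t ^ 2 :=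
    fun t ht => (h.deriv_g_eq hT hT' hg0 ht).deriv
  have h2 : deriv (deriv g) t = _ := (deriv_congr_of_eqOn hT h1 ht).trans
    ((((smooth_hasDerivAt hT h.1 ht).const_mul (6 * c₁)).sub
      ((h.deriv_g_eq hT hT' hg0 ht).pow 2)).deriv)
  simp only [iteratedDeriv_succ, iteratedDeriv_zero]
  rw [h2, h1 t ht, h.deriv_eq ht]
  push_cast
  ring

theorem constants_ne_zero (hg0 : ∃ t ∈ T, g t ≠ 0) (h : IsLogPrimitive T g ψ c₁ c₂) :
    ¬ (c₁ = 0 ∧ c₂ = 0) := by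
  rintro ⟨rfl, rfl⟩
  obtain ⟨t, ht, hgt⟩ := hg0
  obtain ⟨-, h1, h2⟩ := h.2 t ht
  have h3 : deriv ψ t ^ 2 = 0 := by linear_combination h2
  rw [pow_eq_zero_iff (by norm_num) |>.1 h3, zero_div] at h1
  exact hgt h1

theorem exists_eq_linear (hT : IsOpen T) (hT' : IsPreconnected T) (hg0 : ∃ t ∈ T, g t ≠ 0)
    (h : IsLogPrimitive T g ψ 0 c₂) :
    ∃ a b : ℝ, a ≠ 0 ∧ a ^ 2 = c₂ ∧ ∀ t ∈ T, ψ t = a * t + b := by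
  have h2 := h.deriv_deriv_eq hT hT' hg0
  have hne := h.constants_ne_zero hg0
  obtain ⟨t₀, ht₀, -⟩ := hg0
  have hd : ∀ t ∈ T, deriv ψ t = deriv ψ t₀ := fun t ht =>
    eq_of_hasDerivAt_zero hT hT' (fun s hs => (smooth_hasDerivAt hT (smooth_deriv hT h.1)
      hs).congr_deriv (by rw [h2 s hs]; ring)) ht ht₀
  have hsq : deriv ψ t₀ ^ 2 = c₂ := by rw [(h.2 t₀ ht₀).2.2]; ring
  obtain ⟨b, hb⟩ := exists_eq_add_const hT hT' (fun t ht => (smooth_hasDerivAt hT h.1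
    ht).congr_deriv (hd t ht)) (fun t _ => ((hasDerivAt_id t).const_mul (deriv ψ t₀)).congr_deriv
      (mul_one _))
  exact ⟨deriv ψ t₀, b, fun h0 => hne ⟨rfl, by rw [← hsq, h0]; ring⟩, hsq, hb⟩

/-- For `c₂ = 0` one has `g² = 4 c₁ ψ` and `g' = g²/2`, so that `1/g` is affine. -/
theorem exists_eq_inv_sq (hT : IsOpen T) (hT' : IsPreconnected T) (hg0 : ∃ t ∈ T, g t ≠ 0)
    (h : IsLogPrimitive T g ψ c₁ 0) :
    ∃ c₃ : ℝ, ∀ t ∈ T, t + c₃ ≠ 0 ∧ ψ t = (c₁ * (t + c₃) ^ 2)⁻¹ := by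
  have hc : c₁ ≠ 0 := fun hc => h.constants_ne_zero hg0 ⟨hc, rfl⟩
  have hsq : ∀ t ∈ T, g t ^ 2 = 4 * c₁ * ψ t := fun t ht => by
    have h0 := (h.2 t ht).1
    have h1 := (h.2 t ht).2.2
    rw [h.deriv_eq ht] at h1
    have : ψ t ^ 2 * (g t ^ 2 - 4 * c₁ * ψ t) = 0 := by linear_combination h1
    exact sub_eq_zero.1 ((mul_eq_zero.1 this).resolve_left (pow_ne_zero 2 h0))
  have hgne : ∀ t ∈ T, g t ≠ 0 := fun t ht h0 => by
    have := hsq t ht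
    rw [h0] at this
    exact mul_ne_zero (mul_ne_zero four_ne_zero hc) (h.2 t ht).1 (by linarith)
  obtain ⟨d, hd⟩ := exists_eq_add_const hT hT' (f := fun t => (g t)⁻¹) (g := fun t => -(1 / 2) * t)
    (d := fun _ => -(1 / 2)) (fun t ht => by
      refine ((h.deriv_g_eq hT hT' hg0 ht).inv (hgne t ht)).congr_deriv ?_
      have := hgne t ht
      field_simp
      linear_combination 3 * hsq t ht)
    (fun t _ => ((hasDerivAt_id t).const_mul (-(1 / 2) : ℝ)).congr_deriv (mul_one _))
  refine ⟨-2 * d, fun t ht => ?_⟩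
  have hne := hgne t ht
  have h1 : g t * (t + -2 * d) = -2 := by
    have := hd t ht
    have h2 : g t * (g t)⁻¹ = 1 := mul_inv_cancel₀ hne
    rw [this] at h2
    linear_combination -2 * h2
  have hne' : t + -2 * d ≠ 0 := fun h0 => by
    rw [h0] at h1
    norm_num at h1
  refine ⟨hne', ?_⟩
  refine eq_inv_of_mul_eq_one_left ?_
  linear_combination (g t * (t + -2 * d) - 2) / 4 * h1 - (t + -2 * d) ^ 2 / 4 * hsq t ht

end IsLogPrimitive

theorem SolvesOdeOne.exists_isLogPrimitive (hT : IsOpen T) (hT' : IsPreconnected T)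
    (hT'' : T.Nonempty) (hg : ContDiffOn ℝ ∞ g T) (h : SolvesOdeOne T g) :
    ∃ ψ c₁ c₂, IsLogPrimitive T g ψ c₁ c₂ := by
  obtain ⟨ψ, hψ, hψ'⟩ := exists_exp_primitive hT hT' hg
  have h0 : ∀ t ∈ T, ψ t ≠ 0 := fun t ht => (hψ' t ht).1.ne'
  have D : ∀ t ∈ T, HasDerivAt ψ (g t * ψ t) t := fun t ht => (hψ' t ht).2
  have Dg : ∀ t ∈ T, HasDerivAt g (deriv g t) t := fun t ht => smooth_hasDerivAt hT hg ht
  have Dg' : ∀ t ∈ T, HasDerivAt (deriv g) (deriv (deriv g) t) t :=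
    fun t ht => smooth_hasDerivAt hT (smooth_deriv hT hg) ht
  simp only [SolvesOdeOne, iteratedDeriv_succ, iteratedDeriv_zero] at h
  obtain ⟨t₀, ht₀⟩ := hT''
  obtain ⟨c, hc⟩ : ∃ c, ∀ t ∈ T, (deriv g t + g t ^ 2) / ψ t = c :=
    ⟨_, fun t ht => eq_of_hasDerivAt_zero hT hT' (f := fun t => (deriv g t + g t ^ 2) / ψ t)
      (fun t ht => by
        refine (((Dg' t ht).add ((Dg t ht).pow 2)).div (D t ht) (h0 t ht)).congr_deriv ?_
        rw [div_eq_zero_iff]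
        left
        simp only [Pi.add_apply, Pi.pow_apply]
        push_cast
        linear_combination ψ t * h t ht) ht ht₀⟩
  have hc' : ∀ t ∈ T, deriv g t + g t ^ 2 = c * ψ t := fun t ht => by
    rw [← hc t ht, div_mul_cancel₀ _ (h0 t ht)]
  obtain ⟨d, hd⟩ : ∃ d, ∀ t ∈ T, (g t * ψ t) ^ 2 - 4 * (c / 6) * ψ t ^ 3 = d :=
    ⟨_, fun t ht => eq_of_hasDerivAt_zero hT hT'
      (f := fun t => (g t * ψ t) ^ 2 - 4 * (c / 6) * ψ t ^ 3) (fun t ht => by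
        refine ((((Dg t ht).mul (D t ht)).pow 2).sub
          (((D t ht).pow 3).const_mul (4 * (c / 6)))).congr_deriv ?_
        simp only [Pi.mul_apply]
        push_cast
        linear_combination 2 * g t * ψ t ^ 2 * hc' t ht) ht ht₀⟩
  refine ⟨ψ, c / 6, d, hψ, fun t ht => ⟨h0 t ht, ?_, ?_⟩⟩
  · rw [(D t ht).deriv, mul_div_cancel_right₀ _ (h0 t ht)]
  · rw [(D t ht).deriv]
    linear_combination hd t ht

/-- The solutions invariant under `∂_t + g(t) u ∂_u` are separated. -/
theorem isInvariantSolution_phiOne_iff (hX : IsOpen X) (hT : IsOpen T) (hT' : IsPreconnected T)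
    (hg0 : ∃ t ∈ T, g t ≠ 0) (h : IsLogPrimitive T g ψ c₁ c₂) {u : ℝ → ℝ → ℝ}
    (hu : SmoothOnRect X T u) :
    IsInvariantSolution α β γ 0 0 X T (fun _ _ _ => 0) (phiOne g) u ↔
      ∃ w : ℝ → ℝ, ContDiffOn ℝ ∞ w X ∧
        (∀ x ∈ X, w x * iteratedDeriv 4 w x + α * (deriv w x * iteratedDeriv 3 w x)
          + β * iteratedDeriv 2 w x ^ 2
          + 2 * γ * (w x * iteratedDeriv 2 w x + deriv w x ^ 2) - 6 * c₁ * w x = 0) ∧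
        ∀ x ∈ X, ∀ t ∈ T, u x t = w x * ψ t := by
  rw [isInvariantSolution_iff]
  have ψ2 := h.deriv_deriv_eq hT hT' hg0
  have P : ∀ {w : ℝ → ℝ}, (∀ x ∈ X, ∀ t ∈ T, u x t = w x * ψ t) → ∀ x ∈ X, ∀ t ∈ T,
      px u x t = deriv w x * ψ t ∧ px (px u) x t = deriv (deriv w) x * ψ t ∧
      px (px (px u)) x t = deriv (deriv (deriv w)) x * ψ t ∧
      px (px (px (px u))) x t = deriv (deriv (deriv (deriv w))) x * ψ t ∧
      pt u x t = w x * deriv ψ t ∧ pt (pt u) x t = w x * deriv (deriv ψ) t := by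
    intro w hw x hx t ht
    have p1 := px_congr hX hw
    have p2 := px_congr hX p1
    have p3 := px_congr hX p2
    have p4 := px_congr hX p3
    have q1 := pt_congr hT hw
    have q2 := pt_congr hT q1
    simp only [px_mul_fun_t, pt_fun_x_mul] at p1 p2 p3 p4 q1 q2
    exact ⟨p1 x hx t ht, p2 x hx t ht, p3 x hx t ht, p4 x hx t ht, q1 x hx t ht, q2 x hx t ht⟩
  simp only [iteratedDeriv_succ, iteratedDeriv_zero, phiOne, zero_mul, zero_add]
  constructor
  · intro hs
    obtain ⟨t₀, ht₀, -⟩ := hg0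
    have hw : ∀ x ∈ X, ∀ t ∈ T, u x t = u x t₀ / ψ t₀ * ψ t := fun x hx t ht => by
      have : u x t / ψ t = u x t₀ / ψ t₀ := eq_of_hasDerivAt_zero hT hT' (f := fun t => u x t / ψ t)
        (fun s hs' => by
          refine ((hu.hasDerivAt_t hX hT hx hs').div (smooth_hasDerivAt hT h.1 hs')
            (h.2 s hs').1).congr_deriv ?_
          rw [(hs x hx s hs').2, h.deriv_eq hs']
          ring) ht ht₀
      rw [← this, div_mul_cancel₀ _ (h.2 t ht).1]
    obtain ⟨w, hws, hw⟩ : ∃ w : ℝ → ℝ, ContDiffOn ℝ ∞ w X ∧ ∀ x ∈ X, ∀ t ∈ T, u x t = w x * ψ t :=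
      ⟨fun x => u x t₀ / ψ t₀, (hu.slice_x ht₀).div_const _, hw⟩
    refine ⟨w, hws, fun x hx => ?_, hw⟩
    obtain ⟨p1, p2, p3, p4, -, q2⟩ := P hw x hx t₀ ht₀
    have h1 := (hs x hx t₀ ht₀).1
    rw [p1, p2, p3, p4, q2, hw x hx t₀ ht₀, ψ2 t₀ ht₀] at h1
    have h0 := pow_ne_zero 2 (h.2 t₀ ht₀).1
    refine (mul_eq_zero.1 ?_).resolve_left h0
    linear_combination -h1
  · rintro ⟨w, -, hode, hw⟩ x hx t ht
    obtain ⟨p1, p2, p3, p4, q1, q2⟩ := P hw x hx t ht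
    rw [p1, p2, p3, p4, q1, q2, hw x hx t ht, ψ2 t ht, h.deriv_eq ht]
    exact ⟨by linear_combination -ψ t ^ 2 * hode x hx, by ring⟩

end FirstReduction

/-! ### Second reduction -/

section SecondReduction

variable {X T : Set ℝ} {κ : ℝ} {f h : ℝ → ℝ → ℝ}

theorem hasDerivAt_quartic (c₀ c₁ c₂ c₃ c₄ x : ℝ) :
    HasDerivAt (quartic c₀ c₁ c₂ c₃ c₄) (quartic c₁ (2 * c₂) (3 * c₃) (4 * c₄) 0 x) x := by
  refine ((((((hasDerivAt_pow 4 x).const_mul c₄).add ((hasDerivAt_pow 3 x).const_mul c₃)).add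
    ((hasDerivAt_pow 2 x).const_mul c₂)).add ((hasDerivAt_id x).const_mul c₁)).add_const
    c₀).congr_deriv ?_
  simp only [quartic]
  push_cast
  ring

theorem deriv_quartic (c₀ c₁ c₂ c₃ c₄ : ℝ) :
    deriv (quartic c₀ c₁ c₂ c₃ c₄) = quartic c₁ (2 * c₂) (3 * c₃) (4 * c₄) 0 :=
  funext fun x => (hasDerivAt_quartic c₀ c₁ c₂ c₃ c₄ x).deriv

/-- The superposition `p(x - s t) + q(x + s t) + c t` of two travelling waves and a linear
function. -/
def wave (s c : ℝ) (p q : ℝ → ℝ) (x t : ℝ) : ℝ := p (x - s * t) + q (x + s * t) + c * t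

theorem px_wave {p q p' q' : ℝ → ℝ} (hp : ∀ y, HasDerivAt p (p' y) y)
    (hq : ∀ y, HasDerivAt q (q' y) y) (s c : ℝ) : px (wave s c p q) = wave s 0 p' q' := by
  funext x t
  refine ((((hp _).comp x ((hasDerivAt_id x).sub_const (s * t))).add ((hq _).comp x
    ((hasDerivAt_id x).add_const (s * t)))).add_const (c * t)).deriv.trans ?_
  simp [wave]

theorem pt_wave {p q p' q' : ℝ → ℝ} (hp : ∀ y, HasDerivAt p (p' y) y)
    (hq : ∀ y, HasDerivAt q (q' y) y) (s c : ℝ) :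
    pt (wave s c p q) = wave s 0 (fun y => -s * p' y) (fun y => s * q' y + c) := by
  funext x t
  refine ((((hp _).comp t (((hasDerivAt_id t).const_mul s).const_sub x)).add ((hq _).comp t
    (((hasDerivAt_id t).const_mul s).const_add x))).add
    ((hasDerivAt_id t).const_mul c)).deriv.trans ?_
  simp only [wave, id]
  ring

theorem px_sub (hX : IsOpen X) (hT : IsOpen T) (hf : SmoothOnRect X T f) (hh : SmoothOnRect X T h) :
    ∀ x ∈ X, ∀ t ∈ T, px (fun x t => f x t - h x t) x t = px f x t - px h x t :=
  fun _ hx _ ht => ((hf.hasDerivAt_x hX hT hx ht).sub (hh.hasDerivAt_x hX hT hx ht)).deriv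

theorem pt_sub (hX : IsOpen X) (hT : IsOpen T) (hf : SmoothOnRect X T f) (hh : SmoothOnRect X T h) :
    ∀ x ∈ X, ∀ t ∈ T, pt (fun x t => f x t - h x t) x t = pt f x t - pt h x t :=
  fun _ hx _ ht => ((hf.hasDerivAt_t hX hT hx ht).sub (hh.hasDerivAt_t hX hT hx ht)).deriv

/-- On the invariant surfaces of `s ∂_x + ∂_t + P(x + s t) ∂_u` the wave operator
`∂_t² - s² ∂_x²` vanishes, so that `Δ = 0` reduces to `u u_xxxx = 0`. -/
theorem px_four_eq_zero_of_isInvariantSolution (hX : IsOpen X) (hT : IsOpen T)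
    {s c₀ c₁ c₂ c₃ : ℝ} {u : ℝ → ℝ → ℝ} (hu : SmoothOnRect X T u)
    (h : IsInvariantSolution 0 0 0 (s ^ 2) 0 X T (fun _ _ _ => s) (phiTwo s c₀ c₁ c₂ c₃) u) :
    ∀ x ∈ X, ∀ t ∈ T, px (px (px (px u))) x t = 0 := by
  rw [isInvariantSolution_iff] at h
  have u1 := hu.smooth_px hX hT
  have P : ∀ y, HasDerivAt (quartic c₀ c₁ c₂ c₃ 0) _ y := hasDerivAt_quartic c₀ c₁ c₂ c₃ 0
  have h1 : ∀ x ∈ X, ∀ t ∈ T, pt u x t + s * px u x t - quartic c₀ c₁ c₂ c₃ 0 (x + s * t) = 0 :=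
    fun x hx t ht => by
      have := (h x hx t ht).2
      rw [phiTwo] at this
      rw [quartic]
      linear_combination this
  refine eq_zero_of_mul_eq_zero_on_rect (f := u) hX hT
    (((u1.smooth_px hX hT).smooth_px hX hT).smooth_px hX hT) (fun x hx t ht => ?_)
    fun X' _ T' _ hX' _ h => px_eq_zero hX' (px_eq_zero hX' (px_eq_zero hX' (px_eq_zero hX' h)))
  have hx1 := eq_zero_of_hasDerivAt_of_eq_zero (((hu.hasDerivAt_pt_x hX hT hx ht).add
    ((u1.hasDerivAt_x hX hT hx ht).const_mul s)).sub ((P _).comp x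
      ((hasDerivAt_id x).add_const (s * t)))) hX (fun r hr => h1 r hr t ht) hx
  have ht1 := eq_zero_of_hasDerivAt_of_eq_zero ((((hu.smooth_pt hX hT).hasDerivAt_t hX hT
    hx ht).add ((u1.hasDerivAt_t hX hT hx ht).const_mul s)).sub ((P _).comp t
      (((hasDerivAt_id t).const_mul s).const_add x))) hT (fun r hr => h1 x hx r hr) ht
  simp only [id] at hx1 ht1
  linear_combination -(h x hx t ht).1 + ht1 - s * hx1

/-- The solutions invariant under `s ∂_x + ∂_t + P(x + s t) ∂_u`. -/
theorem isInvariantSolution_phiTwo_iff (hX : IsOpen X) (hX' : IsPreconnected X) (hT : IsOpen T)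
    (hT' : IsPreconnected T) {s c₀ c₁ c₂ c₃ : ℝ} (hs : s ≠ 0) {u : ℝ → ℝ → ℝ}
    (hu : SmoothOnRect X T u) :
    IsInvariantSolution 0 0 0 (s ^ 2) 0 X T (fun _ _ _ => s) (phiTwo s c₀ c₁ c₂ c₃) u ↔
      ∃ c₄ c₅ c₆ c₇ : ℝ, ∀ x ∈ X, ∀ t ∈ T,
        u x t = -(c₃ / (8 * s)) * (x - s * t) ^ 4 + c₄ * (x - s * t) ^ 3
          + c₅ * (x - s * t) ^ 2 + c₆ * (x - s * t) + c₇
          + c₃ / (8 * s) * (x + s * t) ^ 4 + c₂ / (6 * s) * (x + s * t) ^ 3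
          + c₁ / (4 * s) * (x + s * t) ^ 2 + c₀ * t := by
  have P := fun c₀ c₁ c₂ c₃ c₄ => hasDerivAt_quartic c₀ c₁ c₂ c₃ c₄
  constructor
  · intro h
    have h4 := px_four_eq_zero_of_isInvariantSolution hX hT hu h
    rw [isInvariantSolution_iff] at h
    generalize hW : wave s c₀ (quartic 0 0 0 0 (-(c₃ / (8 * s))))
      (quartic 0 0 (c₁ / (4 * s)) (c₂ / (6 * s)) (c₃ / (8 * s))) = W
    have sW : SmoothOnRect X T W := by
      refine ContDiff.contDiffOn ?_
      rw [← hW]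
      simp only [wave, quartic]
      fun_prop
    have d0 := px_sub hX hT hu sW
    have su1 := hu.smooth_px hX hT
    have sW1 := sW.smooth_px hX hT
    have d1 := fun x hx t ht => (px_congr (T := T) hX d0 x hx t ht).trans
      (px_sub hX hT su1 sW1 x hx t ht)
    have su2 := su1.smooth_px hX hT
    have sW2 := sW1.smooth_px hX hT
    have d2 := fun x hx t ht => (px_congr (T := T) hX d1 x hx t ht).trans
      (px_sub hX hT su2 sW2 x hx t ht)
    have su3 := su2.smooth_px hX hT
    have sW3 := sW2.smooth_px hX hT
    have d3 := fun x hx t ht => (px_congr (T := T) hX d2 x hx t ht).trans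
      (px_sub hX hT su3 sW3 x hx t ht)
    obtain ⟨e₀, e₁, e₂, e₃, he⟩ := exists_eq_cubic_of_transport (s := -s)
      (f := fun x t => u x t - W x t) hX hX' hT hT' (ContDiffOn.sub hu sW)
      (fun x hx t ht => by
        rw [pt_sub hX hT hu sW x hx t ht, d0 x hx t ht]
        have h2 := (h x hx t ht).2
        rw [← hW, px_wave (P _ _ _ _ _) (P _ _ _ _ _), pt_wave (P _ _ _ _ _) (P _ _ _ _ _)]
        rw [phiTwo] at h2
        have k1 : s * (c₁ / (4 * s)) = c₁ / 4 := by field_simp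
        have k2 : s * (c₂ / (6 * s)) = c₂ / 6 := by field_simp
        have k3 : s * (c₃ / (8 * s)) = c₃ / 8 := by field_simp
        simp only [wave, quartic]
        linear_combination h2 - 4 * (x + s * t) * k1 - 6 * (x + s * t) ^ 2 * k2
          - 8 * (x + s * t) ^ 3 * k3)
      (fun x hx t ht => by
        rw [d3 x hx t ht, h4 x hx t ht, ← hW]
        simp only [px_wave (P _ _ _ _ _) (P _ _ _ _ _)]
        simp only [wave, quartic]
        ring)
    refine ⟨e₃, e₂, e₁, e₀, fun x hx t ht => ?_⟩
    have := he x hx t ht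
    rw [← hW] at this
    simp only [wave, quartic, phiTwo] at this
    linear_combination this
  · rintro ⟨c₄, c₅, c₆, c₇, h⟩
    have hw : ∀ x ∈ X, ∀ t ∈ T, u x t = wave s c₀ (quartic c₇ c₆ c₅ c₄ (-(c₃ / (8 * s))))
        (quartic 0 0 (c₁ / (4 * s)) (c₂ / (6 * s)) (c₃ / (8 * s))) x t := fun x hx t ht => by
      rw [h x hx t ht, wave, quartic, quartic]
      ring
    have p1 := px_congr hX hw
    have p2 := px_congr hX p1
    have p3 := px_congr hX p2
    have p4 := px_congr hX p3
    have q1 := pt_congr hT hw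
    have q2 := pt_congr hT q1
    have Q1 : ∀ (b c₀ c₁ c₂ c₃ c₄ y : ℝ), HasDerivAt (fun y => -b * quartic c₀ c₁ c₂ c₃ c₄ y) _ y :=
      fun b c₀ c₁ c₂ c₃ c₄ y => (P c₀ c₁ c₂ c₃ c₄ y).const_mul (-b)
    have Q2 : ∀ (b c c₀ c₁ c₂ c₃ c₄ y : ℝ),
        HasDerivAt (fun y => b * quartic c₀ c₁ c₂ c₃ c₄ y + c) _ y :=
      fun b c c₀ c₁ c₂ c₃ c₄ y => ((P c₀ c₁ c₂ c₃ c₄ y).const_mul b).add_const c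
    simp only [px_wave (P _ _ _ _ _) (P _ _ _ _ _), pt_wave (P _ _ _ _ _) (P _ _ _ _ _),
      pt_wave (Q1 _ _ _ _ _ _) (Q2 _ _ _ _ _ _ _)] at p1 p2 p3 p4 q1 q2
    rw [isInvariantSolution_iff]
    intro x hx t ht
    rw [p2 x hx t ht, p4 x hx t ht, q2 x hx t ht, p1 x hx t ht, q1 x hx t ht]
    simp only [wave, quartic, phiTwo]
    constructor
    · ring
    · field_simp
      ring

/-- Integration of the reduced equation. -/
theorem exists_profile_iff (hX : IsOpen X) (hX' : IsPreconnected X) (hT' : IsPreconnected T)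
    {s c₃ : ℝ} (hs : s ≠ 0) {v : ℝ → ℝ → ℝ} :
    (∃ w : ℝ → ℝ, ContDiffOn ℝ ∞ w ((fun p : ℝ × ℝ => p.1 - s * p.2) '' (X ×ˢ T)) ∧
      (∀ x ∈ X, ∀ t ∈ T, s * iteratedDeriv 4 w (x - s * t) + 3 * c₃ = 0) ∧
      ∀ x ∈ X, ∀ t ∈ T, v x t = w (x - s * t)) ↔
    ∃ c₄ c₅ c₆ c₇ : ℝ, ∀ x ∈ X, ∀ t ∈ T,
      v x t = quartic c₇ c₆ c₅ c₄ (-(c₃ / (8 * s))) (x - s * t) := by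
  simp only [iteratedDeriv_succ, iteratedDeriv_zero]
  constructor
  · rintro ⟨w, hw, hode, hv⟩
    have hZ : IsOpen ((fun p : ℝ × ℝ => p.1 - s * p.2) '' (X ×ˢ T)) := by
      rw [isOpen_iff_mem_nhds]
      rintro _ ⟨⟨x, t⟩, ⟨hx, ht⟩, rfl⟩
      have hc : Continuous fun z : ℝ => z + s * t := by fun_prop
      have ho := hX.preimage hc
      refine Filter.mem_of_superset (ho.mem_nhds (by simpa using hx)) fun z hz => ?_
      exact ⟨(z + s * t, t), ⟨hz, ht⟩, by simp⟩
    have hZ' : IsPreconnected ((fun p : ℝ × ℝ => p.1 - s * p.2) '' (X ×ˢ T)) :=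
      (hX'.prod hT').image _ (by fun_prop)
    obtain ⟨d₀, d₁, d₂, d₃, hd⟩ := exists_eq_quartic_of_deriv (c := -(c₃ / (8 * s))) hZ hZ' hw (by
      rintro _ ⟨⟨x, t⟩, ⟨hx, ht⟩, rfl⟩
      have := hode x hx t ht
      field_simp
      linear_combination 8 * this)
    exact ⟨d₃, d₂, d₁, d₀, fun x hx t ht => by
      rw [hv x hx t ht, hd _ ⟨(x, t), ⟨hx, ht⟩, rfl⟩]⟩
  · rintro ⟨c₄, c₅, c₆, c₇, h⟩
    refine ⟨_, (contDiff_quartic c₇ c₆ c₅ c₄ (-(c₃ / (8 * s)))).contDiffOn, fun x hx t ht => ?_, h⟩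
    simp only [deriv_quartic]
    simp only [quartic]
    field_simp
    ring

end SecondReduction

/-! ### Third reduction -/

section ThirdReduction

variable {X T : Set ℝ} {g G w Q : ℝ → ℝ} {u : ℝ → ℝ → ℝ} {c₀ c₁ c₂ c₃ c₄ c₅ : ℝ}

/-- The left side of the third order equation, divided by `g²`, is the derivative of
`g'' - 2 g'²/g + 24 c₄ G`. -/
theorem solvesOdeThree_iff_exists_const (hT : IsOpen T) (hT' : IsPreconnected T)
    (hT'' : T.Nonempty) (hg : ContDiffOn ℝ ∞ g T) (hg0 : ∀ t ∈ T, g t ≠ 0)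
    (hG : ∀ t ∈ T, HasDerivAt G (g t ^ 2) t) :
    SolvesOdeThree T c₄ g ↔ ∃ c₅ : ℝ, ∀ t ∈ T, g t * iteratedDeriv 2 g t
      - 2 * deriv g t ^ 2 + 24 * c₄ * g t * G t + 24 * c₅ * g t = 0 := by
  have s1 := smooth_deriv hT hg
  have s2 := smooth_deriv hT s1
  have D0 : ∀ t ∈ T, HasDerivAt g (deriv g t) t := fun t ht => smooth_hasDerivAt hT hg ht
  have D1 : ∀ t ∈ T, HasDerivAt (deriv g) (deriv (deriv g) t) t :=
    fun t ht => smooth_hasDerivAt hT s1 ht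
  have D2 : ∀ t ∈ T, HasDerivAt (deriv (deriv g)) (deriv (deriv (deriv g)) t) t :=
    fun t ht => smooth_hasDerivAt hT s2 ht
  have DH : ∀ t ∈ T, HasDerivAt
      (fun t => deriv (deriv g) t - 2 * deriv g t ^ 2 / g t + 24 * c₄ * G t)
      ((g t ^ 2 * deriv (deriv (deriv g)) t - 4 * g t * deriv g t * deriv (deriv g) t
        + 2 * deriv g t ^ 3 + 24 * c₄ * g t ^ 4) / g t ^ 2) t := fun t ht => by
    have h0 := hg0 t ht
    refine (((D2 t ht).sub ((((D1 t ht).pow 2).const_mul 2).div (D0 t ht) h0)).add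
      ((hG t ht).const_mul (24 * c₄))).congr_deriv ?_
    simp only [Pi.pow_apply]
    field_simp
    push_cast
    ring
  simp only [SolvesOdeThree, iteratedDeriv_succ, iteratedDeriv_zero]
  constructor
  · intro h
    obtain ⟨t₀, ht₀⟩ := hT''
    refine ⟨-(deriv (deriv g) t₀ - 2 * deriv g t₀ ^ 2 / g t₀ + 24 * c₄ * G t₀) / 24,
      fun t ht => ?_⟩
    have := eq_of_hasDerivAt_zero hT hT' (f := fun t => deriv (deriv g) t - 2 * deriv g t ^ 2 / g t
      + 24 * c₄ * G t) (fun s hs => (DH s hs).congr_deriv (by rw [h s hs, zero_div])) ht ht₀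
    rw [← this]
    have h0 := hg0 t ht
    field_simp
    ring
  · rintro ⟨c₅, h⟩ t ht
    have h1 := eq_zero_of_hasDerivAt_of_eq_zero ((DH t ht).add_const (24 * c₅)) hT
      (fun s hs => by
        have h0 := hg0 s hs
        refine (mul_eq_zero.1 ?_).resolve_left h0
        have := h s hs
        field_simp
        linear_combination this) ht
    exact (div_eq_zero_iff.1 h1).resolve_right (pow_ne_zero 2 (hg0 t ht))

/-- The second `t`-derivative on the invariant surfaces. -/
theorem pt_pt_of_phiThree (hX : IsOpen X) (hT : IsOpen T) (hu : SmoothOnRect X T u)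
    (hg : ContDiffOn ℝ ∞ g T) (hg0 : ∀ t ∈ T, g t ≠ 0)
    (h : ∀ x ∈ X, ∀ t ∈ T, pt u x t = phiThree g c₀ c₁ c₂ c₃ c₄ x t (u x t)) :
    ∀ x ∈ X, ∀ t ∈ T,
      g t ^ 2 * pt (pt u) x t = -(u x t * (g t * deriv (deriv g) t - 2 * deriv g t ^ 2)) := by
  intro x hx t ht
  have s1 := smooth_deriv hT hg
  have D0 : HasDerivAt g (deriv g t) t := smooth_hasDerivAt hT hg ht
  have D1 : HasDerivAt (deriv g) (deriv (deriv g) t) t := smooth_hasDerivAt hT s1 ht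
  have h0 := hg0 t ht
  have h1 := pt_congr hT h x hx t ht
  have h2 := ((((hu.hasDerivAt_t hX hT hx ht).div D0 h0).neg.mul D1).add
    (D0.mul_const (quartic c₀ c₁ c₂ c₃ c₄ x))).deriv
  have h3 : pt (fun x t => phiThree g c₀ c₁ c₂ c₃ c₄ x t (u x t)) x t = _ := h2
  rw [h1, h3, h x hx t ht, phiThree]
  simp only [Pi.neg_apply, Pi.div_apply]
  field_simp
  ring

/-- The functions `r(t) (w(x) + Q(x) G(t))` are closed under `∂/∂x`. -/
theorem px_of_eq_add (hX : IsOpen X) {r : ℝ → ℝ} {v : ℝ → ℝ → ℝ} (hw : ContDiffOn ℝ ∞ w X)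
    (hQ : ContDiffOn ℝ ∞ Q X) (h : ∀ x ∈ X, ∀ t ∈ T, v x t = r t * (w x + Q x * G t)) :
    ∀ x ∈ X, ∀ t ∈ T, px v x t = r t * (deriv w x + deriv Q x * G t) := fun x hx t ht => by
  rw [px_congr hX h x hx t ht]
  exact (((smooth_hasDerivAt hX hw hx).add
    ((smooth_hasDerivAt hX hQ hx).mul_const (G t))).const_mul (r t)).deriv

/-- On the invariant surfaces `Δ = u (24 c₅ - w'''') / g`. -/
theorem isInvariantSolution_phiThree_iff_of_eq (hX : IsOpen X) (hT : IsOpen T)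
    (hu : SmoothOnRect X T u) (hg : ContDiffOn ℝ ∞ g T) (hg0 : ∀ t ∈ T, g t ≠ 0)
    (hG : ∀ t ∈ T, HasDerivAt G (g t ^ 2) t)
    (hc : ∀ t ∈ T, g t * iteratedDeriv 2 g t
      - 2 * deriv g t ^ 2 + 24 * c₄ * g t * G t + 24 * c₅ * g t = 0) (hw : ContDiffOn ℝ ∞ w X)
    (h : ∀ x ∈ X, ∀ t ∈ T, u x t = 1 / g t * (w x + quartic c₀ c₁ c₂ c₃ c₄ x * G t)) :
    IsInvariantSolution 0 0 0 0 0 X T (fun _ _ _ => 0) (phiThree g c₀ c₁ c₂ c₃ c₄) u ↔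
      ∀ x ∈ X, ∀ t ∈ T, u x t * (deriv (deriv (deriv (deriv w))) x - 24 * c₅) = 0 := by
  rw [isInvariantSolution_iff]
  simp only [iteratedDeriv_succ, iteratedDeriv_zero] at hc
  have w1 := smooth_deriv hX hw
  have w2 := smooth_deriv hX w1
  have w3 := smooth_deriv hX w2
  have q := fun c₀ c₁ c₂ c₃ c₄ => (contDiff_quartic c₀ c₁ c₂ c₃ c₄).contDiffOn (s := X)
  have p1 := px_of_eq_add hX (r := fun t => 1 / g t) hw (q _ _ _ _ _) h
  simp only [deriv_quartic] at p1
  have p2 := px_of_eq_add hX (r := fun t => 1 / g t) w1 (q _ _ _ _ _) p1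
  simp only [deriv_quartic] at p2
  have p3 := px_of_eq_add hX (r := fun t => 1 / g t) w2 (q _ _ _ _ _) p2
  simp only [deriv_quartic] at p3
  have p4 := px_of_eq_add hX (r := fun t => 1 / g t) w3 (q _ _ _ _ _) p3
  simp only [deriv_quartic] at p4
  have q1 : ∀ x ∈ X, ∀ t ∈ T, pt u x t = phiThree g c₀ c₁ c₂ c₃ c₄ x t (u x t) := by
    intro x hx t ht
    have h0 := hg0 t ht
    rw [pt_congr hT h x hx t ht, h x hx t ht, phiThree]
    refine (((hasDerivAt_const t (1 : ℝ)).div (smooth_hasDerivAt hT hg ht) h0).mul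
      (((hG t ht).const_mul (quartic c₀ c₁ c₂ c₃ c₄ x)).const_add (w x))).deriv.trans ?_
    simp only [Pi.div_apply]
    field_simp
    ring
  have q2 := pt_pt_of_phiThree hX hT hu hg hg0 q1
  refine forall₂_congr fun x hx => forall₂_congr fun t ht => ?_
  have h0 := hg0 t ht
  have e2 := q2 x hx t ht
  have e4 : g t * px (px (px (px u))) x t = deriv (deriv (deriv (deriv w))) x + 24 * c₄ * G t := by
    rw [p4 x hx t ht, quartic]
    field_simp
    ring
  have key : g t ^ 2 * (pt (pt u) x t - (0 * px (px u) x t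
      + 2 * 0 * (u x t * px (px u) x t + px u x t ^ 2)) - u x t * px (px (px (px u))) x t
      - 0 * (px u x t * px (px (px u)) x t) - 0 * px (px u) x t ^ 2)
      = -(g t * (u x t * (deriv (deriv (deriv (deriv w))) x - 24 * c₅))) := by
    linear_combination e2 - g t * u x t * e4 - u x t * hc t ht
  constructor
  · rintro ⟨h1, -⟩
    rw [h1, mul_zero, eq_comm, neg_eq_zero] at key
    exact (mul_eq_zero.1 key).resolve_left h0
  · intro h1
    have key' := key.trans (by rw [h1]; ring : _ = (0 : ℝ))
    refine ⟨(mul_eq_zero.1 key').resolve_left (pow_ne_zero 2 h0), ?_⟩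
    rw [q1 x hx t ht]
    ring

/-- From `Δ = 0` one only gets `w'''' = 24 c₅` where `u(x, ·) ≠ 0`; where `u(x, ·) = 0`, both `w`
and `Q` vanish, because `G` is not constant. On an interval the alternative is global. -/
theorem deriv_four_eq_of_mul_eq_zero (hX : IsOpen X) (hX' : IsPreconnected X) (hT : IsOpen T)
    (hT'' : T.Nonempty) (hg0 : ∀ t ∈ T, g t ≠ 0) (hG : ∀ t ∈ T, HasDerivAt G (g t ^ 2) t)
    (hu0 : ∃ x ∈ X, ∃ t ∈ T, u x t ≠ 0) (hw : ContDiffOn ℝ ∞ w X)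
    (h : ∀ x ∈ X, ∀ t ∈ T, u x t = 1 / g t * (w x + Q x * G t))
    (hΔ : ∀ x ∈ X, ∀ t ∈ T, u x t * (deriv (deriv (deriv (deriv w))) x - 24 * c₅) = 0) :
    ∀ x ∈ X, deriv (deriv (deriv (deriv w))) x - 24 * c₅ = 0 := by
  have s4 : ContinuousOn (deriv (deriv (deriv (deriv w)))) X :=
    (smooth_deriv hX (smooth_deriv hX (smooth_deriv hX (smooth_deriv hX hw)))).continuousOn
  have sh : ContinuousOn (fun x => deriv (deriv (deriv (deriv w))) x - 24 * c₅) X :=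
    s4.sub continuousOn_const
  have hE : ∀ x ∈ X, deriv (deriv (deriv (deriv w))) x - 24 * c₅ ≠ 0 → w x = 0 ∧ Q x = 0 := by
    intro x hx hne
    have h1 : ∀ t ∈ T, w x + Q x * G t = 0 := fun t ht => by
      have h2 := (mul_eq_zero.1 (hΔ x hx t ht)).resolve_right hne
      rw [h x hx t ht] at h2
      exact (mul_eq_zero.1 h2).resolve_left (one_div_ne_zero (hg0 t ht))
    obtain ⟨t, ht⟩ := hT''
    have h2 := eq_zero_of_hasDerivAt_of_eq_zero (((hG t ht).const_mul (Q x)).const_add (w x)) hT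
      h1 ht
    have h3 := (mul_eq_zero.1 h2).resolve_right (pow_ne_zero 2 (hg0 t ht))
    have h4 := h1 t ht
    rw [h3] at h4
    exact ⟨by linarith, h3⟩
  have hmul : ∀ x ∈ X, deriv (deriv (deriv (deriv w))) x
      * (deriv (deriv (deriv (deriv w))) x - 24 * c₅) = 0 := by
    intro x hx
    by_contra hne
    refine left_ne_zero_of_mul hne ?_
    have hev : w =ᶠ[nhds x] fun _ => 0 := by
      filter_upwards [(sh.continuousAt (hX.mem_nhds hx)).eventually_ne (right_ne_zero_of_mul hne),
        hX.mem_nhds hx] with y hy hyX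
      exact (hE y hyX hy).1
    have e4 := hev.deriv.deriv.deriv.deriv.eq_of_nhds
    simpa using e4
  by_cases hc : c₅ = 0
  · intro x hx
    have h1 := hmul x hx
    rw [hc, mul_zero, sub_zero] at h1 ⊢
    exact mul_self_eq_zero.1 h1
  · rcases eq_zero_or_eq_zero_of_mul_eq_zero hX hX' s4 sh hmul (fun x _ h0 => by
      rw [h0, zero_sub]
      exact neg_ne_zero.2 (mul_ne_zero (by norm_num) hc)) with h0 | h0
    · exfalso
      obtain ⟨x, hx, t, ht, hne⟩ := hu0
      obtain ⟨h1, h2⟩ := hE x hx (by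
        rw [h0 x hx, zero_sub]
        exact neg_ne_zero.2 (mul_ne_zero (by norm_num) hc))
      exact hne (by rw [h x hx t ht, h1, h2]; ring)
    · exact h0

/-- The solutions invariant under `∂_t + (g Q - u g'/g) ∂_u`. -/
theorem isInvariantSolution_phiThree_iff (hX : IsOpen X) (hX' : IsPreconnected X) (hT : IsOpen T)
    (hT' : IsPreconnected T) (hT'' : T.Nonempty)
    (hu : SmoothOnRect X T u) (hg : ContDiffOn ℝ ∞ g T) (hg0 : ∀ t ∈ T, g t ≠ 0)
    (hG : ∀ t ∈ T, HasDerivAt G (g t ^ 2) t)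
    (hc : ∀ t ∈ T, g t * iteratedDeriv 2 g t
      - 2 * deriv g t ^ 2 + 24 * c₄ * g t * G t + 24 * c₅ * g t = 0)
    (hu0 : ∃ x ∈ X, ∃ t ∈ T, u x t ≠ 0) :
    IsInvariantSolution 0 0 0 0 0 X T (fun _ _ _ => 0) (phiThree g c₀ c₁ c₂ c₃ c₄) u ↔
      ∃ w : ℝ → ℝ, ContDiffOn ℝ ∞ w X ∧ (∀ x ∈ X, iteratedDeriv 4 w x - 24 * c₅ = 0) ∧
        ∀ x ∈ X, ∀ t ∈ T, u x t = 1 / g t * (w x + quartic c₀ c₁ c₂ c₃ c₄ x * G t) := by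
  have e : ∀ w : ℝ → ℝ, iteratedDeriv 4 w = deriv (deriv (deriv (deriv w))) := fun w => by
    simp only [iteratedDeriv_succ, iteratedDeriv_zero]
  simp only [e]
  constructor
  · intro hs
    obtain ⟨t₀, ht₀⟩ := hT''
    have hs' := isInvariantSolution_iff.1 hs
    have hw : ∀ x ∈ X, ∀ t ∈ T, g t * u x t - quartic c₀ c₁ c₂ c₃ c₄ x * G t
        = g t₀ * u x t₀ - quartic c₀ c₁ c₂ c₃ c₄ x * G t₀ := fun x hx t ht =>
      eq_of_hasDerivAt_zero hT hT' (f := fun t => g t * u x t - quartic c₀ c₁ c₂ c₃ c₄ x * G t)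
        (fun s hsT => by
          refine (((smooth_hasDerivAt hT hg hsT).mul (hu.hasDerivAt_t hX hT hx hsT)).sub
            ((hG s hsT).const_mul _)).congr_deriv ?_
          have h0 := hg0 s hsT
          have h2 := (hs' x hx s hsT).2
          rw [zero_mul, zero_add] at h2
          rw [h2, phiThree]
          field_simp
          ring) ht ht₀
    obtain ⟨w, hws, hww⟩ : ∃ w : ℝ → ℝ, ContDiffOn ℝ ∞ w X ∧ ∀ x ∈ X, ∀ t ∈ T,
        u x t = 1 / g t * (w x + quartic c₀ c₁ c₂ c₃ c₄ x * G t) :=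
      ⟨fun x => g t₀ * u x t₀ - quartic c₀ c₁ c₂ c₃ c₄ x * G t₀,
        (contDiffOn_const.mul (hu.slice_x ht₀)).sub
          ((contDiff_quartic c₀ c₁ c₂ c₃ c₄).contDiffOn.mul contDiffOn_const),
        fun x hx t ht => by
          have h0 := hg0 t ht
          simp only [← hw x hx t ht]
          field_simp
          ring⟩
    exact ⟨w, hws, deriv_four_eq_of_mul_eq_zero hX hX' hT ⟨t₀, ht₀⟩ hg0 hG hu0 hws hww
      ((isInvariantSolution_phiThree_iff_of_eq hX hT hu hg hg0 hG hc hws hww).1 hs), hww⟩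
  · rintro ⟨w, hws, hw4, hww⟩
    exact (isInvariantSolution_phiThree_iff_of_eq hX hT hu hg hg0 hG hc hws hww).2
      fun x hx t _ => by rw [hw4 x hx, mul_zero]

/-- Integration of the reduced equation. -/
theorem exists_quartic_profile_iff (hX : IsOpen X) (hX' : IsPreconnected X) {r K : ℝ → ℝ}
    {P : ℝ → ℝ} :
    (∃ w : ℝ → ℝ, ContDiffOn ℝ ∞ w X ∧ (∀ x ∈ X, iteratedDeriv 4 w x - 24 * c₅ = 0) ∧
      ∀ x ∈ X, ∀ t ∈ T, u x t = r t * (w x + P x * K t)) ↔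
    ∃ c₆ c₇ c₈ c₉ : ℝ, ∀ x ∈ X, ∀ t ∈ T,
      u x t = r t * (c₅ * x ^ 4 + c₆ * x ^ 3 + c₇ * x ^ 2 + c₈ * x + c₉ + P x * K t) := by
  simp only [iteratedDeriv_succ, iteratedDeriv_zero]
  constructor
  · rintro ⟨w, hw, h4, h⟩
    obtain ⟨d₀, d₁, d₂, d₃, hd⟩ := exists_eq_quartic_of_deriv hX hX' hw
      fun x hx => sub_eq_zero.1 (h4 x hx)
    exact ⟨d₃, d₂, d₁, d₀, fun x hx t ht => by rw [h x hx t ht, hd x hx, quartic]⟩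
  · rintro ⟨c₆, c₇, c₈, c₉, h⟩
    refine ⟨quartic c₉ c₈ c₇ c₆ c₅, (contDiff_quartic _ _ _ _ _).contDiffOn, fun x _ => ?_, h⟩
    simp only [deriv_quartic]
    simp only [quartic]
    ring

end ThirdReduction

theorem mainTheorem4 (α β γ κ : ℝ) (X T U : Set ℝ)
    (hX : IsOpen X) (hX' : IsPreconnected X) (hX'' : X.Nonempty)
    (hT : IsOpen T) (hT' : IsPreconnected T) (hT'' : T.Nonempty)
    (hU : IsOpen U) (hU' : IsPreconnected U) (hU'' : U.Nonempty) :
    -- all infinitesimals in the table are nonclassical symmetries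
    (∀ ξ φ : ℝ → ℝ → ℝ → ℝ,
      ((∃ g, KindOne κ X T U ξ φ g) ∨
        (∃ s c₀ c₁ c₂ c₃, KindTwo α β γ κ X T U ξ φ s c₀ c₁ c₂ c₃) ∨
        (∃ g c₀ c₁ c₂ c₃ c₄, KindThree α β γ κ X T U ξ φ g c₀ c₁ c₂ c₃ c₄)) →
      IsNonclassicalSymmetry α β γ κ 0 X T U ξ φ) ∧
    -- the genuinely nonclassical ones are precisely these, minus the degenerate members
    (∀ ξ φ : ℝ → ℝ → ℝ → ℝ, SmoothOnBox X T U ξ → SmoothOnBox X T U φ →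
      (IsGenuinelyNonclassical α β γ κ 0 X T U ξ φ ↔
        (∃ g, KindOne κ X T U ξ φ g ∧ ∃ t ∈ T, 2 * deriv g t ≠ g t ^ 2) ∨
        (∃ s c₀ c₁ c₂ c₃, KindTwo α β γ κ X T U ξ φ s c₀ c₁ c₂ c₃ ∧
          ¬ (c₀ = 0 ∧ c₁ = 0 ∧ c₂ = 0 ∧ c₃ = 0)) ∨
        (∃ g c₀ c₁ c₂ c₃ c₄, KindThree α β γ κ X T U ξ φ g c₀ c₁ c₂ c₃ c₄ ∧
          ¬ (c₀ = 0 ∧ c₁ = 0 ∧ c₂ = 0 ∧ c₃ = 0 ∧ c₄ = 0)))) ∧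
    -- first reduction: the equation for `g`
    (∀ g : ℝ → ℝ, ContDiffOn ℝ ∞ g T → (∃ t ∈ T, g t ≠ 0) →
      (SolvesOdeOne T g ↔ ∃ ψ c₁ c₂, IsLogPrimitive T g ψ c₁ c₂) ∧
      ∀ ψ c₁ c₂, IsLogPrimitive T g ψ c₁ c₂ →
        ¬ (c₁ = 0 ∧ c₂ = 0) ∧
        (c₁ = 0 → ∃ a b : ℝ, a ≠ 0 ∧ a ^ 2 = c₂ ∧ ∀ t ∈ T, ψ t = a * t + b) ∧
        (c₂ = 0 → ∃ c₃ : ℝ, ∀ t ∈ T, t + c₃ ≠ 0 ∧ ψ t = (c₁ * (t + c₃) ^ 2)⁻¹) ∧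
        (c₁ ≠ 0 → c₂ ≠ 0 → ∃ g₃ : ℝ, g₃ = -(c₁ ^ 2 * c₂) ∧
          ∀ t ∈ T, deriv (fun t' => c₁ * ψ t') t ^ 2 = 4 * (c₁ * ψ t) ^ 3 - g₃) ∧
        -- first reduction: the invariant solutions
        (κ = 0 → ∀ u : ℝ → ℝ → ℝ, SmoothOnRect X T u →
          (IsInvariantSolution α β γ κ 0 X T (fun _ _ _ => 0) (phiOne g) u ↔
            ∃ w : ℝ → ℝ, ContDiffOn ℝ ∞ w X ∧
              (∀ x ∈ X, w x * iteratedDeriv 4 w x + α * (deriv w x * iteratedDeriv 3 w x)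
                + β * iteratedDeriv 2 w x ^ 2
                + 2 * γ * (w x * iteratedDeriv 2 w x + deriv w x ^ 2) - 6 * c₁ * w x = 0) ∧
              ∀ x ∈ X, ∀ t ∈ T, u x t = w x * ψ t))) ∧
    -- second reduction
    (α = 0 → β = 0 → γ = 0 → ∀ s c₀ c₁ c₂ c₃ : ℝ, s ≠ 0 → s ^ 2 = κ →
      ∀ u : ℝ → ℝ → ℝ, SmoothOnRect X T u →
        (IsInvariantSolution α β γ κ 0 X T (fun _ _ _ => s) (phiTwo s c₀ c₁ c₂ c₃) u ↔
          ∃ w : ℝ → ℝ, ContDiffOn ℝ ∞ w ((fun p : ℝ × ℝ => p.1 - s * p.2) '' (X ×ˢ T)) ∧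
            (∀ x ∈ X, ∀ t ∈ T, s * iteratedDeriv 4 w (x - s * t) + 3 * c₃ = 0) ∧
            ∀ x ∈ X, ∀ t ∈ T, u x t = w (x - s * t) + c₃ / (8 * s) * (x + s * t) ^ 4
              + c₂ / (6 * s) * (x + s * t) ^ 3 + c₁ / (4 * s) * (x + s * t) ^ 2 + c₀ * t) ∧
        (IsInvariantSolution α β γ κ 0 X T (fun _ _ _ => s) (phiTwo s c₀ c₁ c₂ c₃) u ↔
          ∃ c₄ c₅ c₆ c₇ : ℝ, ∀ x ∈ X, ∀ t ∈ T,
            u x t = -(c₃ / (8 * s)) * (x - s * t) ^ 4 + c₄ * (x - s * t) ^ 3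
              + c₅ * (x - s * t) ^ 2 + c₆ * (x - s * t) + c₇
              + c₃ / (8 * s) * (x + s * t) ^ 4 + c₂ / (6 * s) * (x + s * t) ^ 3
              + c₁ / (4 * s) * (x + s * t) ^ 2 + c₀ * t)) ∧
    -- third reduction
    (α = 0 → β = 0 → γ = 0 → κ = 0 → ∀ (g G : ℝ → ℝ) (c₀ c₁ c₂ c₃ c₄ : ℝ),
      ContDiffOn ℝ ∞ g T → (∀ t ∈ T, g t ≠ 0) → (∀ t ∈ T, HasDerivAt G (g t ^ 2) t) →
      (SolvesOdeThree T c₄ g ↔ ∃ c₅ : ℝ, ∀ t ∈ T, g t * iteratedDeriv 2 g t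
        - 2 * deriv g t ^ 2 + 24 * c₄ * g t * G t + 24 * c₅ * g t = 0) ∧
      ∀ c₅ : ℝ, (∀ t ∈ T, g t * iteratedDeriv 2 g t
          - 2 * deriv g t ^ 2 + 24 * c₄ * g t * G t + 24 * c₅ * g t = 0) →
        ∀ u : ℝ → ℝ → ℝ, SmoothOnRect X T u → (∃ x ∈ X, ∃ t ∈ T, u x t ≠ 0) →
          (IsInvariantSolution α β γ κ 0 X T (fun _ _ _ => 0) (phiThree g c₀ c₁ c₂ c₃ c₄) u ↔
            ∃ w : ℝ → ℝ, ContDiffOn ℝ ∞ w X ∧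
              (∀ x ∈ X, iteratedDeriv 4 w x - 24 * c₅ = 0) ∧
              ∀ x ∈ X, ∀ t ∈ T,
                u x t = 1 / g t * (w x + quartic c₀ c₁ c₂ c₃ c₄ x * G t)) ∧
          (IsInvariantSolution α β γ κ 0 X T (fun _ _ _ => 0) (phiThree g c₀ c₁ c₂ c₃ c₄) u ↔
            ∃ c₆ c₇ c₈ c₉ : ℝ, ∀ x ∈ X, ∀ t ∈ T,
              u x t = 1 / g t * (c₅ * x ^ 4 + c₆ * x ^ 3 + c₇ * x ^ 2 + c₈ * x + c₉
                + quartic c₀ c₁ c₂ c₃ c₄ x * G t))) := by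
  refine ⟨?_, ?_, ?_, ?_, ?_⟩
  · rintro ξ φ (⟨g, h⟩ | ⟨s, c₀, c₁, c₂, c₃, h⟩ | ⟨g, c₀, c₁, c₂, c₃, c₄, h⟩)
    · exact isNonclassicalSymmetry_of_kindOne hX hT hU h
    · exact isNonclassicalSymmetry_of_kindTwo hX hT hU h
    · exact isNonclassicalSymmetry_of_kindThree hX hT hU h
  · intro ξ φ hξ hφ
    constructor
    · rintro ⟨hn, hcl⟩
      obtain ⟨a, A, C, ha, hA, hC, h1, h2, hS⟩ := hn.exists_affineSystem hX hT hU hU' hU'' hξ hφ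
      by_cases hκ : κ = 0
      · subst hκ
        rcases classification_kappa_zero hX hX' hX'' hT hT' hU ha hA hC h1 h2 hS hcl with h | h
        · exact Or.inl h
        · exact Or.inr (Or.inr h)
      · exact Or.inr (Or.inl
          (classification_kappa_ne_zero hX hX' hX'' hT hT' hU hκ ha hA hC h1 h2 hS hcl))
    · rintro (⟨g, h, hne⟩ | ⟨s, c₀, c₁, c₂, c₃, h, hne⟩ | ⟨g, c₀, c₁, c₂, c₃, c₄, h, hne⟩)
      · exact ⟨isNonclassicalSymmetry_of_kindOne hX hT hU h,
          not_isClassicalUpToFactor_of_kindOne hX hX' hX'' hT hU hU' hU'' hφ h hne⟩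
      · exact ⟨isNonclassicalSymmetry_of_kindTwo hX hT hU h,
          not_isClassicalUpToFactor_of_kindTwo hX hX' hX'' hT hT'' hU hU' hU'' hφ h hne⟩
      · exact ⟨isNonclassicalSymmetry_of_kindThree hX hT hU h,
          not_isClassicalUpToFactor_of_kindThree hX hX' hX'' hT hT'' hU hU' hU'' hφ h hne⟩
  · intro g hg hg0
    refine ⟨⟨fun h => h.exists_isLogPrimitive hT hT' hT'' hg, fun ⟨ψ, c₁, c₂, h⟩ =>
      h.solvesOdeOne hT hT' hg0⟩, fun ψ c₁ c₂ h => ⟨h.constants_ne_zero hg0, ?_, ?_, ?_, ?_⟩⟩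
    · rintro rfl
      exact h.exists_eq_linear hT hT' hg0
    · rintro rfl
      exact h.exists_eq_inv_sq hT hT' hg0
    · refine fun _ _ => ⟨_, rfl, fun t ht => ?_⟩
      rw [deriv_const_mul_field]
      linear_combination c₁ ^ 2 * (h.2 t ht).2.2
    · rintro rfl u hu
      exact isInvariantSolution_phiOne_iff hX hT hT' hg0 h hu
  · rintro rfl rfl rfl s c₀ c₁ c₂ c₃ hs rfl u hu
    have hmain := isInvariantSolution_phiTwo_iff (c₀ := c₀) (c₁ := c₁) (c₂ := c₂) (c₃ := c₃) hX hX'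
      hT hT' hs hu
    refine ⟨hmain.trans ?_, hmain⟩
    have hprof := exists_profile_iff (c₃ := c₃) hX hX' hT' hs (v := fun x t => u x t
      - (c₃ / (8 * s) * (x + s * t) ^ 4 + c₂ / (6 * s) * (x + s * t) ^ 3
        + c₁ / (4 * s) * (x + s * t) ^ 2 + c₀ * t))
    refine Iff.trans ?_ (hprof.symm.trans ?_)
    · refine exists₄_congr fun c₄ c₅ c₆ c₇ => forall₂_congr fun x _ => forall₂_congr fun t _ => ?_
      rw [quartic]
      exact ⟨fun h => by linear_combination h, fun h => by linear_combination h⟩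
    · refine exists_congr fun w => and_congr_right fun _ => and_congr_right fun _ =>
        forall₂_congr fun x _ => forall₂_congr fun t _ => ?_
      exact ⟨fun h => by linear_combination h, fun h => by linear_combination h⟩
  · rintro rfl rfl rfl rfl g G c₀ c₁ c₂ c₃ c₄ hg hg0 hG
    refine ⟨solvesOdeThree_iff_exists_const hT hT' hT'' hg hg0 hG, fun c₅ hc u hu hu0 => ?_⟩
    have hmain := isInvariantSolution_phiThree_iff (c₀ := c₀) (c₁ := c₁) (c₂ := c₂) (c₃ := c₃)
      hX hX' hT hT' hT'' hu hg hg0 hG hc hu0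
    exact ⟨hmain, hmain.trans (exists_quartic_profile_iff hX hX' (r := fun t => 1 / g t)
      (P := quartic c₀ c₁ c₂ c₃ c₄) (K := G))⟩
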